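/- **Setting.** Let $\Gamma\subset O(4)$ be a finite group and let $f:\mathbb R^4\to\mathbb R^4$ be a $\Gamma$-equivariant vector field of class $C^n$, where $n\ge 1$ is fixed ($n=\infty$ and $n=\omega$ are allowed). Write $\mathrm{Fix}(H)$ for the space of points fixed by a subgroup $H\le\Gamma$. A *(robust) heteroclinic cycle* of $\dot y=f(y)$ consists of distinct equilibria (nodes) $\xi_1,\dots,\xi_m$, not all in one $\Gamma$-orbit, and of trajectories $[\xi_j\to\xi_{j+1}]$ from $\xi_j$ to $\xi_{j+1}$ (indices modulo $m$). Each trajectory $[\xi_j\to\xi_{j+1}]$ lies in a space $P_j=\mathrm{Fix}(\Sigma_j)$, where $\Sigma_j$ is an isotropy subgroup of $\Gamma$, and for the flow restricted to $P_j$ the node $\xi_j$ is a hyperbolic saddle and $\xi_{j+1}$ a hyperbolic sink. Put $L_j=P_{j-1}\cap P_j$. The cycle $X$ (the union of its nodes and trajectories) is *simple* if $0\notin X$, $\dim P_j=2$ for all $j$, the group orbit $\Gamma X$ meets each connected component of each $L_j\setminus\{0\}$ in at most one point, and no $\mathrm df(\xi_j)$ has a multiple eigenvalue. A simple cycle $X$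 is of *type A* if $\Sigma_j\cong\mathbb Z_2$ for all $j$, of *type B* if $X\subset\mathrm{Fix}(H)$ for some $H\le\Gamma$ with $\dim\mathrm{Fix}(H)=3$, and of *type C* if it is neither of type A nor of type B. A subscript gives the number of $\Gamma$-orbits of nodes of the cycle; the superscript is $-$ if $-\mathrm{Id}\in\Gamma$ and $+$ if $-\mathrm{Id}\notin\Gamma$. Cycles are counted up to symmetry: $X$ and $X'$ count as the same cycle if $\Gamma X=\Gamma X'$. A *heteroclinic network* is a connected union $N$ of finitely many heteroclinic cycles, at least two of them different. It is *simple* if its cycles are simple and $\Gamma N$ meets each connected component of $L_j\setminus\{0\}$ in at most one point, for the lines $L_j$ of all its cycles. *Assumption A* says that (i) every cycle of the network has an elementary building block, that is, a part $[\xi_i\to\dots\to\xi_{i+l}]$ with $\xi_{i+l}=\xi_i$ in which $\xi_i,\dots,\xi_{i+l-1}$ lie in different $\Gamma$-orbits; and (ii) every node lies on a coordinate axis. A $(T_1,\dots,T_r)$ network is one that has, up to symmetry, exactly $r$ cycles, with labels $T_1,\dots,T_r$. **Theorem.** The types of simple heteroclinic networks in $\mathbb R^4$ that satisfy Assumption A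 (for some $\Gamma$ and $f$ as above) are exactly $$(A_2^+,A_2^+),\quad (A_3^-,A_3^-),\quad (A_3^-,A_4^-),\quad (A_3^-,A_3^-,A_4^-),$$ $$(B_2^+,B_2^+),\quad (B_3^-,B_3^-),\quad (B_3^-,C_4^-),\quad (B_3^-,B_3^-,C_4^-).$$ In particular no such network joins an $A_2$ cycle with an $A_3$ or $A_4$ cycle. Moreover, let $\kappa_{ij}$ be the map that changes the sign of the two coordinates other than $x_i,x_j$. A simple $(A_2^+,A_2^+)$ network satisfying Assumption A exists for the group $\Gamma=\langle\kappa_{12},\kappa_{13}\rangle$ and the $\Gamma$-equivariant vector field $$\begin{aligned} \dot x_1&=a_1x_1+\sum_{i=1}^4 b_{1i}x_i^2+c_1x_1^3,\\ \dot x_2&=a_2x_2+\Big(\sum_{i=1}^4 b_{2i}x_i^2\Big)x_2+c_2x_2^2x_3x_4,\\ \dot x_3&=a_3x_3+\Big(\sum_{i=1}^4 b_{3i}x_i^2\Big)x_3+c_3x_2x_3^2x_4,\\ \dot x_4&=a_4x_4+\Big(\sum_{i=1}^4 b_{4i}x_i^2\Big)x_4+c_4x_2x_3x_4^2, \end{aligned}$$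 for suitable real coefficients with all $c_j\neq 0$. Simple networks of each of the types $(A_3^-,A_3^-)$, $(A_3^-,A_4^-)$ and $(A_3^-,A_3^-,A_4^-)$ satisfying Assumption A exist for the group $\Gamma=\langle\kappa_{12},\kappa_{13},\kappa_{34}\rangle$ and the $\Gamma$-equivariant vector field $$\dot x_j=a_jx_j+\Big(\sum_{i=1}^4 b_{ji}x_i^2\Big)x_j+c_j\,x_1x_2x_3x_4\,x_j\qquad(j=1,\dots,4),$$ for suitable real coefficients, depending on the type, with all $c_j\ne0$. -/

import Mathlib

open Filter Topology

noncomputable section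

namespace HetNet

/-- The phase space `ℝ⁴` with its Euclidean structure. -/
abbrev E4 : Type := EuclideanSpace ℝ (Fin 4)

/-- The orthogonal group `O(4)`. -/
abbrev O4 : Type := E4 ≃ₗᵢ[ℝ] E4

/-! ### Groups, orbits, fixed-point spaces -/

/-- `f (γ x) = γ (f x)` for all `γ ∈ Γ`. -/
def IsEquivariant (Γ : Subgroup O4) (f : E4 → E4) : Prop :=
  ∀ γ ∈ Γ, ∀ x : E4, f (γ x) = γ (f x)

/-- `y` lies in the group orbit of `x`. -/
def SameOrbit (Γ : Subgroup O4) (x y : E4) : Prop := ∃ γ ∈ Γ, γ x = y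

/-- The union `Γ X` of all images of a set under the group. -/
def groupOrbit (Γ : Subgroup O4) (X : Set E4) : Set E4 :=
  {y | ∃ γ ∈ Γ, ∃ x ∈ X, γ x = y}

/-- `Fix(S)`. -/
def fixedSpace (S : Subgroup O4) : Submodule ℝ E4 where
  carrier := {x | ∀ γ ∈ S, γ x = x}
  add_mem' := by
    intro a b ha hb γ hγ
    rw [map_add, ha γ hγ, hb γ hγ]
  zero_mem' := by
    intro γ _
    exact map_zero γ
  smul_mem' := by
    intro c x hx γ hγ
    rw [map_smul, hx γ hγ]

/-- The isotropy subgroup of the point `x`. -/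
def isotropy (Γ : Subgroup O4) (x : E4) : Subgroup O4 where
  carrier := {γ | γ ∈ Γ ∧ γ x = x}
  mul_mem' := by
    rintro a b ⟨ha, hax⟩ ⟨hb, hbx⟩
    refine ⟨Γ.mul_mem ha hb, ?_⟩
    calc (a * b) x = a (b x) := rfl
      _ = x := by rw [hbx, hax]
  one_mem' := ⟨Γ.one_mem, rfl⟩
  inv_mem' := by
    rintro a ⟨ha, hax⟩
    refine ⟨Γ.inv_mem ha, ?_⟩
    calc a⁻¹ x = a⁻¹ (a x) := by rw [hax]
      _ = x := a.symm_apply_apply x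

def IsIsotropySubgroup (Γ S : Subgroup O4) : Prop := ∃ x : E4, S = isotropy Γ x

/-! ### Linearization -/

/-- The complex eigenvalues, with algebraic multiplicity, of an endomorphism of a
finite-dimensional real space. -/
def complexEigenvalues {V : Type*} [AddCommGroup V] [Module ℝ V] [Module.Finite ℝ V]
    [Module.Free ℝ V] (A : V →ₗ[ℝ] V) : Multiset ℂ :=
  (A.charpoly.map (algebraMap ℝ ℂ)).roots

/-- The linearization of `f` at `x` on the subspace `P`. If `P` is invariant under `df(x)`, as every
fixed-point space containing `x` is for an equivariant `f`, the projection does nothing and this is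
the restriction of `df(x)` to `P`. -/
def linearizationOn (f : E4 → E4) (P : Submodule ℝ E4) (x : E4) : P →ₗ[ℝ] P :=
  (P.orthogonalProjectionOnto : E4 →ₗ[ℝ] P) ∘ₗ (fderiv ℝ f x : E4 →ₗ[ℝ] E4) ∘ₗ P.subtype

/-- The equilibrium `x` is a (hyperbolic) sink of the flow restricted to `P`. -/
def IsSinkIn (f : E4 → E4) (P : Submodule ℝ E4) (x : E4) : Prop :=
  x ∈ P ∧ f x = 0 ∧ ∀ μ ∈ complexEigenvalues (linearizationOn f P x), μ.re < 0

/-- The equilibrium `x` is a (hyperbolic) saddle of the flow restricted to `P`. -/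
def IsSaddleIn (f : E4 → E4) (P : Submodule ℝ E4) (x : E4) : Prop :=
  x ∈ P ∧ f x = 0 ∧ (∀ μ ∈ complexEigenvalues (linearizationOn f P x), μ.re ≠ 0) ∧
    (∃ μ ∈ complexEigenvalues (linearizationOn f P x), μ.re < 0) ∧
    (∃ μ ∈ complexEigenvalues (linearizationOn f P x), 0 < μ.re)

/-! ### Heteroclinic cycles -/

/-- A robust heteroclinic cycle `[ξ₀ → ξ₁ → ⋯ → ξ_k → ξ₀]` of `ẏ = f(y)`, with `k + 1` distinct
nodes; the addition of indices in `Fin (k + 1)` is cyclic. The `j`-th connection is a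
saddle-sink connection in the fixed-point space of the isotropy subgroup `Sig j`. The last field
says that the cycle is not homoclinic. -/
structure Cycle (Γ : Subgroup O4) (f : E4 → E4) where
  k : ℕ
  node : Fin (k + 1) → E4
  node_injective : Function.Injective node
  traj : Fin (k + 1) → ℝ → E4
  Sig : Fin (k + 1) → Subgroup O4
  isotropy_Sig : ∀ j, IsIsotropySubgroup Γ (Sig j)
  solution : ∀ j t, HasDerivAt (traj j) (f (traj j t)) t
  traj_mem : ∀ j t, traj j t ∈ fixedSpace (Sig j)
  tendsto_source : ∀ j, Tendsto (traj j) atBot (𝓝 (node j))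
  tendsto_target : ∀ j, Tendsto (traj j) atTop (𝓝 (node (j + 1)))
  saddle : ∀ j, IsSaddleIn f (fixedSpace (Sig j)) (node j)
  sink : ∀ j, IsSinkIn f (fixedSpace (Sig j)) (node (j + 1))
  not_homoclinic : ∃ j, ¬ SameOrbit Γ (node 0) (node j)

namespace Cycle

variable {Γ : Subgroup O4} {f : E4 → E4}

/-- The cycle as a subset of `ℝ⁴`: its nodes and connecting trajectories. -/
def carrier (C : Cycle Γ f) : Set E4 :=
  Set.range C.node ∪ ⋃ j, Set.range (C.traj j)

/-- `P_j = Fix(Σ_j)`, the space that contains the connection from `ξ_j` to `ξ_{j+1}`. -/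
def P (C : Cycle Γ f) (j : Fin (C.k + 1)) : Submodule ℝ E4 := fixedSpace (C.Sig j)

/-- `L_j = P_{j-1} ∩ P_j`. -/
def L (C : Cycle Γ f) (j : Fin (C.k + 1)) : Submodule ℝ E4 := C.P (j - 1) ⊓ C.P j

/-- The `Γ`-orbit of `X` meets each connected component of `L_j \ {0}` in at most one point,
for every `j`. -/
def MeetsAxesOnce (C : Cycle Γ f) (X : Set E4) : Prop :=
  ∀ j, ∀ x ∈ (C.L j : Set E4) \ {0},
    (groupOrbit Γ X ∩ connectedComponentIn ((C.L j : Set E4) \ {0}) x).Subsingleton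

/-- Simple cycles. -/
structure IsSimple (C : Cycle Γ f) : Prop where
  zero_notMem : (0 : E4) ∉ C.carrier
  finrank_P : ∀ j, Module.finrank ℝ (C.P j) = 2
  meetsAxesOnce : C.MeetsAxesOnce C.carrier
  no_double_eigenvalue :
    ∀ j, (complexEigenvalues (fderiv ℝ f (C.node j) : E4 →ₗ[ℝ] E4)).Nodup

/-- The part `[ξ_j → ξ_{j+1} → ⋯ → ξ_{j+l}]` of the cycle is a building block. -/
def IsBuildingBlock (C : Cycle Γ f) (j : Fin (C.k + 1)) (l : ℕ) : Prop :=
  0 < l ∧ SameOrbit Γ (C.node j) (C.node (j + Fin.ofNat (C.k + 1) l)) ∧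
    ∀ a : ℕ, 0 < a → a < l → ¬ SameOrbit Γ (C.node j) (C.node (j + Fin.ofNat (C.k + 1) a))

/-- The building block is elementary: its `l` nodes lie in different group orbits, and it
closes up at its first node itself and not merely at a symmetric image of it. -/
def IsElementaryBlock (C : Cycle Γ f) (j : Fin (C.k + 1)) (l : ℕ) : Prop :=
  C.IsBuildingBlock j l ∧
    (∀ a b : ℕ, a < b → b < l →
      ¬ SameOrbit Γ (C.node (j + Fin.ofNat (C.k + 1) a)) (C.node (j + Fin.ofNat (C.k + 1) b))) ∧
    C.node (j + Fin.ofNat (C.k + 1) l) = C.node j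

/-- Type A: every `Σ_j` is cyclic of order two. -/
def IsTypeA (C : Cycle Γ f) : Prop := ∀ j, Nat.card (C.Sig j) = 2

/-- Type B: the cycle lies in a three-dimensional fixed-point space. -/
def IsTypeB (C : Cycle Γ f) : Prop :=
  ∃ H : Subgroup O4, H ≤ Γ ∧ Module.finrank ℝ (fixedSpace H) = 3 ∧
    C.carrier ⊆ (fixedSpace H : Set E4)

/-- The number of different group orbits of nodes. -/
def numOrbits (C : Cycle Γ f) : ℕ :=
  (Set.range fun j => groupOrbit Γ {C.node j}).ncard

end Cycle

/-! ### Labels such as `B₃⁻` -/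

inductive Kind
  | A
  | B
  | C

/-- A type, the number of group orbits of nodes, and the superscript: `negId` is `true` (written
`-`) if `-Id` belongs to the group, and `false` (written `+`) if not. -/
structure Label where
  kind : Kind
  size : ℕ
  negId : Bool

open Classical in
/-- The label of a cycle; type C means neither of type A nor of type B. -/
def Cycle.label {Γ : Subgroup O4} {f : E4 → E4} (C : Cycle Γ f) : Label where
  kind := if C.IsTypeA then Kind.A else if C.IsTypeB then Kind.B else Kind.C
  size := C.numOrbits
  negId := decide ((LinearIsometryEquiv.neg ℝ : O4) ∈ Γ)

def A2 : Label := ⟨Kind.A, 2, false⟩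
def A3 : Label := ⟨Kind.A, 3, true⟩
def A4 : Label := ⟨Kind.A, 4, true⟩
def B2 : Label := ⟨Kind.B, 2, false⟩
def B3 : Label := ⟨Kind.B, 3, true⟩
def C4 : Label := ⟨Kind.C, 4, true⟩

/-! ### Heteroclinic networks -/

/-- A heteroclinic network: a finite connected union of heteroclinic cycles. Cycles are counted up
to symmetry: two of them are the same if their group orbits `Γ C` are the same set. A network
has at least two different cycles. -/
structure Network (Γ : Subgroup O4) (f : E4 → E4) where
  cycles : Set (Cycle Γ f)
  finite_cycles : cycles.Finite
  connected : IsConnected (⋃ C ∈ cycles, C.carrier)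
  two_cycles : ∃ C ∈ cycles, ∃ C' ∈ cycles, groupOrbit Γ C.carrier ≠ groupOrbit Γ C'.carrier

namespace Network

variable {Γ : Subgroup O4} {f : E4 → E4}

def carrier (N : Network Γ f) : Set E4 := ⋃ C ∈ N.cycles, C.carrier

/-- Simple networks. -/
structure IsSimple (N : Network Γ f) : Prop where
  simple_cycles : ∀ C ∈ N.cycles, C.IsSimple
  meetsAxesOnce : ∀ C ∈ N.cycles, C.MeetsAxesOnce N.carrier

/-- Assumption A: every cycle has an elementary building block, and every equilibrium lies on a
coordinate axis. -/
structure AssumptionA (N : Network Γ f) : Prop where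
  elementary : ∀ C ∈ N.cycles, ∃ j l, C.IsElementaryBlock j l
  on_axis : ∀ C ∈ N.cycles, ∀ j, ∃ i : Fin 4, ∀ i' : Fin 4, i' ≠ i → C.node j i' = 0

/-- `N` is a `(τ₁, …, τ_r)` network: its cycles up to symmetry are represented, each exactly once,
by cycles with the labels `τ₁, …, τ_r`. -/
def HasType (N : Network Γ f) (τ : Multiset Label) : Prop :=
  ∃ (r : ℕ) (R : Fin r → Cycle Γ f), (∀ i, R i ∈ N.cycles) ∧
    (∀ C ∈ N.cycles, ∃! i, groupOrbit Γ C.carrier = groupOrbit Γ (R i).carrier) ∧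
    τ = Finset.univ.val.map fun i => (R i).label

end Network

/-- `Γ` is a finite group, `f` is a `Γ`-equivariant vector field of class `C^n`, and `f` has
a simple heteroclinic network of type `τ` that satisfies Assumption A. -/
def Supports (n : WithTop ℕ∞) (Γ : Subgroup O4) (f : E4 → E4) (τ : Multiset Label) : Prop :=
  Finite Γ ∧ ContDiff ℝ n f ∧ IsEquivariant Γ f ∧
    ∃ N : Network Γ f, N.IsSimple ∧ N.AssumptionA ∧ N.HasType τ

/-! ### The groups and vector fields for networks of type A; the coordinates `x₁, …, x₄` are
`x 0, …, x 3`. -/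

/-- The map that changes the sign of the coordinates with index different from `i` and `j`. -/
def kappa (i j : Fin 4) : O4 :=
  LinearIsometryEquiv.piLpCongrRight 2 fun k =>
    if k = i ∨ k = j then LinearIsometryEquiv.refl ℝ ℝ else LinearIsometryEquiv.neg ℝ

/-- `⟨κ₁₂, κ₁₃⟩`. -/
def GammaTwo : Subgroup O4 := Subgroup.closure {kappa 0 1, kappa 0 2}

/-- `⟨κ₁₂, κ₁₃, κ₃₄⟩`. -/
def GammaThree : Subgroup O4 := Subgroup.closure {kappa 0 1, kappa 0 2, kappa 2 3}

def fieldTwo (a : Fin 4 → ℝ) (b : Fin 4 → Fin 4 → ℝ) (c : Fin 4 → ℝ) (x : E4) : E4 :=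
  !₂[a 0 * x 0 + (∑ i, b 0 i * x i ^ 2) + c 0 * x 0 ^ 3,
     a 1 * x 1 + (∑ i, b 1 i * x i ^ 2) * x 1 + c 1 * x 1 ^ 2 * x 2 * x 3,
     a 2 * x 2 + (∑ i, b 2 i * x i ^ 2) * x 2 + c 2 * x 1 * x 2 ^ 2 * x 3,
     a 3 * x 3 + (∑ i, b 3 i * x i ^ 2) * x 3 + c 3 * x 1 * x 2 * x 3 ^ 2]

def fieldThree (a : Fin 4 → ℝ) (b : Fin 4 → Fin 4 → ℝ) (c : Fin 4 → ℝ) (x : E4) : E4 :=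
  WithLp.toLp 2 fun j =>
    a j * x j + (∑ i, b j i * x i ^ 2) * x j + c j * x 0 * x 1 * x 2 * x 3 * x j

end HetNet

end

/-! The classification is linear algebra at the nodes followed by counting. At a node `x` of a
simple cycle the linearization has simple spectrum, so all maps that commute with it commute with
each other, and the isotropy group of `x` is abelian. The incoming and the outgoing plane are
different fixed planes through `x`, because `x` is a sink in one and a saddle in the other.
Commutativity then gives an orthonormal frame, with `b 0` along `x`, `b 1` in the incoming and `b 2`
in the outgoing plane, on which the isotropy group acts by sign changes and which contains the half
turns about both planes among them (`exists_isFrame`).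

Four facts follow. The linearization is diagonal in the frame. Type A means that one node,
equivalently every node, has no orientation-reversing isotropy (`Cycle.isTypeA_iff`). A connection
is determined up to symmetry by its source and its plane, because the unstable manifold in the plane
is a curve whose two halves are exchanged by a half turn (`Cycle.groupOrbit_traj_eq`). A node
perpendicular to its successor is mapped to its negative by a symmetry.

Under Assumption A the nodes lie on coordinate axes and in different group orbits, so two nodes on
one axis lie on opposite half-axes that no symmetry exchanges. Hence either all nodes lie on one
axis, and then there are two of them and `-Id` is not in the group, or they lie on three or four
different axes, and the half turns about the coordinate planes of the connections generate `-Id`.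

If `-Id` belongs to the group, the cycles of a network are directed cycles on the four axes, no two
of which use an edge in opposite directions. There are at most two triangles and at most one
four-cycle of this kind, and any two cycles share an axis, so they are all of type A or none is
(`Network.type_of_neg_mem`). If `-Id` does not belong to the group, connectedness forces all cycles
to have the same two nodes. At one of them there are at most three fixed planes; a cycle is
determined by an outgoing and an incoming plane, and no plane is both, so there are at most two
cycles (`Network.type_of_neg_notMem`).

For existence, polynomial fields are chosen with an invariant circle in each relevant coordinate
plane, on which the connections are solutions of scalar equations. The terms with the coefficients
`c` that break the reflections vanish on these planes. Groups of rotations give type A; groups that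
contain a reflection, with those terms removed, give types B and C. -/

namespace HetNet

/-! ### Linear maps with simple spectrum -/

/-- Over an algebraically closed field, matrices that commute with a matrix with simple spectrum
commute with each other. -/
theorem commute_of_nodup_roots_charpoly {n : Type*} [Fintype n] [DecidableEq n]
    {M N K : Matrix n n ℂ} (hM : M.charpoly.roots.Nodup) (hN : Commute M N) (hK : Commute M K) :
    Commute N K := by
  have hcp : (Matrix.toLin' M).charpoly = M.charpoly := Matrix.charpoly_toLin' M
  let φ : Module.End ℂ (n → ℂ) := Matrix.toLin' M
  let ι := {μ // μ ∈ M.charpoly.roots.toFinset}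
  have hroot : ∀ μ : ι, ∃ v, φ.HasEigenvector μ.1 v := fun μ => by
    have h : φ.HasEigenvalue μ.1 := by
      rw [Module.End.hasEigenvalue_iff_isRoot_charpoly]
      change (Matrix.toLin' M).charpoly.IsRoot μ.1
      rw [hcp]
      exact Polynomial.isRoot_of_mem_roots (Multiset.mem_toFinset.mp μ.2)
    exact h.exists_hasEigenvector
  choose v hv using hroot
  have hli : LinearIndependent ℂ v :=
    φ.eigenvectors_linearIndependent' (fun μ : ι => μ.1) Subtype.val_injective v hv
  -- Over `ℂ` the simple roots are as many as the dimension, so the eigenvectors form a basis.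
  have hcard : Fintype.card ι = Module.finrank ℂ (n → ℂ) := by
    have h1 := Multiset.toFinset_card_of_nodup hM
    have h2 := (IsAlgClosed.splits M.charpoly).natDegree_eq_card_roots
    rw [Fintype.card_coe, h1, ← h2, M.charpoly_natDegree_eq_dim, Module.finrank_fintype_fun_eq_card]
  -- Each eigenspace is a line, and a matrix that commutes with `M` preserves it; so it is diagonal
  -- in the eigenbasis of `M`.
  have key : ∀ B : Matrix n n ℂ, Commute M B → ∀ μ : ι, ∃ c : ℂ, B.mulVec (v μ) = c • v μ := by
    intro B hB μ
    have hle : Module.finrank ℂ (φ.eigenspace μ.1) ≤ 1 := by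
      refine (LinearMap.finrank_eigenspace_le φ μ.1).trans ?_
      change (Matrix.toLin' M).charpoly.rootMultiplicity μ.1 ≤ 1
      rw [hcp, ← Polynomial.count_roots]
      exact Multiset.nodup_iff_count_le_one.mp hM _
    have hmem : B.mulVec (v μ) ∈ φ.eigenspace μ.1 := by
      rw [Module.End.mem_eigenspace_iff]
      have h1 : M.mulVec (v μ) = μ.1 • v μ := (hv μ).apply_eq_smul
      change M.mulVec (B.mulVec (v μ)) = μ.1 • B.mulVec (v μ)
      rw [Matrix.mulVec_mulVec, hB.eq, ← Matrix.mulVec_mulVec, h1, Matrix.mulVec_smul]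
    have hne : (⟨v μ, (hv μ).1⟩ : φ.eigenspace μ.1) ≠ 0 := fun h => (hv μ).2 (congrArg Subtype.val h)
    have h1 : Module.finrank ℂ (φ.eigenspace μ.1) = 1 :=
      le_antisymm hle (Module.finrank_pos_iff_exists_ne_zero.mpr ⟨_, hne⟩)
    obtain ⟨c, hc⟩ := exists_smul_eq_of_finrank_eq_one h1 hne ⟨_, hmem⟩
    exact ⟨c, (congrArg Subtype.val hc).symm⟩
  by_cases hn : Nonempty ι
  · let b := basisOfLinearIndependentOfCardEqFinrank hli hcard
    have : Matrix.toLin' (N * K) = Matrix.toLin' (K * N) := by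
      refine b.ext fun μ => ?_
      obtain ⟨c, hc⟩ := key N hN μ
      obtain ⟨d, hd⟩ := key K hK μ
      have hb : b μ = v μ := by simp [b]
      rw [hb, Matrix.toLin'_apply, Matrix.toLin'_apply, ← Matrix.mulVec_mulVec,
        ← Matrix.mulVec_mulVec, hc, hd, Matrix.mulVec_smul, Matrix.mulVec_smul, hc, hd, smul_comm]
    exact Matrix.toLin'.injective this
  -- Without roots the characteristic polynomial is constant and the matrices have size zero.
  · have h0 : Fintype.card n = 0 := by
      have : Fintype.card ι = 0 := Fintype.card_eq_zero_iff.mpr (not_nonempty_iff.mp hn)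
      rw [← Module.finrank_fintype_fun_eq_card ℂ, ← hcard, this]
    have := Fintype.card_eq_zero_iff.mp h0
    ext i
    exact isEmptyElim i

/-- Linear maps that commute with a linear map with simple spectrum commute with each other. -/
theorem commute_of_nodup_complexEigenvalues {V : Type*} [AddCommGroup V] [Module ℝ V]
    [Module.Finite ℝ V] [Module.Free ℝ V] {A B D : V →ₗ[ℝ] V} (hA : (complexEigenvalues A).Nodup)
    (hB : A ∘ₗ B = B ∘ₗ A) (hD : A ∘ₗ D = D ∘ₗ A) : B ∘ₗ D = D ∘ₗ B := by
  classical
  let b := Module.Free.chooseBasis ℝ V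
  let τ := LinearMap.toMatrix b b
  let c : ℝ →+* ℂ := algebraMap ℝ ℂ
  have hmul : ∀ F G : V →ₗ[ℝ] V, (τ (F ∘ₗ G)).map c = (τ F).map c * (τ G).map c := by
    intro F G
    rw [← Matrix.map_mul, ← LinearMap.toMatrix_comp]
  have hcp : ((τ A).map c).charpoly.roots.Nodup := by
    rw [Matrix.charpoly_map, LinearMap.charpoly_toMatrix]
    exact hA
  have hcomm : ∀ F : V →ₗ[ℝ] V, A ∘ₗ F = F ∘ₗ A → Commute ((τ A).map c) ((τ F).map c) := by
    intro F hF
    change _ * _ = _ * _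
    rw [← hmul, ← hmul, hF]
  have h := commute_of_nodup_roots_charpoly hcp (hcomm B hB) (hcomm D hD)
  have h' : (τ (B ∘ₗ D)).map c = (τ (D ∘ₗ B)).map c := by rw [hmul, hmul]; exact h
  exact τ.injective (Matrix.map_injective (algebraMap ℝ ℂ).injective h')

/-- The spectrum of a linear map that is diagonal in some basis. -/
theorem complexEigenvalues_of_basis {V ι : Type*} [AddCommGroup V] [Module ℝ V]
    [Module.Finite ℝ V] [Module.Free ℝ V] [Fintype ι] (b : Module.Basis ι ℝ V) (A : V →ₗ[ℝ] V)
    (l : ι → ℝ) (h : ∀ i, A (b i) = l i • b i) :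
    complexEigenvalues A = Finset.univ.val.map fun i => (l i : ℂ) := by
  classical
  have hM : LinearMap.toMatrix b b A = Matrix.diagonal l := by
    ext i j
    rw [LinearMap.toMatrix_apply, h]
    simp [Matrix.diagonal_apply, Finsupp.single_apply, eq_comm]
    split_ifs with hij
    · rw [hij]
    · rfl
  rw [complexEigenvalues, ← LinearMap.charpoly_toMatrix A b, hM, Matrix.charpoly_diagonal,
    Polynomial.map_prod]
  simp only [Polynomial.map_sub, Polynomial.map_X, Polynomial.map_C]
  have := Polynomial.roots_multiset_prod_X_sub_C (Finset.univ.val.map fun i => (l i : ℂ))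
  rw [Multiset.map_map] at this
  exact this

/-- The spectrum of the linearization on a plane spanned by two eigenvectors. -/
theorem complexEigenvalues_linearizationOn {f : E4 → E4} {P : Submodule ℝ E4} {x u v : E4}
    {l m : ℝ} (hP : P = Submodule.span ℝ {u, v}) (hli : LinearIndependent ℝ ![u, v])
    (hu : fderiv ℝ f x u = l • u) (hv : fderiv ℝ f x v = m • v) :
    complexEigenvalues (linearizationOn f P x) = {(l : ℂ), (m : ℂ)} := by
  have hrange : P = Submodule.span ℝ (Set.range ![u, v]) := by
    rw [hP, Matrix.range_cons, Matrix.range_cons, Matrix.range_empty, Set.union_empty]; rfl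
  subst hrange
  let b := Module.Basis.span hli
  have hb : ∀ i, ((b i : Submodule.span ℝ (Set.range ![u, v])) : E4) = ![u, v] i :=
    fun i => congrArg Subtype.val (Module.Basis.span_apply hli i)
  have := complexEigenvalues_of_basis b (linearizationOn f _ x) ![l, m] (fun i => by
    have h1 : fderiv ℝ f x (b i : E4) = ((![l, m] i • b i : Submodule.span ℝ (Set.range ![u, v])) : E4) := by
      rw [Submodule.coe_smul, hb]
      fin_cases i
      · exact hu
      · exact hv
    change (Submodule.span ℝ (Set.range ![u, v])).orthogonalProjectionOnto (fderiv ℝ f x (b i : E4)) = _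
    rw [h1, Submodule.orthogonalProjectionOnto_mem_subspace_eq_self])
  rw [this]
  rfl

/-! ### Equivariant vector fields -/

theorem IsEquivariant.fderiv_apply {Γ : Subgroup O4} {f : E4 → E4} (hf : IsEquivariant Γ f)
    (hd : Differentiable ℝ f) {γ : O4} (hγ : γ ∈ Γ) (x v : E4) :
    fderiv ℝ f (γ x) (γ v) = γ (fderiv ℝ f x v) := by
  have hg : HasFDerivAt (γ : E4 → E4) (γ : E4 →L[ℝ] E4) x := (γ : E4 →L[ℝ] E4).hasFDerivAt
  have h1 : HasFDerivAt (fun y => f (γ y)) ((fderiv ℝ f (γ x)).comp (γ : E4 →L[ℝ] E4)) x :=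
    (hd (γ x)).hasFDerivAt.comp x hg
  have h2 : HasFDerivAt (fun y => γ (f y)) ((γ : E4 →L[ℝ] E4).comp (fderiv ℝ f x)) x :=
    (γ : E4 →L[ℝ] E4).hasFDerivAt.comp x (hd x).hasFDerivAt
  have h3 : (fun y => f (γ y)) = fun y => γ (f y) := funext fun y => hf γ hγ y
  rw [h3] at h1
  exact congrArg (fun T : E4 →L[ℝ] E4 => T v) (h1.unique h2)

theorem mem_fixedSpace {S : Subgroup O4} {x : E4} : x ∈ fixedSpace S ↔ ∀ γ ∈ S, γ x = x := Iff.rfl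

theorem mem_isotropy {Γ : Subgroup O4} {γ : O4} {x : E4} : γ ∈ isotropy Γ x ↔ γ ∈ Γ ∧ γ x = x :=
  Iff.rfl

theorem IsIsotropySubgroup.le {Γ S : Subgroup O4} (h : IsIsotropySubgroup Γ S) : S ≤ Γ := by
  obtain ⟨x, rfl⟩ := h
  exact fun γ hγ => hγ.1

/-- An isotropy subgroup consists of all group elements that fix its fixed-point space. -/
theorem IsIsotropySubgroup.mem_iff {Γ S : Subgroup O4} (h : IsIsotropySubgroup Γ S) {γ : O4} :
    γ ∈ S ↔ γ ∈ Γ ∧ ∀ x ∈ fixedSpace S, γ x = x := by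
  obtain ⟨x, rfl⟩ := h
  exact ⟨fun hγ => ⟨hγ.1, fun y hy => hy γ hγ⟩, fun hγ => ⟨hγ.1, hγ.2 x fun δ hδ => hδ.2⟩⟩

/-- At a point where the linearization has simple spectrum, the isotropy group is commutative. -/
theorem isotropy_commute {Γ : Subgroup O4} {f : E4 → E4} (hf : IsEquivariant Γ f)
    (hd : Differentiable ℝ f) {x : E4}
    (hx : (complexEigenvalues (fderiv ℝ f x : E4 →ₗ[ℝ] E4)).Nodup) {γ δ : O4}
    (hγ : γ ∈ isotropy Γ x) (hδ : δ ∈ isotropy Γ x) (v : E4) : γ (δ v) = δ (γ v) := by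
  -- At a fixed point of `γ`, differentiating the equivariance says that `γ` commutes with the
  -- linearization.
  have key : ∀ γ ∈ isotropy Γ x, (fderiv ℝ f x : E4 →ₗ[ℝ] E4) ∘ₗ (γ.toLinearEquiv : E4 →ₗ[ℝ] E4) =
      (γ.toLinearEquiv : E4 →ₗ[ℝ] E4) ∘ₗ (fderiv ℝ f x : E4 →ₗ[ℝ] E4) := by
    intro γ hγ
    ext1 v
    have := hf.fderiv_apply hd hγ.1 x v
    rw [hγ.2] at this
    exact this
  exact LinearMap.congr_fun (commute_of_nodup_complexEigenvalues hx (key γ hγ) (key δ hδ)) v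

end HetNet

/-! ### Existence of a frame adapted to a node and its two fixed planes. -/

namespace HetNet

open scoped InnerProductSpace

/-- A plane has an orthonormal basis that starts with a given unit vector. -/
theorem exists_orthonormal_span_pair {P : Submodule ℝ E4} (hP : Module.finrank ℝ P = 2) {u : E4}
    (hu : u ∈ P) (hn : ‖u‖ = 1) :
    ∃ v ∈ P, ‖v‖ = 1 ∧ ⟪u, v⟫_ℝ = 0 ∧ P = Submodule.span ℝ {u, v} := by
  have hcard : Module.finrank ℝ P = Fintype.card (Fin 2) := by rw [hP]; rfl
  have ho : Orthonormal ℝ (Set.domRestrict {(0 : Fin 2)} fun _ => (⟨u, hu⟩ : P)) := by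
    constructor
    · intro i; exact hn
    · intro i j hij
      exact absurd (Subsingleton.elim i j) hij
  obtain ⟨b, hb⟩ := ho.exists_orthonormalBasis_extension_of_card_eq hcard
  have hb0 : ((b 0 : P) : E4) = u := congrArg Subtype.val (hb 0 rfl)
  refine ⟨b 1, (b 1).2, b.orthonormal.1 1, ?_, ?_⟩
  · have := b.orthonormal.2 (show (0 : Fin 2) ≠ 1 by decide)
    rw [← hb0]; exact this
  · refine le_antisymm (fun y hy => ?_) (Submodule.span_le.mpr ?_)
    · have h := congrArg Subtype.val (b.sum_repr ⟨y, hy⟩)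
      rw [Fin.sum_univ_two] at h
      rw [Submodule.mem_span_pair]
      exact ⟨_, _, by rw [← hb0]; exact h⟩
    · rintro y (rfl | rfl)
      · exact hu
      · exact (b 1).2

theorem isometry_apply_eq_or_neg {γ : O4} {v : E4} {c : ℝ} (hv : ‖v‖ = 1) (h : γ v = c • v) :
    γ v = v ∨ γ v = -v := by
  have h1 : |c| = 1 := by
    have := γ.norm_map v
    rwa [h, norm_smul, hv, mul_one, Real.norm_eq_abs] at this
  rcases (abs_eq zero_le_one).mp h1 with rfl | rfl
  · left; rw [h, one_smul]
  · right; rw [h, neg_one_smul]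

/-- Since `γ` fixes `u`, it preserves the orthogonal complement, so the image of `v` stays on the
line of `v` inside the plane. -/
theorem isometry_apply_eq_or_neg_of_mem_span_pair {γ : O4} {u v : E4} (hu : γ u = u)
    (hun : ‖u‖ = 1) (hv : ‖v‖ = 1) (huv : ⟪u, v⟫_ℝ = 0) (h : γ v ∈ Submodule.span ℝ {u, v}) :
    γ v = v ∨ γ v = -v := by
  obtain ⟨a, c, hac⟩ := Submodule.mem_span_pair.mp h
  have h1 : ⟪u, γ v⟫_ℝ = 0 := by
    rw [← huv]; nth_rewrite 1 [← hu]; exact γ.inner_map_map u v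
  rw [← hac, inner_add_right, inner_smul_right, inner_smul_right, huv, mul_zero, add_zero,
    real_inner_self_eq_norm_sq, hun] at h1
  have ha : a = 0 := by simpa using h1
  rw [ha, zero_smul, zero_add] at hac
  exact isometry_apply_eq_or_neg hv hac.symm

/-- If a group acts by signs on two lines and fixes neither, some element reverses both. -/
theorem exists_mem_neg_neg {T : Subgroup O4} {u w : E4} (hu : ∀ γ ∈ T, γ u = u ∨ γ u = -u)
    (hw : ∀ γ ∈ T, γ w = w ∨ γ w = -w) (hu' : u ∉ fixedSpace T) (hw' : w ∉ fixedSpace T) :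
    ∃ ρ ∈ T, ρ u = -u ∧ ρ w = -w := by
  simp only [mem_fixedSpace, not_forall] at hu' hw'
  obtain ⟨γ, hγ, hγu⟩ := hu'
  obtain ⟨δ, hδ, hδw⟩ := hw'
  replace hγu := (hu γ hγ).resolve_left hγu
  replace hδw := (hw δ hδ).resolve_left hδw
  rcases hw γ hγ with h | h
  · rcases hu δ hδ with h' | h'
    · refine ⟨γ * δ, T.mul_mem hγ hδ, ?_, ?_⟩
      · change γ (δ u) = _; rw [h', hγu]
      · change γ (δ w) = _; rw [hδw, map_neg, h]
    · exact ⟨δ, hδ, h', hδw⟩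
  · exact ⟨γ, hγ, hγu, h⟩

/-- An orthonormal basis adapted to a point `x` in which two fixed planes `P`, `Q` intersect: the
isotropy group of `x` acts by sign changes and contains the half turns about `P` and `Q`. -/
structure IsFrame (Γ : Subgroup O4) (x : E4) (P Q : Submodule ℝ E4)
    (b : OrthonormalBasis (Fin 4) ℝ E4) : Prop where
  x_eq : x = ‖x‖ • b 0
  P_eq : P = Submodule.span ℝ {b 0, b 1}
  Q_eq : Q = Submodule.span ℝ {b 0, b 2}
  diag : ∀ γ ∈ isotropy Γ x, ∀ i, γ (b i) = b i ∨ γ (b i) = -b i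
  halfTurn_P : ∃ ρ ∈ Γ, ρ (b 0) = b 0 ∧ ρ (b 1) = b 1 ∧ ρ (b 2) = -b 2 ∧ ρ (b 3) = -b 3
  halfTurn_Q : ∃ ρ ∈ Γ, ρ (b 0) = b 0 ∧ ρ (b 1) = -b 1 ∧ ρ (b 2) = b 2 ∧ ρ (b 3) = -b 3

theorem OrthonormalBasis.notMem_span_pair (b : OrthonormalBasis (Fin 4) ℝ E4) {i j k : Fin 4}
    (hi : k ≠ i) (hj : k ≠ j) : b k ∉ Submodule.span ℝ {b i, b j} := by
  intro h
  obtain ⟨a, c, h⟩ := Submodule.mem_span_pair.mp h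
  have h1 := congrArg (fun y => ⟪b k, y⟫_ℝ) h
  simp only [inner_add_right, inner_smul_right] at h1
  rw [b.orthonormal.2 hi, b.orthonormal.2 hj, real_inner_self_eq_norm_sq, b.orthonormal.1] at h1
  norm_num at h1

/-- Both `S` and `T` lie in the isotropy group of `x`, which is commutative by `hc` and therefore
preserves both planes. It acts by a sign on the direction perpendicular to `x` in each plane, and
then also on the one direction that remains. -/
theorem exists_isFrame {Γ S T : Subgroup O4} {x : E4} (hS : S ≤ Γ) (hT : T ≤ Γ)
    (hxS : x ∈ fixedSpace S) (hxT : x ∈ fixedSpace T) (hx : x ≠ 0)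
    (hfS : Module.finrank ℝ (fixedSpace S) = 2) (hfT : Module.finrank ℝ (fixedSpace T) = 2)
    (hne : fixedSpace S ≠ fixedSpace T)
    (hc : ∀ γ ∈ isotropy Γ x, ∀ δ ∈ isotropy Γ x, ∀ v, γ (δ v) = δ (γ v)) :
    ∃ b, IsFrame Γ x (fixedSpace S) (fixedSpace T) b := by
  have hx0 : ‖x‖ ≠ 0 := norm_ne_zero_iff.mpr hx
  set u : E4 := ‖x‖⁻¹ • x with hu
  have hxu : x = ‖x‖ • u := by rw [hu, smul_smul, mul_inv_cancel₀ hx0, one_smul]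
  have hun : ‖u‖ = 1 := by rw [hu, norm_smul, norm_inv, norm_norm, inv_mul_cancel₀ hx0]
  have hSi : ∀ γ ∈ S, γ ∈ isotropy Γ x := fun γ hγ => ⟨hS hγ, hxS γ hγ⟩
  have hTi : ∀ γ ∈ T, γ ∈ isotropy Γ x := fun γ hγ => ⟨hT hγ, hxT γ hγ⟩
  have hiu : ∀ γ ∈ isotropy Γ x, γ u = u := fun γ hγ => by rw [hu, map_smul, hγ.2]
  obtain ⟨v, hvS, hvn, huv, hPv⟩ := exists_orthonormal_span_pair hfS (Submodule.smul_mem _ _ hxS) hun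
  obtain ⟨w, hwT, hwn, huw, hQw⟩ := exists_orthonormal_span_pair hfT (Submodule.smul_mem _ _ hxT) hun
  -- A map that commutes with `R` preserves the fixed-point space of `R`.
  have hpres : ∀ R : Subgroup O4, (∀ γ ∈ R, γ ∈ isotropy Γ x) → ∀ γ ∈ isotropy Γ x,
      ∀ y ∈ fixedSpace R, γ y ∈ fixedSpace R := by
    intro R hR γ hγ y hy δ hδ
    rw [hc δ (hR δ hδ) γ hγ, hy δ hδ]
  have hiv : ∀ γ ∈ isotropy Γ x, γ v = v ∨ γ v = -v := fun γ hγ =>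
    isometry_apply_eq_or_neg_of_mem_span_pair (hiu γ hγ) hun hvn huv (hPv ▸ hpres S hSi γ hγ v hvS)
  have hiw : ∀ γ ∈ isotropy Γ x, γ w = w ∨ γ w = -w := fun γ hγ =>
    isometry_apply_eq_or_neg_of_mem_span_pair (hiu γ hγ) hun hwn huw (hQw ▸ hpres T hTi γ hγ w hwT)
  have hvT : v ∉ fixedSpace T := fun h => by
    refine hne (Submodule.eq_of_le_of_finrank_eq ?_ (hfS.trans hfT.symm))
    rw [hPv, Submodule.span_le]
    rintro y (rfl | rfl)
    · exact Submodule.smul_mem _ _ hxT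
    · exact h
  have hwS : w ∉ fixedSpace S := fun h => by
    refine hne (Submodule.eq_of_le_of_finrank_eq ?_ (hfT.trans hfS.symm)).symm
    rw [hQw, Submodule.span_le]
    rintro y (rfl | rfl)
    · exact Submodule.smul_mem _ _ hxS
    · exact h
  -- Some element of `T` reverses `v` and fixes `w`, so the two are perpendicular.
  have hvw : ⟪v, w⟫_ℝ = 0 := by
    simp only [mem_fixedSpace, not_forall] at hvT
    obtain ⟨γ, hγ, hγv⟩ := hvT
    replace hγv := (hiv γ (hTi γ hγ)).resolve_left hγv
    have := γ.inner_map_map v w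
    rw [hγv, hwT γ hγ, inner_neg_left] at this
    linarith
  have ho : Orthonormal ℝ (Set.domRestrict {i : Fin 4 | i ≠ 3} ![u, v, w, 0]) := by
    constructor
    · rintro ⟨i, hi⟩
      fin_cases i
      · exact hun
      · exact hvn
      · exact hwn
      · exact absurd rfl hi
    · rintro ⟨i, hi⟩ ⟨j, hj⟩ hij
      replace hij : i ≠ j := fun h => hij (Subtype.ext h)
      change ⟪![u, v, w, 0] i, ![u, v, w, 0] j⟫_ℝ = 0
      fin_cases i <;> fin_cases j <;> simp at hij hi hj ⊢ <;>
        first | assumption | (rw [real_inner_comm]; assumption)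
  obtain ⟨b, hb⟩ := ho.exists_orthonormalBasis_extension_of_card_eq (by simp)
  have hb0 : b 0 = u := hb 0 (by simp)
  have hb1 : b 1 = v := hb 1 (by simp)
  have hb2 : b 2 = w := hb 2 (by simp)
  have hdiag : ∀ γ ∈ isotropy Γ x, ∀ i, γ (b i) = b i ∨ γ (b i) = -b i := by
    intro γ hγ
    have hlt : ∀ i : Fin 4, i ≠ 3 → γ (b i) = b i ∨ γ (b i) = -b i := by
      intro i hi
      fin_cases i
      · left; change γ (b 0) = b 0; rw [hb0, hiu γ hγ]
      · change γ (b 1) = b 1 ∨ γ (b 1) = -b 1; rw [hb1]; exact hiv γ hγ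
      · change γ (b 2) = b 2 ∨ γ (b 2) = -b 2; rw [hb2]; exact hiw γ hγ
      · exact absurd rfl hi
    intro i
    -- The image of `b 3` is perpendicular to the images of the other three vectors, which are these
    -- vectors up to sign, so it lies on the line of `b 3`.
    by_cases hi : i = 3
    · subst hi
      have h0 : ∀ i : Fin 4, i ≠ 3 → ⟪b i, γ (b 3)⟫_ℝ = 0 := by
        intro i hi
        have h1 := γ.inner_map_map (b i) (b 3)
        rw [b.orthonormal.2 hi] at h1
        rcases hlt i hi with h | h
        · rwa [h] at h1
        · rwa [h, inner_neg_left, neg_eq_zero] at h1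
      have h1 := b.sum_repr' (γ (b 3))
      rw [Fin.sum_univ_four, h0 0 (by decide), h0 1 (by decide), h0 2 (by decide)] at h1
      simp only [zero_smul, zero_add] at h1
      exact isometry_apply_eq_or_neg (b.orthonormal.1 3) h1.symm
    · exact hlt i hi
  have hP : fixedSpace S = Submodule.span ℝ {b 0, b 1} := by rw [hb0, hb1]; exact hPv
  have hQ : fixedSpace T = Submodule.span ℝ {b 0, b 2} := by rw [hb0, hb2]; exact hQw
  refine ⟨b, ⟨by rw [hb0]; exact hxu, hP, hQ, hdiag, ?_, ?_⟩⟩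
  -- Neither `b 2` nor `b 3` is fixed by `S`, since the fixed plane is spanned by `b 0` and `b 1`;
  -- an element that reverses both is the half turn.
  · obtain ⟨ρ, hρ, h2, h3⟩ := exists_mem_neg_neg (T := S) (fun γ hγ => hdiag γ (hSi γ hγ) 2)
      (fun γ hγ => hdiag γ (hSi γ hγ) 3)
      (hP ▸ OrthonormalBasis.notMem_span_pair b (by decide) (by decide))
      (hP ▸ OrthonormalBasis.notMem_span_pair b (by decide) (by decide))
    refine ⟨ρ, hS hρ, ?_, ?_, h2, h3⟩
    · rw [hb0]; exact hiu ρ (hSi ρ hρ)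
    · rw [hb1]; exact hvS ρ hρ
  · obtain ⟨ρ, hρ, h2, h3⟩ := exists_mem_neg_neg (T := T) (fun γ hγ => hdiag γ (hTi γ hγ) 1)
      (fun γ hγ => hdiag γ (hTi γ hγ) 3)
      (hQ ▸ OrthonormalBasis.notMem_span_pair b (by decide) (by decide))
      (hQ ▸ OrthonormalBasis.notMem_span_pair b (by decide) (by decide))
    refine ⟨ρ, hT hρ, ?_, h2, ?_, h3⟩
    · rw [hb0]; exact hiu ρ (hTi ρ hρ)
    · rw [hb2]; exact hwT ρ hρ

end HetNet

namespace HetNet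
open scoped InnerProductSpace

/-! ### Solutions of `C¹` vector fields -/

/-- A `C¹` field is locally Lipschitz, so the set of times at which the solutions agree is open as
well as closed in `ℝ`. -/
theorem solution_unique {f : E4 → E4} (hf : ContDiff ℝ 1 f) {z w : ℝ → E4}
    (hz : ∀ t, HasDerivAt z (f (z t)) t) (hw : ∀ t, HasDerivAt w (f (w t)) t) {t₀ : ℝ}
    (h : z t₀ = w t₀) : z = w := by
  have hzc : Continuous z := continuous_iff_continuousAt.mpr fun t => (hz t).continuousAt
  have hwc : Continuous w := continuous_iff_continuousAt.mpr fun t => (hw t).continuousAt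
  have hclopen : IsClopen {t | z t = w t} := by
    refine ⟨isClosed_eq hzc hwc, isOpen_iff_mem_nhds.mpr fun t ht => ?_⟩
    obtain ⟨K, s, hs, hK⟩ := (hf.contDiffAt (x := z t)).exists_lipschitzOnWith
    refine ODE_solution_unique_of_eventually (v := fun _ => f) (s := fun _ => s) (K := K)
      (Eventually.of_forall fun _ => hK) ?_ ?_ ht
    · filter_upwards [hzc.continuousAt.eventually_mem hs] with r hr using ⟨hz r, hr⟩
    · have hs' : s ∈ 𝓝 (w t) := by rw [← show z t = w t from ht]; exact hs
      filter_upwards [hwc.continuousAt.eventually_mem hs'] with r hr using ⟨hw r, hr⟩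
  have huniv := hclopen.eq_univ ⟨t₀, h⟩
  funext t
  exact (huniv ▸ Set.mem_univ t : t ∈ {t | z t = w t})

theorem solution_shift {f : E4 → E4} {z : ℝ → E4} (hz : ∀ t, HasDerivAt z (f (z t)) t) (s t : ℝ) :
    HasDerivAt (fun t => z (t + s)) (f (z (t + s))) t :=
  (hz (t + s)).comp_add_const t s

theorem solution_eq_shift {f : E4 → E4} (hf : ContDiff ℝ 1 f) {z w : ℝ → E4}
    (hz : ∀ t, HasDerivAt z (f (z t)) t) (hw : ∀ t, HasDerivAt w (f (w t)) t) {a c : ℝ}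
    (h : z a = w c) : (fun t => z (t + (a - c))) = w :=
  solution_unique hf (t₀ := c) (solution_shift hz _) hw (by simpa using h)

theorem range_eq_of_solution {f : E4 → E4} (hf : ContDiff ℝ 1 f) {z w : ℝ → E4}
    (hz : ∀ t, HasDerivAt z (f (z t)) t) (hw : ∀ t, HasDerivAt w (f (w t)) t) {a c : ℝ}
    (h : z a = w c) : Set.range z = Set.range w := by
  rw [← solution_eq_shift hf hz hw h]
  ext y
  constructor
  · rintro ⟨t, rfl⟩
    exact ⟨t - (a - c), by simp⟩
  · rintro ⟨t, rfl⟩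
    exact ⟨_, rfl⟩

/-- A solution through an equilibrium is constant. -/
theorem solution_eq_const {f : E4 → E4} (hf : ContDiff ℝ 1 f) {z : ℝ → E4} {x : E4}
    (hz : ∀ t, HasDerivAt z (f (z t)) t) (hx : f x = 0) {t₀ : ℝ} (h : z t₀ = x) :
    z = fun _ => x :=
  solution_unique hf hz (fun t => by rw [hx]; exact hasDerivAt_const t x) h

/-! ### Uniqueness of the unstable manifold of a planar saddle -/

/-- The left-hand side is the derivative of `p ^ 2 - q ^ 2` along the difference of two solutions,
where `p` and `q` are its stable and unstable coordinates and `a`, `e` are linearization errors. The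
linear part contributes at most `-2 * c * r ^ 2`; errors bounded by `c / 2 * r` contribute at most
`2 * c * r ^ 2`. -/
theorem saddle_cone_estimate {l m c p q a e r : ℝ} (hl : l ≤ -c) (hm : c ≤ m)
    (hr : r ^ 2 = p ^ 2 + q ^ 2) (hr0 : 0 ≤ r) (ha : |a| ≤ c / 2 * r) (he : |e| ≤ c / 2 * r) :
    2 * p * (l * p + a) - 2 * q * (m * q + e) ≤ 0 := by
  have hp : |p| ≤ r := abs_le_of_sq_le_sq' (by nlinarith [sq_nonneg q]) hr0 |> abs_le.mpr
  have hq : |q| ≤ r := abs_le_of_sq_le_sq' (by nlinarith [sq_nonneg p]) hr0 |> abs_le.mpr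
  have h1 : |p * a| ≤ r * (c / 2 * r) := by
    rw [abs_mul]; exact mul_le_mul hp ha (abs_nonneg _) hr0
  have h2 : |q * e| ≤ r * (c / 2 * r) := by
    rw [abs_mul]; exact mul_le_mul hq he (abs_nonneg _) hr0
  have h3 := (abs_le.mp h1).2
  have h4 := (abs_le.mp h2).1
  rw [show r * (c / 2 * r) = c / 2 * (p ^ 2 + q ^ 2) by rw [← hr]; ring] at h3 h4
  linarith [mul_le_mul_of_nonneg_right hl (sq_nonneg p),
    mul_le_mul_of_nonneg_right hm (sq_nonneg q)]

/-- Two solutions that emanate from a planar saddle agree where their unstable coordinates do. -/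
theorem saddle_cone {f : E4 → E4} (hf : ContDiff ℝ 1 f) {x u v : E4} {l m : ℝ}
    (hu : ‖u‖ = 1) (hv : ‖v‖ = 1) (huv : ⟪u, v⟫_ℝ = 0) (hl : l < 0) (hm : 0 < m)
    (hAu : fderiv ℝ f x u = l • u) (hAv : fderiv ℝ f x v = m • v) :
    ∃ U ∈ 𝓝 x, ∀ z w : ℝ → E4, (∀ t, HasDerivAt z (f (z t)) t) → (∀ t, HasDerivAt w (f (w t)) t) →
      (∀ t, z t ∈ Submodule.span ℝ {u, v}) → (∀ t, w t ∈ Submodule.span ℝ {u, v}) →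
      Tendsto z atBot (𝓝 x) → Tendsto w atBot (𝓝 x) →
      ∀ t₀, (∀ t ≤ t₀, z t ∈ U ∧ w t ∈ U) → ⟪v, z t₀⟫_ℝ = ⟪v, w t₀⟫_ℝ → z t₀ = w t₀ := by
  set c := min (-l) m with hc
  have hc0 : 0 < c := lt_min (neg_pos.mpr hl) hm
  have hstrict : HasStrictFDerivAt f (fderiv ℝ f x) x :=
    hf.contDiffAt.hasStrictFDerivAt one_ne_zero
  -- Strict differentiability is needed, because the estimate compares two moving points and not a
  -- point with `x`.
  have hev : ∀ᶠ r : E4 × E4 in 𝓝 x ×ˢ 𝓝 x,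
      ‖f r.1 - f r.2 - fderiv ℝ f x (r.1 - r.2)‖ ≤ c / 2 * ‖r.1 - r.2‖ := by
    rw [← nhds_prod_eq]
    exact hstrict.isLittleO.def (half_pos hc0)
  obtain ⟨U, hU, hUU⟩ := mem_prod_self_iff.mp hev
  refine ⟨U, hU, fun z w hz hw hzP hwP hzl hwl t₀ hmem hq => ?_⟩
  let p : ℝ → ℝ := fun t => ⟪u, z t - w t⟫_ℝ
  let q : ℝ → ℝ := fun t => ⟪v, z t - w t⟫_ℝ
  have hdecomp : ∀ t, z t - w t = p t • u + q t • v := by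
    intro t
    obtain ⟨a, b, hab⟩ := Submodule.mem_span_pair.mp (Submodule.sub_mem _ (hzP t) (hwP t))
    have hp : p t = a := by
      simp only [p]
      rw [← hab, inner_add_right, inner_smul_right, inner_smul_right, huv, real_inner_self_eq_norm_sq,
        hu]
      ring
    have hq : q t = b := by
      simp only [q]
      rw [← hab, inner_add_right, inner_smul_right, inner_smul_right, real_inner_comm, huv,
        real_inner_self_eq_norm_sq, hv]
      ring
    rw [hp, hq, hab]
  have hnorm : ∀ t, ‖z t - w t‖ ^ 2 = p t ^ 2 + q t ^ 2 := by
    intro t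
    rw [hdecomp, norm_add_sq_real, norm_smul, norm_smul, hu, hv, inner_smul_left, inner_smul_right,
      huv]
    simp
  have hder : ∀ (y : E4) t, HasDerivAt (fun t => ⟪y, z t - w t⟫_ℝ) ⟪y, f (z t) - f (w t)⟫_ℝ t := by
    intro y t
    have := (hasDerivAt_const t y).inner ℝ ((hz t).sub (hw t))
    simpa using this
  have hVd : ∀ t, HasDerivAt (fun t => p t ^ 2 - q t ^ 2)
      (2 * p t * ⟪u, f (z t) - f (w t)⟫_ℝ - 2 * q t * ⟪v, f (z t) - f (w t)⟫_ℝ) t := by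
    intro t
    exact (((hder u t).fun_pow 2).fun_sub ((hder v t).fun_pow 2)).congr_deriv (by simp [p, q])
  have hVle : ∀ t ≤ t₀,
      2 * p t * ⟪u, f (z t) - f (w t)⟫_ℝ - 2 * q t * ⟪v, f (z t) - f (w t)⟫_ℝ ≤ 0 := by
    intro t ht
    have hest : ‖f (z t) - f (w t) - fderiv ℝ f x (z t - w t)‖ ≤ c / 2 * ‖z t - w t‖ :=
      @hUU (z t, w t) (Set.mk_mem_prod (hmem t ht).1 (hmem t ht).2)
    set e := f (z t) - f (w t) - fderiv ℝ f x (z t - w t) with he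
    have hfe : f (z t) - f (w t) = (p t * l) • u + (q t * m) • v + e := by
      have : fderiv ℝ f x (z t - w t) = (p t * l) • u + (q t * m) • v := by
        rw [hdecomp, map_add, map_smul, map_smul, hAu, hAv, smul_smul, smul_smul]
      rw [he, this]; abel
    have hiu : ⟪u, f (z t) - f (w t)⟫_ℝ = l * p t + ⟪u, e⟫_ℝ := by
      rw [hfe, inner_add_right, inner_add_right, inner_smul_right, inner_smul_right, huv,
        real_inner_self_eq_norm_sq, hu]
      ring
    have hiv : ⟪v, f (z t) - f (w t)⟫_ℝ = m * q t + ⟪v, e⟫_ℝ := by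
      rw [hfe, inner_add_right, inner_add_right, inner_smul_right, inner_smul_right,
        real_inner_comm, huv, real_inner_self_eq_norm_sq, hv]
      ring
    rw [hiu, hiv]
    refine saddle_cone_estimate (c := c) (r := ‖z t - w t‖) ?_ (min_le_right _ _) (hnorm t)
      (norm_nonneg _) ?_ ?_
    · have := min_le_left (-l) m
      linarith
    · refine (abs_real_inner_le_norm u e).trans ?_
      rw [hu, one_mul]; exact hest
    · refine (abs_real_inner_le_norm v e).trans ?_
      rw [hv, one_mul]; exact hest
  -- The function `p ^ 2 - q ^ 2` does not increase and tends to `0` at `-∞`, so `|p| ≤ |q|` at time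
  -- `t₀`, and equal unstable coordinates leave no difference at all.
  have hanti : AntitoneOn (fun t => p t ^ 2 - q t ^ 2) (Set.Iic t₀) := by
    refine antitoneOn_of_deriv_nonpos (convex_Iic t₀)
      (fun t _ => (hVd t).continuousAt.continuousWithinAt)
      (fun t _ => (hVd t).differentiableAt.differentiableWithinAt) fun t ht => ?_
    rw [(hVd t).deriv]
    exact hVle t (Set.mem_Iic.mp (interior_subset (s := Set.Iic t₀) ht))
  have hlim : Tendsto (fun t => p t ^ 2 - q t ^ 2) atBot (𝓝 0) := by
    have hd : Tendsto (fun t => z t - w t) atBot (𝓝 0) := by simpa using hzl.sub hwl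
    have hp : Tendsto p atBot (𝓝 0) := by
      simpa using (tendsto_const_nhds (x := u)).inner (𝕜 := ℝ) hd
    have hq : Tendsto q atBot (𝓝 0) := by
      simpa using (tendsto_const_nhds (x := v)).inner (𝕜 := ℝ) hd
    simpa using (hp.pow 2).sub (hq.pow 2)
  have hV0 : p t₀ ^ 2 - q t₀ ^ 2 ≤ 0 :=
    ge_of_tendsto hlim ((eventually_le_atBot t₀).mono fun t ht => hanti ht Set.self_mem_Iic ht)
  have hq0 : q t₀ = 0 := by simp only [q]; rw [inner_sub_right, hq, sub_self]
  have hp0 : p t₀ = 0 := by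
    rw [hq0] at hV0
    nlinarith [sq_nonneg (p t₀)]
  rw [← sub_eq_zero, hdecomp, hp0, hq0]
  simp

theorem groupOrbit_image {Γ : Subgroup O4} {γ : O4} (hγ : γ ∈ Γ) (X : Set E4) :
    groupOrbit Γ (γ '' X) = groupOrbit Γ X := by
  ext y
  constructor
  · rintro ⟨δ, hδ, _, ⟨x, hx, rfl⟩, rfl⟩
    exact ⟨δ * γ, Γ.mul_mem hδ hγ, x, hx, rfl⟩
  · rintro ⟨δ, hδ, x, hx, rfl⟩
    refine ⟨δ * γ⁻¹, Γ.mul_mem hδ (Γ.inv_mem hγ), γ x, ⟨x, hx, rfl⟩, ?_⟩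
    change δ (γ⁻¹ (γ x)) = δ x
    rw [show γ⁻¹ (γ x) = x from γ.symm_apply_apply x]

/-- Up to a symmetry that reverses the unstable direction, only one nonconstant solution emanates
from a planar saddle. -/
theorem groupOrbit_range_eq_of_saddle {Γ : Subgroup O4} {f : E4 → E4} (hf : ContDiff ℝ 1 f)
    (he : IsEquivariant Γ f) {x u v : E4} {l m : ℝ}
    (hu : ‖u‖ = 1) (hv : ‖v‖ = 1) (huv : ⟪u, v⟫_ℝ = 0) (hl : l < 0) (hm : 0 < m)
    (hAu : fderiv ℝ f x u = l • u) (hAv : fderiv ℝ f x v = m • v) (hx : f x = 0)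
    (hxu : x ∈ Submodule.span ℝ {u}) {ρ : O4} (hρ : ρ ∈ Γ) (hρu : ρ u = u) (hρv : ρ v = -v)
    {z w : ℝ → E4} (hz : ∀ t, HasDerivAt z (f (z t)) t) (hw : ∀ t, HasDerivAt w (f (w t)) t)
    (hzP : ∀ t, z t ∈ Submodule.span ℝ {u, v}) (hwP : ∀ t, w t ∈ Submodule.span ℝ {u, v})
    (hzl : Tendsto z atBot (𝓝 x)) (hwl : Tendsto w atBot (𝓝 x))
    (hzx : ∃ t, z t ≠ x) (hwx : ∃ t, w t ≠ x) :
    groupOrbit Γ (Set.range z) = groupOrbit Γ (Set.range w) := by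
  obtain ⟨U, hU, hcone⟩ := saddle_cone hf hu hv huv hl hm hAu hAv
  obtain ⟨a, rfl⟩ := Submodule.mem_span_singleton.mp hxu
  set x := a • u with hxdef
  have hvx : ⟪v, x⟫_ℝ = 0 := by rw [hxdef, inner_smul_right, real_inner_comm, huv, mul_zero]
  have hρx : ρ x = x := by rw [hxdef, map_smul, hρu]
  have hxP : x ∈ Submodule.span ℝ {u, v} :=
    Submodule.smul_mem _ _ (Submodule.subset_span (Set.mem_insert _ _))
  -- a symmetric image of a nonconstant solution lies on the positive side
  have hpos : ∀ z : ℝ → E4, (∀ t, HasDerivAt z (f (z t)) t) →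
      (∀ t, z t ∈ Submodule.span ℝ {u, v}) → Tendsto z atBot (𝓝 x) → (∃ t, z t ≠ x) →
      ∃ γ ∈ Γ, (∀ t, HasDerivAt (fun t => γ (z t)) (f (γ (z t))) t) ∧
        (∀ t, γ (z t) ∈ Submodule.span ℝ {u, v}) ∧ Tendsto (fun t => γ (z t)) atBot (𝓝 x) ∧
        ∃ T, ∀ t ≤ T, 0 < ⟪v, γ (z t)⟫_ℝ := by
    intro z hz hzP hzl hzx
    obtain ⟨T, hT⟩ := eventually_atBot.mp (hzl.eventually_mem hU)
    -- Comparison with the constant solution at `x`: with the unstable coordinate of `x`, the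
    -- solution would be at `x` and hence constant.
    have hne : ∀ t ≤ T, ⟪v, z t⟫_ℝ ≠ 0 := by
      intro t ht h0
      have h1 : z t = x := hcone z (fun _ => x) hz (fun t => by rw [hx]; exact hasDerivAt_const t x)
        hzP (fun _ => hxP) hzl tendsto_const_nhds t
        (fun s hs => ⟨hT s (hs.trans ht), mem_of_mem_nhds hU⟩) (by rw [h0, hvx])
      obtain ⟨s, hs⟩ := hzx
      exact hs (congrFun (solution_eq_const hf hz hx h1) s)
    have hzc : Continuous z := continuous_iff_continuousAt.mpr fun t => (hz t).continuousAt
    have hqc : ContinuousOn (fun t => ⟪v, z t⟫_ℝ) (Set.Iic T) :=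
      (continuous_const.inner hzc).continuousOn
    have hsign : (∀ t ≤ T, 0 < ⟪v, z t⟫_ℝ) ∨ (∀ t ≤ T, ⟪v, z t⟫_ℝ < 0) := by
      rcases lt_or_gt_of_ne (hne T le_rfl) with h | h
      · right
        intro t ht
        by_contra hcon
        obtain ⟨s, hs, hs0⟩ := isPreconnected_Iic.intermediate_value Set.self_mem_Iic ht hqc
          (show (0 : ℝ) ∈ Set.Icc _ _ from ⟨h.le, not_lt.mp hcon⟩)
        exact hne s hs hs0
      · left
        intro t ht
        by_contra hcon
        obtain ⟨s, hs, hs0⟩ := isPreconnected_Iic.intermediate_value ht Set.self_mem_Iic hqc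
          (show (0 : ℝ) ∈ Set.Icc _ _ from ⟨not_lt.mp hcon, h.le⟩)
        exact hne s hs hs0
    rcases hsign with h | h
    · exact ⟨1, Γ.one_mem, hz, hzP, hzl, T, h⟩
    · refine ⟨ρ, hρ, fun t => ?_, fun t => ?_, ?_, T, fun t ht => ?_⟩
      · rw [he ρ hρ]
        exact ((ρ : E4 →L[ℝ] E4).hasFDerivAt.comp_hasDerivAt t (hz t))
      · obtain ⟨c, d, hcd⟩ := Submodule.mem_span_pair.mp (hzP t)
        rw [← hcd, map_add, map_smul, map_smul, hρu, hρv]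
        exact Submodule.mem_span_pair.mpr ⟨c, -d, by simp⟩
      · have := (ρ.continuous.tendsto x).comp hzl
        rwa [hρx] at this
      · have h1 := ρ.inner_map_map v (z t)
        rw [hρv, inner_neg_left] at h1
        have := h t ht
        linarith
  -- solutions on the positive side agree up to a time shift
  have hsame : ∀ z w : ℝ → E4, (∀ t, HasDerivAt z (f (z t)) t) → (∀ t, HasDerivAt w (f (w t)) t) →
      (∀ t, z t ∈ Submodule.span ℝ {u, v}) → (∀ t, w t ∈ Submodule.span ℝ {u, v}) →
      Tendsto z atBot (𝓝 x) → Tendsto w atBot (𝓝 x) →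
      ∀ T, (∀ t ≤ T, z t ∈ U ∧ w t ∈ U) → 0 < ⟪v, z T⟫_ℝ → ⟪v, z T⟫_ℝ ≤ ⟪v, w T⟫_ℝ →
      Set.range z = Set.range w := by
    intro z w hz hw hzP hwP hzl hwl T hT h0 hle
    have hwc : Continuous w := continuous_iff_continuousAt.mpr fun t => (hw t).continuousAt
    have hlim : Tendsto (fun t => ⟪v, w t⟫_ℝ) atBot (𝓝 0) := by
      have := (tendsto_const_nhds (x := v)).inner (𝕜 := ℝ) hwl
      rwa [hvx] at this
    obtain ⟨s, hs, hsT⟩ := ((hlim.eventually_lt_const h0).and (eventually_le_atBot T)).exists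
    -- The unstable coordinate of `w` rises from `0` to at least that of `z T`, so it attains this
    -- value at some earlier time `r`; after a shift by `r - T` the cone estimate applies.
    obtain ⟨r, hr, hr0⟩ := isPreconnected_Iic.intermediate_value (s := Set.Iic T) hsT
      Set.self_mem_Iic (continuous_const.inner hwc).continuousOn
      (show ⟪v, z T⟫_ℝ ∈ Set.Icc _ _ from ⟨hs.le, hle⟩)
    have hr' : r ≤ T := hr
    have h1 := hcone z (fun t => w (t + (r - T))) hz (solution_shift hw _) hzP (fun t => hwP _) hzl
      (hwl.comp (tendsto_atBot_add_const_right _ _ tendsto_id)) T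
      (fun t ht => ⟨(hT t ht).1, (hT _ (by linarith)).2⟩) (by simpa using hr0.symm)
    exact range_eq_of_solution hf hz hw (a := T) (c := r) (by simpa using h1)
  obtain ⟨γ, hγ, hz1, hz2, hz3, T₁, hz4⟩ := hpos z hz hzP hzl hzx
  obtain ⟨δ, hδ, hw1, hw2, hw3, T₂, hw4⟩ := hpos w hw hwP hwl hwx
  obtain ⟨T₃, hT₃⟩ := eventually_atBot.mp ((hz3.eventually_mem hU).and (hw3.eventually_mem hU))
  let T := min T₃ (min T₁ T₂)
  have hT : ∀ t ≤ T, γ (z t) ∈ U ∧ δ (w t) ∈ U := fun t ht => hT₃ t (ht.trans (min_le_left _ _))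
  have hzT := hz4 T ((min_le_right _ _).trans (min_le_left _ _))
  have hwT := hw4 T ((min_le_right _ _).trans (min_le_right _ _))
  have hrange : Set.range (fun t => γ (z t)) = Set.range (fun t => δ (w t)) := by
    rcases le_total ⟪v, γ (z T)⟫_ℝ ⟪v, δ (w T)⟫_ℝ with h | h
    · exact hsame _ _ hz1 hw1 hz2 hw2 hz3 hw3 T hT hzT h
    · exact (hsame _ _ hw1 hz1 hw2 hz2 hw3 hz3 T (fun t ht => (hT t ht).symm) hwT h).symm
  have e1 := groupOrbit_image hγ (Set.range z)
  have e2 := groupOrbit_image hδ (Set.range w)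
  rw [← Set.range_comp] at e1 e2
  rw [← e1, ← e2]
  exact congrArg _ hrange

end HetNet

namespace HetNet
open scoped InnerProductSpace

/-! ### Adapted frames -/

theorem isometry_ext_of_basis (b : OrthonormalBasis (Fin 4) ℝ E4) {γ δ : O4}
    (h : ∀ i, γ (b i) = δ (b i)) : γ = δ := by
  have : (γ.toLinearEquiv : E4 →ₗ[ℝ] E4) = (δ.toLinearEquiv : E4 →ₗ[ℝ] E4) :=
    b.toBasis.ext fun i => by simpa using h i
  ext1 x
  exact LinearMap.congr_fun this x

theorem eq_zero_of_eq_neg {x : E4} (h : x = -x) : x = 0 := by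
  have h2 : (2 : ℝ) • x = 0 := by
    rw [two_smul]
    nth_rewrite 2 [h]
    exact add_neg_cancel x
  exact (smul_eq_zero.mp h2).resolve_left two_ne_zero

theorem mul_apply' (γ δ : O4) (x : E4) : (γ * δ) x = γ (δ x) := rfl

/-- The isotropy group of `x` contains an orientation-reversing map. -/
def HasOddIsotropy (Γ : Subgroup O4) (x : E4) : Prop :=
  ∃ γ ∈ isotropy Γ x, LinearMap.det (γ.toLinearEquiv : E4 →ₗ[ℝ] E4) = -1

theorem det_of_basis (b : OrthonormalBasis (Fin 4) ℝ E4) (γ : O4) (s : Fin 4 → ℝ)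
    (h : ∀ i, γ (b i) = s i • b i) :
    LinearMap.det (γ.toLinearEquiv : E4 →ₗ[ℝ] E4) = s 0 * s 1 * s 2 * s 3 := by
  have hM : LinearMap.toMatrix b.toBasis b.toBasis (γ.toLinearEquiv : E4 →ₗ[ℝ] E4) =
      Matrix.diagonal s := by
    ext i j
    rw [LinearMap.toMatrix_apply]
    have : (γ.toLinearEquiv : E4 →ₗ[ℝ] E4) (b.toBasis j) = s j • b.toBasis j := by
      simpa using h j
    rw [this]
    simp only [map_smul, Module.Basis.repr_self, Finsupp.smul_single, Finsupp.single_apply,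
      Matrix.diagonal_apply, smul_eq_mul, mul_one, eq_comm]
    split_ifs with hij
    · rw [hij]
    · rfl
  rw [← LinearMap.det_toMatrix b.toBasis, hM, Matrix.det_diagonal, Fin.prod_univ_four]

namespace IsFrame

variable {Γ : Subgroup O4} {x : E4} {P Q : Submodule ℝ E4} {b : OrthonormalBasis (Fin 4) ℝ E4}

theorem swap (h : IsFrame Γ x P Q b) : IsFrame Γ x Q P (b.reindex (Equiv.swap 1 2)) := by
  have h0 : b.reindex (Equiv.swap 1 2) 0 = b 0 := by simp [Equiv.swap_apply_of_ne_of_ne]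
  have h1 : b.reindex (Equiv.swap 1 2) 1 = b 2 := by simp
  have h2 : b.reindex (Equiv.swap 1 2) 2 = b 1 := by simp
  have h3 : b.reindex (Equiv.swap 1 2) 3 = b 3 := by
    rw [OrthonormalBasis.reindex_apply]; rfl
  refine ⟨by rw [h0]; exact h.x_eq, by rw [h0, h1]; exact h.Q_eq, by rw [h0, h2]; exact h.P_eq,
    fun γ hγ i => ?_, ?_, ?_⟩
  · rw [OrthonormalBasis.reindex_apply]; exact h.diag γ hγ _
  · obtain ⟨ρ, hρ, r0, r1, r2, r3⟩ := h.halfTurn_Q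
    exact ⟨ρ, hρ, by rw [h0, r0], by rw [h1, r2], by rw [h2, r1], by rw [h3, r3]⟩
  · obtain ⟨ρ, hρ, r0, r1, r2, r3⟩ := h.halfTurn_P
    exact ⟨ρ, hρ, by rw [h0, r0], by rw [h1, r2], by rw [h2, r1], by rw [h3, r3]⟩

theorem fix_x (h : IsFrame Γ x P Q b) {ρ : O4} (hρ : ρ (b 0) = b 0) : ρ x = x := by
  rw [h.x_eq, map_smul, hρ]

theorem fix_b0 (h : IsFrame Γ x P Q b) (hx : x ≠ 0) {ρ : O4} (hρ : ρ x = x) : ρ (b 0) = b 0 := by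
  rw [h.x_eq, map_smul] at hρ
  exact smul_right_injective _ (norm_ne_zero_iff.mpr hx) hρ

/-- A frame diagonalizes the linearization. -/
theorem fderiv_apply (h : IsFrame Γ x P Q b) {f : E4 → E4} (hf : IsEquivariant Γ f)
    (hd : Differentiable ℝ f) (i : Fin 4) :
    fderiv ℝ f x (b i) = ⟪b i, fderiv ℝ f x (b i)⟫_ℝ • b i := by
  obtain ⟨ρ, hρ, r0, r1, r2, r3⟩ := h.halfTurn_P
  obtain ⟨σ, hσ, s0, s1, s2, s3⟩ := h.halfTurn_Q
  -- A symmetry of `x` that fixes `b i` and reverses `b k` forces both mixed matrix entries of the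
  -- linearization to vanish.
  have key : ∀ γ ∈ Γ, γ x = x → ∀ i k, γ (b i) = b i → γ (b k) = -b k →
      ⟪b k, fderiv ℝ f x (b i)⟫_ℝ = 0 ∧ ⟪b i, fderiv ℝ f x (b k)⟫_ℝ = 0 := by
    intro γ hγ hγx i k hi hk
    have hA : ∀ v, fderiv ℝ f x (γ v) = γ (fderiv ℝ f x v) := fun v => by
      have := hf.fderiv_apply hd hγ x v
      rwa [hγx] at this
    constructor
    · have h1 := γ.inner_map_map (b k) (fderiv ℝ f x (b i))
      rw [← hA, hi, hk, inner_neg_left] at h1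
      linarith
    · have h1 := γ.inner_map_map (b i) (fderiv ℝ f x (b k))
      rw [← hA, hi, hk, map_neg, inner_neg_right] at h1
      linarith
  have hρx := h.fix_x r0
  have hσx := h.fix_x s0
  -- The half turn `ρ` separates the indices 0, 1 from 2, 3, and `σ` separates 0, 2 from 1, 3;
  -- together they separate every pair.
  have k02 := key ρ hρ hρx 0 2 r0 r2
  have k03 := key ρ hρ hρx 0 3 r0 r3
  have k12 := key ρ hρ hρx 1 2 r1 r2
  have k13 := key ρ hρ hρx 1 3 r1 r3
  have k01 := key σ hσ hσx 0 1 s0 s1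
  have k23 := key σ hσ hσx 2 3 s2 s3
  have hs := b.sum_repr' (fderiv ℝ f x (b i))
  rw [Fin.sum_univ_four] at hs
  fin_cases i
  · simp only [Fin.zero_eta, k02.1, k03.1, k01.1, zero_smul, add_zero] at hs ⊢
    exact hs.symm
  · simp only [Fin.mk_one, k01.2, k12.1, k13.1, zero_smul, add_zero, zero_add] at hs ⊢
    exact hs.symm
  · simp only [Fin.reduceFinMk, k02.2, k12.2, k23.1, zero_smul, add_zero, zero_add] at hs ⊢
    exact hs.symm
  · simp only [Fin.reduceFinMk, k03.2, k13.2, k23.2, zero_smul, add_zero, zero_add] at hs ⊢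
    exact hs.symm

theorem linearIndependent_pair (b : OrthonormalBasis (Fin 4) ℝ E4) {i j : Fin 4} (hij : i ≠ j) :
    LinearIndependent ℝ ![b i, b j] := by
  have : (![b i, b j] : Fin 2 → E4) = b ∘ ![i, j] := by
    funext k; fin_cases k <;> rfl
  rw [this]
  refine b.orthonormal.linearIndependent.comp _ ?_
  intro k l hkl
  fin_cases k <;> fin_cases l <;> simp_all

/-- The direction `b 0` lies in both planes and is contracting because `P` is a sink plane, so the
positive eigenvalue in `Q` must belong to `b 2`. -/
theorem eigenvalues (h : IsFrame Γ x P Q b) {f : E4 → E4} (hf : IsEquivariant Γ f)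
    (hd : Differentiable ℝ f) (hsink : IsSinkIn f P x) (hsaddle : IsSaddleIn f Q x) :
    ⟪b 0, fderiv ℝ f x (b 0)⟫_ℝ < 0 ∧ 0 < ⟪b 2, fderiv ℝ f x (b 2)⟫_ℝ := by
  have h1 := complexEigenvalues_linearizationOn h.P_eq (linearIndependent_pair b (by decide))
    (h.fderiv_apply hf hd 0) (h.fderiv_apply hf hd 1)
  have h2 := complexEigenvalues_linearizationOn h.Q_eq (linearIndependent_pair b (by decide))
    (h.fderiv_apply hf hd 0) (h.fderiv_apply hf hd 2)
  have h3 : ⟪b 0, fderiv ℝ f x (b 0)⟫_ℝ < 0 := by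
    have := hsink.2.2 (⟪b 0, fderiv ℝ f x (b 0)⟫_ℝ : ℂ) (by rw [h1]; simp)
    simpa using this
  refine ⟨h3, ?_⟩
  obtain ⟨μ, hμ, hμ0⟩ := hsaddle.2.2.2.2
  rw [h2] at hμ
  rcases Multiset.mem_cons.mp hμ with rfl | hμ
  · rw [Complex.ofReal_re] at hμ0; linarith
  · rw [Multiset.mem_singleton] at hμ
    subst hμ
    simpa using hμ0

/-- The half turn about `P`. -/
theorem exists_halfTurn (h : IsFrame Γ x P Q b) :
    ∃ ρ ∈ Γ, (∀ y ∈ P, ρ y = y) ∧ ∀ y, (∀ p ∈ P, ⟪p, y⟫_ℝ = 0) → ρ y = -y := by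
  obtain ⟨ρ, hρ, r0, r1, r2, r3⟩ := h.halfTurn_P
  refine ⟨ρ, hρ, fun y hy => ?_, fun y hy => ?_⟩
  · rw [h.P_eq] at hy
    obtain ⟨a, c, rfl⟩ := Submodule.mem_span_pair.mp hy
    rw [map_add, map_smul, map_smul, r0, r1]
  · have hs := b.sum_repr' y
    rw [Fin.sum_univ_four, hy (b 0) (by rw [h.P_eq]; exact Submodule.subset_span (by simp)),
      hy (b 1) (by rw [h.P_eq]; exact Submodule.subset_span (by simp))] at hs
    simp only [zero_smul, zero_add] at hs
    rw [← hs, map_add, map_smul, map_smul, r2, r3]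
    simp [add_comm]

/-- If the isotropy group is not orientation preserving, it contains the reflection that fixes both
planes of the frame. -/
theorem exists_reflection (h : IsFrame Γ x P Q b) (hx : x ≠ 0) (hodd : HasOddIsotropy Γ x) :
    ∃ γ ∈ Γ, γ (b 0) = b 0 ∧ γ (b 1) = b 1 ∧ γ (b 2) = b 2 ∧ γ (b 3) = -b 3 := by
  obtain ⟨γ, hγ, hdet⟩ := hodd
  obtain ⟨ρ, hρ, r0, r1, r2, r3⟩ := h.halfTurn_P
  obtain ⟨σ, hσ, s0, s1, s2, s3⟩ := h.halfTurn_Q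
  have hg0 := h.fix_b0 hx hγ.2
  have hs : ∀ i, ∃ s : ℝ, (s = 1 ∨ s = -1) ∧ γ (b i) = s • b i := by
    intro i
    rcases h.diag γ hγ i with hi | hi
    · exact ⟨1, Or.inl rfl, by rw [hi, one_smul]⟩
    · exact ⟨-1, Or.inr rfl, by rw [hi, neg_one_smul]⟩
  choose s hs1 hs2 using hs
  rw [det_of_basis b γ s hs2] at hdet
  have hs0 : s 0 = 1 := by
    rcases hs1 0 with h0 | h0
    · exact h0
    · exfalso
      have := hs2 0
      rw [h0, hg0, neg_one_smul] at this
      exact b.orthonormal.ne_zero 0 (eq_zero_of_eq_neg this)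
  have g1 := hs2 1
  have g2 := hs2 2
  have g3 := hs2 3
  rw [hs0] at hdet
  -- With `b 0` fixed and determinant `-1`, an odd number of the other three vectors is reversed; in
  -- each of the four cases a product with half turns leaves only `b 3` reversed.
  rcases hs1 1 with e1 | e1 <;> rcases hs1 2 with e2 | e2 <;> rcases hs1 3 with e3 | e3 <;>
    rw [e1, e2, e3] at hdet <;> norm_num at hdet <;> rw [e1] at g1 <;> rw [e2] at g2 <;>
    rw [e3] at g3 <;> simp only [one_smul, neg_smul] at g1 g2 g3
  · exact ⟨γ, hγ.1, hg0, g1, g2, g3⟩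
  · exact ⟨ρ * γ, Γ.mul_mem hρ hγ.1, by simp [mul_apply', hg0, r0], by simp [mul_apply', g1, r1],
      by simp [mul_apply', g2, r2], by simp [mul_apply', g3, r3]⟩
  · exact ⟨σ * γ, Γ.mul_mem hσ hγ.1, by simp [mul_apply', hg0, s0], by simp [mul_apply', g1, s1],
      by simp [mul_apply', g2, s2], by simp [mul_apply', g3, s3]⟩
  · exact ⟨σ * (ρ * γ), Γ.mul_mem hσ (Γ.mul_mem hρ hγ.1), by simp [mul_apply', hg0, r0, s0],
      by simp [mul_apply', g1, r1, s1], by simp [mul_apply', g2, r2, s2],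
      by simp [mul_apply', g3, r3, s3]⟩

/-- The elements of `S` differ only in their signs on `b 2` and `b 3`. The identity and the half
turn are always present, and a further element is a reflection, which reverses orientation. This
turns the order of an isotropy subgroup into a condition on the node alone, the same for both
planes. -/
theorem card_eq_two_iff_P (h : IsFrame Γ x P Q b) (hx : x ≠ 0) {S : Subgroup O4}
    (hS : IsIsotropySubgroup Γ S) (hP : fixedSpace S = P) :
    Nat.card S = 2 ↔ ¬ HasOddIsotropy Γ x := by
  obtain ⟨ρ, hρ, r0, r1, r2, r3⟩ := h.halfTurn_P
  have hmem : ∀ γ ∈ Γ, γ (b 0) = b 0 → γ (b 1) = b 1 → γ ∈ S := by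
    intro γ hγ h0 h1
    refine hS.mem_iff.mpr ⟨hγ, fun y hy => ?_⟩
    rw [hP, h.P_eq] at hy
    obtain ⟨a, c, rfl⟩ := Submodule.mem_span_pair.mp hy
    rw [map_add, map_smul, map_smul, h0, h1]
  have hρS := hmem ρ hρ r0 r1
  have hne : ∀ i, b i ≠ -b i := fun i hi => b.orthonormal.ne_zero i (eq_zero_of_eq_neg hi)
  have hρ1 : (1 : O4) ≠ ρ := by
    rintro rfl
    exact hne 2 r2
  constructor
  · intro hcard hodd
    obtain ⟨γ, hγ, g0, g1, g2, g3⟩ := h.exists_reflection hx hodd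
    have hγS := hmem γ hγ g0 g1
    have hγ1 : (1 : O4) ≠ γ := by
      rintro rfl
      exact hne 3 g3
    have hγρ : ρ ≠ γ := by
      rintro rfl
      exact hne 2 (g2.symm.trans r2)
    obtain ⟨a, c, -, hac⟩ := Nat.card_eq_two_iff.mp hcard
    have m1 : (1 : S) ∈ ({a, c} : Set S) := hac ▸ Set.mem_univ _
    have m2 : (⟨ρ, hρS⟩ : S) ∈ ({a, c} : Set S) := hac ▸ Set.mem_univ _
    have m3 : (⟨γ, hγS⟩ : S) ∈ ({a, c} : Set S) := hac ▸ Set.mem_univ _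
    have n1 : (1 : S) ≠ ⟨ρ, hρS⟩ := fun e => hρ1 (congrArg Subtype.val e)
    have n2 : (1 : S) ≠ ⟨γ, hγS⟩ := fun e => hγ1 (congrArg Subtype.val e)
    have n3 : (⟨ρ, hρS⟩ : S) ≠ ⟨γ, hγS⟩ := fun e => hγρ (congrArg Subtype.val e)
    simp only [Set.mem_insert_iff, Set.mem_singleton_iff] at m1 m2 m3
    grind
  · intro hodd
    refine Nat.card_eq_two_iff.mpr ⟨1, ⟨ρ, hρS⟩, fun e => hρ1 (congrArg Subtype.val e), ?_⟩
    refine Set.eq_univ_of_forall fun ⟨γ, hγ⟩ => ?_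
    have hγΓ := hS.le hγ
    have hfix := (hS.mem_iff.mp hγ).2
    rw [hP, h.P_eq] at hfix
    have g0 := hfix (b 0) (Submodule.subset_span (by simp))
    have g1 := hfix (b 1) (Submodule.subset_span (by simp))
    have hγx : γ ∈ isotropy Γ x := ⟨hγΓ, h.fix_x g0⟩
    have hdet : ∀ s : Fin 4 → ℝ, (∀ i, γ (b i) = s i • b i) → s 0 * s 1 * s 2 * s 3 ≠ -1 :=
      fun s hs hd => hodd ⟨γ, hγx, (det_of_basis b γ s hs).trans hd⟩
    rcases h.diag γ hγx 2 with g2 | g2 <;> rcases h.diag γ hγx 3 with g3 | g3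
    · left
      refine Subtype.ext (isometry_ext_of_basis b fun i => ?_)
      fin_cases i
      exacts [g0, g1, g2, g3]
    · exfalso
      refine hdet ![1, 1, 1, -1] (fun i => ?_) (by simp)
      fin_cases i
      · simpa using g0
      · simpa using g1
      · simpa using g2
      · simpa using g3
    · exfalso
      refine hdet ![1, 1, -1, 1] (fun i => ?_) (by simp)
      fin_cases i
      · simpa using g0
      · simpa using g1
      · simpa using g2
      · simpa using g3
    · right
      refine Subtype.ext (isometry_ext_of_basis b fun i => ?_)
      fin_cases i
      exacts [g0.trans r0.symm, g1.trans r1.symm, g2.trans r2.symm, g3.trans r3.symm]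

theorem card_eq_two_iff_Q (h : IsFrame Γ x P Q b) (hx : x ≠ 0) {S : Subgroup O4}
    (hS : IsIsotropySubgroup Γ S) (hQ : fixedSpace S = Q) :
    Nat.card S = 2 ↔ ¬ HasOddIsotropy Γ x :=
  h.swap.card_eq_two_iff_P hx hS hQ

/-- The reflection that fixes both planes of the frame has a three-dimensional fixed-point space. -/
theorem exists_fixedSpace_finrank_three (h : IsFrame Γ x P Q b) (hx : x ≠ 0)
    (hodd : HasOddIsotropy Γ x) :
    ∃ H : Subgroup O4, H ≤ Γ ∧ Module.finrank ℝ (fixedSpace H) = 3 ∧ P ≤ fixedSpace H ∧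
      Q ≤ fixedSpace H := by
  obtain ⟨γ, hγ, g0, g1, g2, g3⟩ := h.exists_reflection hx hodd
  have hfix : fixedSpace (Subgroup.zpowers γ) = (Submodule.span ℝ {b 3})ᗮ := by
    ext y
    rw [Submodule.mem_orthogonal_singleton_iff_inner_right]
    constructor
    · intro hy
      have h1 := γ.inner_map_map (b 3) y
      rw [hy γ (Subgroup.mem_zpowers γ), g3, inner_neg_left] at h1
      linarith
    · intro hy
      have hγy : γ y = y := by
        have hs := b.sum_repr' y
        rw [Fin.sum_univ_four, hy] at hs
        rw [← hs]
        simp only [map_add, map_smul, g0, g1, g2, zero_smul, map_zero]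
      have hle : Subgroup.zpowers γ ≤ isotropy (Subgroup.zpowers γ) y := by
        rw [Subgroup.zpowers_le]
        exact ⟨Subgroup.mem_zpowers γ, hγy⟩
      exact fun δ hδ => (hle hδ).2
  have hb : ∀ i, i ≠ 3 → b i ∈ fixedSpace (Subgroup.zpowers γ) := by
    intro i hi
    rw [hfix, Submodule.mem_orthogonal_singleton_iff_inner_right]
    exact b.orthonormal.2 hi.symm
  refine ⟨Subgroup.zpowers γ, by rwa [Subgroup.zpowers_le], ?_, ?_, ?_⟩
  · rw [hfix]
    have : Fact (Module.finrank ℝ E4 = 3 + 1) := ⟨by simp⟩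
    exact Submodule.finrank_orthogonal_span_singleton (b.orthonormal.ne_zero 3)
  · rw [h.P_eq, Submodule.span_le]
    rintro y (rfl | rfl)
    exacts [hb 0 (by decide), hb 1 (by decide)]
  · rw [h.Q_eq, Submodule.span_le]
    rintro y (rfl | rfl)
    exacts [hb 0 (by decide), hb 2 (by decide)]

/-- A fixed plane through `x` is spanned by `x` and a vector of the frame. -/
theorem exists_eq_span (h : IsFrame Γ x P Q b) {S : Subgroup O4} (hS : S ≤ Γ)
    (hxS : x ∈ fixedSpace S) (hx : x ≠ 0) (hfS : Module.finrank ℝ (fixedSpace S) = 2) :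
    ∃ i : Fin 3, fixedSpace S = Submodule.span ℝ {b 0, b i.succ} := by
  have hi : ∀ γ ∈ S, γ ∈ isotropy Γ x := fun γ hγ => ⟨hS hγ, hxS γ hγ⟩
  have hb0 : b 0 ∈ fixedSpace S := fun γ hγ => h.fix_b0 hx (hxS γ hγ)
  -- A frame vector that is not fixed by `S` is reversed by some element, hence perpendicular to the
  -- fixed-point space.
  have hcomp : ∀ y ∈ fixedSpace S, ∀ i, b i ∈ fixedSpace S ∨ ⟪b i, y⟫_ℝ = 0 := by
    intro y hy i
    by_cases hbi : b i ∈ fixedSpace S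
    · exact Or.inl hbi
    · right
      simp only [mem_fixedSpace, not_forall] at hbi
      obtain ⟨γ, hγ, hγi⟩ := hbi
      have h1 := γ.inner_map_map (b i) y
      rw [hy γ hγ, (h.diag γ (hi γ hγ) i).resolve_left hγi, inner_neg_left] at h1
      linarith
  have hex : ∃ i : Fin 3, b i.succ ∈ fixedSpace S := by
    by_contra hcon
    push Not at hcon
    have hle : fixedSpace S ≤ Submodule.span ℝ {b 0} := by
      intro y hy
      rw [Submodule.mem_span_singleton]
      have hs := b.sum_repr' y
      rw [Fin.sum_univ_succ] at hs
      have h0 : ∑ i : Fin 3, ⟪b i.succ, y⟫_ℝ • b i.succ = 0 := Finset.sum_eq_zero fun i _ => by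
        rw [(hcomp y hy i.succ).resolve_left (hcon i), zero_smul]
      rw [h0, add_zero] at hs
      exact ⟨_, hs⟩
    have := (Submodule.finrank_mono hle).trans (finrank_span_singleton (K := ℝ)
      (b.orthonormal.ne_zero 0)).le
    omega
  obtain ⟨i, hbi⟩ := hex
  refine ⟨i, (Submodule.eq_of_le_of_finrank_eq ?_ ?_).symm⟩
  · rw [Submodule.span_le]
    rintro y (rfl | rfl)
    exacts [hb0, hbi]
  · rw [hfS]
    have hli := linearIndependent_pair b (i := 0) (j := i.succ) (Fin.succ_ne_zero i).symm
    have := finrank_span_eq_card hli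
    rw [Matrix.range_cons, Matrix.range_cons, Matrix.range_empty, Set.union_empty] at this
    exact this

end IsFrame

end HetNet

/-! ### Symmetry and geometry of simple cycles. -/

namespace HetNet
open scoped InnerProductSpace

theorem SameOrbit.symm {Γ : Subgroup O4} {x y : E4} (h : SameOrbit Γ x y) : SameOrbit Γ y x := by
  obtain ⟨γ, hγ, rfl⟩ := h
  exact ⟨γ⁻¹, Γ.inv_mem hγ, γ.symm_apply_apply x⟩

theorem SameOrbit.refl (Γ : Subgroup O4) (x : E4) : SameOrbit Γ x x := ⟨1, Γ.one_mem, rfl⟩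

theorem subset_groupOrbit (Γ : Subgroup O4) (X : Set E4) : X ⊆ groupOrbit Γ X :=
  fun x hx => ⟨1, Γ.one_mem, x, hx, rfl⟩

theorem groupOrbit_union (Γ : Subgroup O4) (X Y : Set E4) :
    groupOrbit Γ (X ∪ Y) = groupOrbit Γ X ∪ groupOrbit Γ Y := by
  ext y
  constructor
  · rintro ⟨γ, hγ, x, hx | hx, rfl⟩
    · exact Or.inl ⟨γ, hγ, x, hx, rfl⟩
    · exact Or.inr ⟨γ, hγ, x, hx, rfl⟩
  · rintro (⟨γ, hγ, x, hx, rfl⟩ | ⟨γ, hγ, x, hx, rfl⟩)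
    · exact ⟨γ, hγ, x, Or.inl hx, rfl⟩
    · exact ⟨γ, hγ, x, Or.inr hx, rfl⟩

theorem groupOrbit_iUnion {ι : Type*} (Γ : Subgroup O4) (X : ι → Set E4) :
    groupOrbit Γ (⋃ i, X i) = ⋃ i, groupOrbit Γ (X i) := by
  ext y
  simp only [groupOrbit, Set.mem_iUnion, Set.mem_ofPred_eq]
  constructor
  · rintro ⟨γ, hγ, x, ⟨i, hx⟩, rfl⟩
    exact ⟨i, γ, hγ, x, hx, rfl⟩
  · rintro ⟨i, γ, hγ, x, hx, rfl⟩
    exact ⟨γ, hγ, x, ⟨i, hx⟩, rfl⟩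

theorem smul_mem_connectedComponentIn {L : Submodule ℝ E4} {x : E4} (hx : x ∈ L) (h0 : x ≠ 0)
    {c : ℝ} (hc : 0 < c) : c • x ∈ connectedComponentIn ((L : Set E4) \ {0}) x := by
  have hpre : IsPreconnected ((fun s : ℝ => s • x) '' Set.Ioi 0) :=
    isPreconnected_Ioi.image _ (by fun_prop)
  refine hpre.subset_connectedComponentIn (s := _) ⟨1, Set.mem_Ioi.mpr one_pos, one_smul ℝ x⟩ ?_
    ⟨c, hc, rfl⟩
  rintro _ ⟨s, hs, rfl⟩
  exact ⟨L.smul_mem s hx, fun h => (smul_ne_zero (ne_of_gt hs) h0) h⟩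

namespace Cycle

variable {Γ : Subgroup O4} {f : E4 → E4}

/-- An open ray in `L j` lies in a single component of the punctured space. -/
theorem MeetsAxesOnce.eq_of_pos_smul {C : Cycle Γ f} {X : Set E4} (h : C.MeetsAxesOnce X) {x : E4}
    {c : ℝ} (hc : 0 < c) {j : Fin (C.k + 1)} (hxL : x ∈ C.L j) (h0 : x ≠ 0)
    (hx : x ∈ groupOrbit Γ X) (hcx : c • x ∈ groupOrbit Γ X) : c • x = x :=
  h j x ⟨hxL, h0⟩ ⟨hcx, smul_mem_connectedComponentIn hxL h0 hc⟩
    ⟨hx, mem_connectedComponentIn (show x ∈ (C.L j : Set E4) \ {0} from ⟨hxL, h0⟩)⟩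

theorem node_mem_carrier (C : Cycle Γ f) (j : Fin (C.k + 1)) : C.node j ∈ C.carrier :=
  Or.inl ⟨j, rfl⟩

theorem node_mem_P (C : Cycle Γ f) (j : Fin (C.k + 1)) : C.node j ∈ C.P j := (C.saddle j).1

theorem node_succ_mem_P (C : Cycle Γ f) (j : Fin (C.k + 1)) : C.node (j + 1) ∈ C.P j := (C.sink j).1

theorem node_mem_L (C : Cycle Γ f) (j : Fin (C.k + 1)) : C.node j ∈ C.L j := by
  refine ⟨?_, C.node_mem_P j⟩
  have := C.node_succ_mem_P (j - 1)
  rwa [sub_add_cancel] at this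

theorem IsSimple.node_ne_zero {C : Cycle Γ f} (h : C.IsSimple) (j : Fin (C.k + 1)) :
    C.node j ≠ 0 := fun h0 => h.zero_notMem (h0 ▸ C.node_mem_carrier j)

/-- Their common node is a sink in the first plane and a saddle in the second. -/
theorem P_ne_P_succ (C : Cycle Γ f) (j : Fin (C.k + 1)) : C.P j ≠ C.P (j + 1) := by
  intro h
  obtain ⟨μ, hμ, hμ0⟩ := (C.saddle (j + 1)).2.2.2.2
  have hs := (C.sink j).2.2
  rw [show fixedSpace (C.Sig j) = fixedSpace (C.Sig (j + 1)) from h] at hs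
  exact absurd (hs μ hμ) (not_lt.mpr hμ0.le)

theorem k_pos (C : Cycle Γ f) : 0 < C.k := by
  obtain ⟨j, hj⟩ := C.not_homoclinic
  rcases Nat.eq_zero_or_pos C.k with h | h
  · exfalso
    refine hj ?_
    have : j = 0 := by
      apply Fin.ext
      have := j.2
      simp
      omega
    rw [this]
    exact SameOrbit.refl Γ _
  · exact h

theorem ne_succ (C : Cycle Γ f) (j : Fin (C.k + 1)) : j ≠ j + 1 := by
  have := C.k_pos
  intro h
  have h1 : (1 : Fin (C.k + 1)) = 0 := by simpa using h
  rw [Fin.one_eq_zero_iff] at h1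
  omega

theorem exists_traj_ne (C : Cycle Γ f) (j : Fin (C.k + 1)) : ∃ t, C.traj j t ≠ C.node j := by
  by_contra hcon
  push Not at hcon
  have h1 : C.traj j = fun _ => C.node j := funext hcon
  have h2 := C.tendsto_target j
  rw [h1] at h2
  exact C.ne_succ j (C.node_injective (tendsto_nhds_unique tendsto_const_nhds h2))

theorem exists_isFrame (C : Cycle Γ f) (hC : C.IsSimple) (hf : ContDiff ℝ 1 f)
    (he : IsEquivariant Γ f) (j : Fin (C.k + 1)) :
    ∃ b, IsFrame Γ (C.node (j + 1)) (C.P j) (C.P (j + 1)) b :=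
  HetNet.exists_isFrame (C.isotropy_Sig j).le (C.isotropy_Sig (j + 1)).le (C.node_succ_mem_P j)
    (C.node_mem_P (j + 1)) (hC.node_ne_zero _) (hC.finrank_P j) (hC.finrank_P (j + 1))
    (C.P_ne_P_succ j) fun _ hγ _ hδ v =>
      isotropy_commute he (hf.differentiable one_ne_zero) (hC.no_double_eigenvalue (j + 1)) hγ hδ v

/-- Connections that start at symmetric nodes in symmetric planes are equal up to symmetry. -/
theorem groupOrbit_traj_eq {C C' : Cycle Γ f} (hC : C.IsSimple) (hf : ContDiff ℝ 1 f)
    (he : IsEquivariant Γ f) {j : Fin (C.k + 1)} {j' : Fin (C'.k + 1)} {γ : O4} (hγ : γ ∈ Γ)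
    (hn : C.node j = γ (C'.node j')) (hP : ∀ y ∈ C'.P j', γ y ∈ C.P j) :
    groupOrbit Γ (Set.range (C.traj j)) = groupOrbit Γ (Set.range (C'.traj j')) := by
  -- Frames are attached to the target of a connection, so the source has to be written as a
  -- successor.
  obtain ⟨i, rfl⟩ : ∃ i, j = i + 1 := ⟨j - 1, (sub_add_cancel j 1).symm⟩
  obtain ⟨b, hb⟩ := C.exists_isFrame hC hf he i
  have hd := hf.differentiable one_ne_zero
  obtain ⟨hl, hm⟩ := hb.eigenvalues he hd (C.sink i) (C.saddle (i + 1))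
  -- The half turn about the incoming plane reverses `b 2`, the unstable direction in the outgoing
  -- plane.
  obtain ⟨ρ, hρ, r0, -, r2, -⟩ := hb.halfTurn_P
  rw [← groupOrbit_image hγ (Set.range (C'.traj j')), ← Set.range_comp]
  refine groupOrbit_range_eq_of_saddle hf he (b.orthonormal.1 0) (b.orthonormal.1 2)
    (b.orthonormal.2 (by decide)) hl hm (hb.fderiv_apply he hd 0) (hb.fderiv_apply he hd 2)
    (C.sink i).2.1 (Submodule.mem_span_singleton.mpr ⟨_, hb.x_eq.symm⟩) hρ r0 r2
    (C.solution _) (fun t => ?_) (fun t => ?_) (fun t => ?_) (C.tendsto_source _) ?_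
    (C.exists_traj_ne _) ?_
  · rw [Function.comp_apply, he γ hγ]
    exact (γ : E4 →L[ℝ] E4).hasFDerivAt.comp_hasDerivAt t (C'.solution j' t)
  · rw [← hb.Q_eq]; exact C.traj_mem _ t
  · rw [← hb.Q_eq]; exact hP _ (C'.traj_mem _ t)
  · rw [hn]; exact (γ.continuous.tendsto _).comp (C'.tendsto_source _)
  · obtain ⟨t, ht⟩ := C'.exists_traj_ne j'
    exact ⟨t, fun h => ht (γ.injective (h.trans hn))⟩

/-- Up to symmetry, a cycle is determined by its nodes and planes. -/
theorem groupOrbit_carrier_subset {C C' : Cycle Γ f} (hC : C.IsSimple) (hf : ContDiff ℝ 1 f)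
    (he : IsEquivariant Γ f)
    (h : ∀ j', ∃ j, ∃ γ ∈ Γ, C.node j = γ (C'.node j') ∧ ∀ y ∈ C'.P j', γ y ∈ C.P j) :
    groupOrbit Γ C'.carrier ⊆ groupOrbit Γ C.carrier := by
  rw [carrier, carrier, groupOrbit_union, groupOrbit_union, groupOrbit_iUnion, groupOrbit_iUnion]
  refine Set.union_subset_union ?_ (Set.iUnion_subset fun j' => ?_)
  · rintro _ ⟨δ, hδ, _, ⟨j', rfl⟩, rfl⟩
    obtain ⟨j, γ, hγ, hn, -⟩ := h j'
    refine ⟨δ * γ⁻¹, Γ.mul_mem hδ (Γ.inv_mem hγ), _, ⟨j, rfl⟩, ?_⟩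
    rw [hn]
    change δ (γ⁻¹ (γ _)) = _
    rw [show γ⁻¹ (γ (C'.node j')) = _ from γ.symm_apply_apply _]
  · obtain ⟨j, γ, hγ, hn, hP⟩ := h j'
    rw [← groupOrbit_traj_eq hC hf he hγ hn hP]
    exact Set.subset_iUnion (fun j => groupOrbit Γ (Set.range (C.traj j))) j

/-- The half turn about the plane of a connection. -/
theorem exists_halfTurn (C : Cycle Γ f) (hC : C.IsSimple) (hf : ContDiff ℝ 1 f)
    (he : IsEquivariant Γ f) (j : Fin (C.k + 1)) :
    ∃ ρ ∈ Γ, (∀ y ∈ C.P j, ρ y = y) ∧ ∀ y, (∀ p ∈ C.P j, ⟪p, y⟫_ℝ = 0) → ρ y = -y := by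
  obtain ⟨b, hb⟩ := C.exists_isFrame hC hf he j
  exact hb.exists_halfTurn

/-- If consecutive nodes are perpendicular, a symmetry reverses the first one. -/
theorem exists_neg_of_inner_eq_zero (C : Cycle Γ f) (hC : C.IsSimple) (hf : ContDiff ℝ 1 f)
    (he : IsEquivariant Γ f) {j : Fin (C.k + 1)} (h : ⟪C.node (j + 1), C.node j⟫_ℝ = 0) :
    ∃ ρ ∈ Γ, ρ (C.node j) = -C.node j := by
  obtain ⟨b, hb⟩ := C.exists_isFrame hC hf he j
  obtain ⟨ρ, hρ, -, r1, -, -⟩ := hb.halfTurn_Q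
  have hmem := C.node_mem_P j
  rw [hb.P_eq] at hmem
  obtain ⟨a, c, hac⟩ := Submodule.mem_span_pair.mp hmem
  -- Being perpendicular to `b 0`, the earlier node is a multiple of `b 1`, which the half turn
  -- about the outgoing plane reverses.
  have ha : a = 0 := by
    rw [hb.x_eq, inner_smul_left, ← hac, inner_add_right, inner_smul_right, inner_smul_right,
      b.orthonormal.2 (by decide : (0 : Fin 4) ≠ 1), real_inner_self_eq_norm_sq,
      b.orthonormal.1] at h
    have := norm_ne_zero_iff.mpr (hC.node_ne_zero (j + 1))
    simpa [this, hC.node_ne_zero] using h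
  rw [ha, zero_smul, zero_add] at hac
  exact ⟨ρ, hρ, by rw [← hac, map_smul, r1, smul_neg]⟩

/-! #### Type A -/

theorem card_Sig_iff (C : Cycle Γ f) (hC : C.IsSimple) (hf : ContDiff ℝ 1 f)
    (he : IsEquivariant Γ f) (j : Fin (C.k + 1)) :
    (Nat.card (C.Sig j) = 2 ↔ ¬ HasOddIsotropy Γ (C.node (j + 1))) ∧
    (Nat.card (C.Sig (j + 1)) = 2 ↔ ¬ HasOddIsotropy Γ (C.node (j + 1))) := by
  obtain ⟨b, hb⟩ := C.exists_isFrame hC hf he j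
  exact ⟨hb.card_eq_two_iff_P (hC.node_ne_zero _) (C.isotropy_Sig j) rfl,
    hb.card_eq_two_iff_Q (hC.node_ne_zero _) (C.isotropy_Sig (j + 1)) rfl⟩

theorem ofNat_val_eq {k : ℕ} (i : Fin (k + 1)) : Fin.ofNat (k + 1) i.val = i := by
  apply Fin.ext
  simp [Fin.ofNat, Nat.mod_eq_of_lt i.2]

/-- Induction along the cyclic order of the nodes. -/
theorem fin_cyclic_induction {k : ℕ} {p : Fin (k + 1) → Prop} {j : Fin (k + 1)} (h0 : p j)
    (hs : ∀ i, p i → p (i + 1)) (i : Fin (k + 1)) : p i := by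
  have key : ∀ n : ℕ, p (j + Fin.ofNat (k + 1) n) := by
    intro n
    induction n with
    | zero => simpa [Fin.ofNat] using h0
    | succ n ih =>
      have : Fin.ofNat (k + 1) (n + 1) = Fin.ofNat (k + 1) n + 1 := by
        apply Fin.ext
        simp [Fin.ofNat, Fin.val_add]
      rw [this, ← add_assoc]
      exact hs _ ih
  have := key (i - j).val
  rwa [ofNat_val_eq, add_sub_cancel] at this

/-- The order of `Sig l` can be read off at either end of its connection, so the absence of
orientation-reversing isotropy passes from each node to the next and around the whole cycle. -/
theorem isTypeA_iff (C : Cycle Γ f) (hC : C.IsSimple) (hf : ContDiff ℝ 1 f)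
    (he : IsEquivariant Γ f) (i : Fin (C.k + 1)) :
    C.IsTypeA ↔ ¬ HasOddIsotropy Γ (C.node i) := by
  have h := C.card_Sig_iff hC hf he
  constructor
  · intro hA
    have := (h (i - 1)).1.mp (hA _)
    rwa [sub_add_cancel] at this
  · intro hodd j
    have : ¬ HasOddIsotropy Γ (C.node (j + 1)) := by
      refine fin_cyclic_induction (p := fun j => ¬ HasOddIsotropy Γ (C.node j)) hodd
        (fun l hl => ?_) (j + 1)
      have h1 : Nat.card (C.Sig l) = 2 := by
        have := (h (l - 1)).2
        rw [sub_add_cancel] at this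
        exact this.mpr hl
      exact (h l).1.mp h1
    exact (h j).1.mpr this

/-- A cycle whose planes span only a three-dimensional space is of type A or of type B. -/
theorem isTypeB_of_odd (C : Cycle Γ f) (hC : C.IsSimple) (hf : ContDiff ℝ 1 f)
    (he : IsEquivariant Γ f) {i : Fin (C.k + 1)} (hodd : HasOddIsotropy Γ (C.node (i + 1)))
    (hP : ∀ j, C.P j ≤ C.P i ⊔ C.P (i + 1)) : C.IsTypeB := by
  obtain ⟨b, hb⟩ := C.exists_isFrame hC hf he i
  obtain ⟨H, hH, h3, h1, h2⟩ := hb.exists_fixedSpace_finrank_three (hC.node_ne_zero _) hodd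
  have hle : ∀ j, C.P j ≤ fixedSpace H := fun j => (hP j).trans (sup_le h1 h2)
  refine ⟨H, hH, h3, ?_⟩
  rintro y (⟨j, rfl⟩ | hy)
  · exact hle j (C.node_mem_P j)
  · obtain ⟨j, t, rfl⟩ := Set.mem_iUnion.mp hy
    exact hle j (C.traj_mem j t)

/-! #### Elementary building blocks -/

/-- With an elementary building block, no two nodes are symmetric. -/
theorem not_sameOrbit_of_isElementaryBlock {C : Cycle Γ f} {j : Fin (C.k + 1)} {l : ℕ}
    (h : C.IsElementaryBlock j l) {a b : Fin (C.k + 1)} (hab : a ≠ b) :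
    ¬ SameOrbit Γ (C.node a) (C.node b) := by
  obtain ⟨⟨hl, -, -⟩, hdist, hclose⟩ := h
  have h1 : Fin.ofNat (C.k + 1) l = 0 := by
    have := C.node_injective hclose
    simpa using this
  -- The block closes at its first node itself, so injectivity of the nodes makes `l` a positive
  -- multiple of `k + 1`; thus the block runs through all nodes.
  have hkl : C.k + 1 ≤ l := by
    have h2 : l % (C.k + 1) = 0 := congrArg Fin.val h1
    exact Nat.le_of_dvd hl (Nat.dvd_of_mod_eq_zero h2)
  have hrep : ∀ a : Fin (C.k + 1), j + Fin.ofNat (C.k + 1) (a - j).val = a := by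
    intro a
    rw [ofNat_val_eq, add_sub_cancel]
  have hlt : ∀ a : Fin (C.k + 1), (a - j).val < l := fun a => lt_of_lt_of_le (a - j).2 hkl
  have hne : (a - j).val ≠ (b - j).val := fun e => hab (sub_left_injective (Fin.ext e))
  rcases lt_or_gt_of_ne hne with hlt' | hlt'
  · have := hdist _ _ hlt' (hlt b)
    rwa [hrep, hrep] at this
  · have := hdist _ _ hlt' (hlt a)
    rw [hrep, hrep] at this
    exact fun hs => this hs.symm

theorem numOrbits_eq {C : Cycle Γ f}
    (h : ∀ a b, a ≠ b → ¬ SameOrbit Γ (C.node a) (C.node b)) : C.numOrbits = C.k + 1 := by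
  have hinj : Function.Injective fun j => groupOrbit Γ {C.node j} := by
    intro a b hab
    by_contra hne
    have : C.node b ∈ groupOrbit Γ {C.node a} := by
      have h1 : C.node b ∈ groupOrbit Γ {C.node b} := subset_groupOrbit _ _ rfl
      rwa [show groupOrbit Γ {C.node a} = groupOrbit Γ {C.node b} from hab]
    obtain ⟨γ, hγ, x, rfl, hx⟩ := this
    exact h a b hne ⟨γ, hγ, hx⟩
  rw [numOrbits, Set.ncard_range_of_injective hinj]
  simp

end Cycle

end HetNet

namespace HetNet
open scoped InnerProductSpace

/-! ### Points on the coordinate axes -/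

/-- The standard basis vectors. -/
noncomputable abbrev e (i : Fin 4) : E4 := EuclideanSpace.single i 1

theorem inner_e_e {i j : Fin 4} (h : i ≠ j) : ⟪e i, e j⟫_ℝ = 0 := by
  rw [EuclideanSpace.inner_single_left, PiLp.single_apply, if_neg h]
  simp

theorem isometry_ext {γ δ : O4} (h : ∀ i, γ (e i) = δ (e i)) : γ = δ :=
  isometry_ext_of_basis (EuclideanSpace.basisFun (Fin 4) ℝ) fun i => by simpa using h i

theorem linearIndependent_e_e {i j : Fin 4} (h : i ≠ j) : LinearIndependent ℝ ![e i, e j] := by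
  simpa using IsFrame.linearIndependent_pair (EuclideanSpace.basisFun (Fin 4) ℝ) h

theorem finrank_span_e_e {i j : Fin 4} (h : i ≠ j) :
    Module.finrank ℝ (Submodule.span ℝ {e i, e j}) = 2 := by
  have := finrank_span_eq_card (linearIndependent_e_e h)
  rw [Matrix.range_cons, Matrix.range_cons, Matrix.range_empty, Set.union_empty] at this
  exact this

/-- `x` lies on a coordinate axis. -/
def OnAxis (x : E4) : Prop := ∃ i : Fin 4, ∀ i' : Fin 4, i' ≠ i → x i' = 0

open Classical in
/-- The coordinate axis on which `x` lies. -/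
noncomputable def axis (x : E4) : Fin 4 := if h : OnAxis x then h.choose else 0

theorem OnAxis.eq_smul {x : E4} (h : OnAxis x) : x = x (axis x) • e (axis x) := by
  have hs : ∀ i', i' ≠ axis x → x i' = 0 := by
    rw [axis, dif_pos h]
    exact h.choose_spec
  ext i
  by_cases hi : i = axis x
  · rw [hi]; simp
  · rw [hs i hi]; simp [hi]

theorem OnAxis.coord_ne_zero {x : E4} (h : OnAxis x) (hx : x ≠ 0) : x (axis x) ≠ 0 := by
  intro h0
  have := h.eq_smul
  rw [h0, zero_smul] at this
  exact hx this

theorem OnAxis.e_eq_smul {x : E4} (h : OnAxis x) (hx : x ≠ 0) :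
    e (axis x) = (x (axis x))⁻¹ • x := by
  have h1 := congrArg (fun y => (x (axis x))⁻¹ • y) h.eq_smul
  simp only [smul_smul, inv_mul_cancel₀ (h.coord_ne_zero hx), one_smul] at h1
  exact h1.symm

theorem OnAxis.inner_eq_zero {x y : E4} (hx : OnAxis x) (hy : OnAxis y) (h : axis x ≠ axis y) :
    ⟪x, y⟫_ℝ = 0 := by
  rw [hx.eq_smul, hy.eq_smul, inner_smul_left, inner_smul_right, inner_e_e h]
  simp

theorem OnAxis.exists_smul_eq {x y : E4} (hx : OnAxis x) (hx0 : x ≠ 0) (hy : OnAxis y)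
    (hy0 : y ≠ 0) (h : axis x = axis y) : ∃ c : ℝ, c ≠ 0 ∧ y = c • x := by
  refine ⟨y (axis y) * (x (axis x))⁻¹, mul_ne_zero (hy.coord_ne_zero hy0)
    (inv_ne_zero (hx.coord_ne_zero hx0)), ?_⟩
  rw [mul_smul, ← hx.e_eq_smul hx0, h]
  exact hy.eq_smul

theorem neg_apply (x : E4) : (LinearIsometryEquiv.neg ℝ : O4) x = -x := rfl

/-- Half turns about the coordinate planes of a cyclic path with three or four edges generate
`-Id`. -/
theorem neg_mem_of_halfTurns {Γ : Subgroup O4} {k : ℕ} (hk : k = 2 ∨ k = 3)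
    {a : Fin (k + 1) → Fin 4} (ha : Function.Injective a)
    (h : ∀ j, ∃ ρ ∈ Γ, ρ (e (a j)) = e (a j) ∧ ρ (e (a (j + 1))) = e (a (j + 1)) ∧
      ∀ i, i ≠ a j → i ≠ a (j + 1) → ρ (e i) = -e i) :
    (LinearIsometryEquiv.neg ℝ : O4) ∈ Γ := by
  choose ρ hρ h1 h2 h3 using h
  rcases hk with rfl | rfl
  -- Each of the three axes is reversed only by the half turn about the plane of the other two, and
  -- the fourth axis by all three half turns.
  · have : (LinearIsometryEquiv.neg ℝ : O4) = ρ 0 * ρ 1 * ρ 2 := by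
      refine isometry_ext fun i => ?_
      rw [mul_apply', mul_apply', neg_apply]
      have n01 : a 0 ≠ a 1 := ha.ne (by decide)
      have n12 : a 1 ≠ a 2 := ha.ne (by decide)
      have n02 : a 0 ≠ a 2 := ha.ne (by decide)
      have p0 := h1 0
      have p1 := h1 1
      have p2 := h1 2
      have q0 : ρ 0 (e (a 1)) = e (a 1) := h2 0
      have q1 : ρ 1 (e (a 2)) = e (a 2) := h2 1
      have q2 : ρ 2 (e (a 0)) = e (a 0) := h2 2
      have r0 : ∀ i, i ≠ a 0 → i ≠ a 1 → ρ 0 (e i) = -e i := h3 0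
      have r1 : ∀ i, i ≠ a 1 → i ≠ a 2 → ρ 1 (e i) = -e i := h3 1
      have r2 : ∀ i, i ≠ a 2 → i ≠ a 0 → ρ 2 (e i) = -e i := h3 2
      by_cases i0 : i = a 0
      · rw [i0, q2, r1 _ n01 n02, map_neg, p0]
      by_cases i1 : i = a 1
      · rw [i1, r2 _ n12 n01.symm, map_neg, p1, map_neg, q0]
      by_cases i2 : i = a 2
      · rw [i2, p2, q1, r0 _ n02.symm n12.symm]
      · rw [r2 _ i2 i0, map_neg, r1 _ i1 i2, neg_neg, r0 _ i0 i1]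
    rw [this]
    exact Γ.mul_mem (Γ.mul_mem (hρ 0) (hρ 1)) (hρ 2)
  -- The first and the third edge span complementary planes, and the half turns about these compose
  -- to `-Id`.
  · have : (LinearIsometryEquiv.neg ℝ : O4) = ρ 0 * ρ 2 := by
      refine isometry_ext fun i => ?_
      rw [mul_apply', neg_apply]
      obtain ⟨j, rfl⟩ := (Finite.injective_iff_surjective.mp ha) i
      have q0 : ρ 0 (e (a 1)) = e (a 1) := h2 0
      have q2 : ρ 2 (e (a 3)) = e (a 3) := h2 2
      have r0 : ∀ i, i ≠ a 0 → i ≠ a 1 → ρ 0 (e i) = -e i := h3 0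
      have r2 : ∀ i, i ≠ a 2 → i ≠ a 3 → ρ 2 (e i) = -e i := h3 2
      fin_cases j
      · change -e (a 0) = ρ 0 (ρ 2 (e (a 0)))
        rw [r2 _ (ha.ne (by decide)) (ha.ne (by decide)), map_neg, h1 0]
      · change -e (a 1) = ρ 0 (ρ 2 (e (a 1)))
        rw [r2 _ (ha.ne (by decide)) (ha.ne (by decide)), map_neg, q0]
      · change -e (a 2) = ρ 0 (ρ 2 (e (a 2)))
        rw [h1 2, r0 _ (ha.ne (by decide)) (ha.ne (by decide))]
      · change -e (a 3) = ρ 0 (ρ 2 (e (a 3)))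
        rw [q2, r0 _ (ha.ne (by decide)) (ha.ne (by decide))]
    rw [this]
    exact Γ.mul_mem (hρ 0) (hρ 2)

namespace Cycle

variable {Γ : Subgroup O4} {f : E4 → E4}

/-- A simple cycle whose nodes lie on coordinate axes and in different group orbits. -/
structure IsAxial (C : Cycle Γ f) : Prop where
  simple : C.IsSimple
  onAxis : ∀ j, OnAxis (C.node j)
  distinct : ∀ a b, a ≠ b → ¬ SameOrbit Γ (C.node a) (C.node b)

/-- Nodes on the same axis lie on different sides of the origin, and no symmetry exchanges the
sides. -/
theorem IsAxial.of_axis_eq {C : Cycle Γ f} (hC : C.IsAxial) {i j : Fin (C.k + 1)} (hij : i ≠ j)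
    (h : axis (C.node i) = axis (C.node j)) :
    (∀ ρ ∈ Γ, ρ (C.node i) ≠ -C.node i) ∧ ∃ c : ℝ, c < 0 ∧ C.node j = c • C.node i := by
  have hi0 := hC.simple.node_ne_zero i
  obtain ⟨c, hc, hcj⟩ :=
    (hC.onAxis i).exists_smul_eq hi0 (hC.onAxis j) (hC.simple.node_ne_zero j) h
  have hc' : c < 0 := by
    rcases lt_or_gt_of_ne hc with hc | hc
    · exact hc
    · exfalso
      have := hC.simple.meetsAxesOnce.eq_of_pos_smul hc (C.node_mem_L i) hi0
        (subset_groupOrbit _ _ (C.node_mem_carrier i))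
        (hcj ▸ subset_groupOrbit _ _ (C.node_mem_carrier j))
      exact hij (C.node_injective (this ▸ hcj)).symm
  -- A symmetry that reverses `node i` would put its image on the half-axis of `node j`, where the
  -- group orbit of the cycle has only one point; the two nodes would then be symmetric.
  refine ⟨fun ρ hρ hneg => ?_, c, hc', hcj⟩
  have h1 := hC.simple.meetsAxesOnce.eq_of_pos_smul (neg_pos.mpr hc') (x := -C.node i)
    ((C.L i).neg_mem (C.node_mem_L i)) (neg_ne_zero.mpr hi0)
    ⟨ρ, hρ, _, C.node_mem_carrier i, hneg⟩
    (by rw [neg_smul_neg, ← hcj]; exact subset_groupOrbit _ _ (C.node_mem_carrier j))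
  rw [neg_smul_neg, ← hcj] at h1
  exact hC.distinct i j hij ⟨ρ, hρ, by rw [hneg, h1]⟩

/-- A cycle with two consecutive nodes on one axis has no other nodes. -/
theorem IsAxial.of_consecutive_axis_eq {C : Cycle Γ f} (hC : C.IsAxial) (hf : ContDiff ℝ 1 f)
    (he : IsEquivariant Γ f) {j : Fin (C.k + 1)}
    (h : axis (C.node j) = axis (C.node (j + 1))) :
    C.k = 1 ∧ (∀ i, axis (C.node i) = axis (C.node 0)) ∧
      (LinearIsometryEquiv.neg ℝ : O4) ∉ Γ := by
  have hstep : ∀ i, axis (C.node i) = axis (C.node (i + 1)) := by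
    refine fin_cyclic_induction (p := fun i => axis (C.node i) = axis (C.node (i + 1))) h ?_
    intro i hi
    -- If the node after next left the axis, a half turn would reverse the node before it, which
    -- shares its axis with `node i`.
    by_contra hne
    obtain ⟨ρ, hρ, hneg⟩ := C.exists_neg_of_inner_eq_zero hC.simple hf he
      ((hC.onAxis (i + 1 + 1)).inner_eq_zero (hC.onAxis (i + 1)) (Ne.symm hne))
    exact (hC.of_axis_eq (C.ne_succ i).symm hi.symm).1 ρ hρ hneg
  have hall : ∀ i, axis (C.node i) = axis (C.node 0) :=
    fin_cyclic_induction (p := fun i => axis (C.node i) = axis (C.node 0)) (j := 0) rfl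
      fun i hi => (hstep i).symm.trans hi
  refine ⟨?_, hall, fun hneg => ?_⟩
  -- Three nodes on one line would be negative multiples of one another in pairs, which the signs
  -- exclude.
  · by_contra hk
    have hk2 : 2 ≤ C.k := by have := C.k_pos; omega
    let p : Fin (C.k + 1) := ⟨1, by omega⟩
    let q : Fin (C.k + 1) := ⟨2, by omega⟩
    have h0p : (0 : Fin (C.k + 1)) ≠ p := fun h => by
      have := congrArg Fin.val h; simp [p] at this
    have h0q : (0 : Fin (C.k + 1)) ≠ q := fun h => by
      have := congrArg Fin.val h; simp [q] at this
    have hpq : p ≠ q := fun h => by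
      have := congrArg Fin.val h; simp [p, q] at this
    obtain ⟨-, c, hc, h1⟩ := hC.of_axis_eq h0p (hall p).symm
    obtain ⟨-, d, hd, h2⟩ := hC.of_axis_eq h0q (hall q).symm
    obtain ⟨-, r, hr, h3⟩ := hC.of_axis_eq hpq ((hall p).trans (hall q).symm)
    rw [h1, h2, smul_smul] at h3
    have : d = r * c := smul_left_injective ℝ (hC.simple.node_ne_zero 0) h3
    have hpos := mul_pos_of_neg_of_neg hr hc
    linarith
  · exact (hC.of_axis_eq (C.ne_succ j) h).1 _ hneg (neg_apply _)

/-- A connection between different axes lies in the coordinate plane. -/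
theorem IsAxial.P_eq {C : Cycle Γ f} (hC : C.IsAxial) {j : Fin (C.k + 1)}
    (h : axis (C.node j) ≠ axis (C.node (j + 1))) :
    C.P j = Submodule.span ℝ {e (axis (C.node j)), e (axis (C.node (j + 1)))} := by
  refine (Submodule.eq_of_le_of_finrank_eq ?_ ?_).symm
  · rw [Submodule.span_le]
    rintro y (rfl | rfl)
    · rw [(hC.onAxis j).e_eq_smul (hC.simple.node_ne_zero j)]
      exact (C.P j).smul_mem _ (C.node_mem_P j)
    · rw [(hC.onAxis (j + 1)).e_eq_smul (hC.simple.node_ne_zero (j + 1))]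
      exact (C.P j).smul_mem _ (C.node_succ_mem_P j)
  · rw [hC.simple.finrank_P, finrank_span_e_e h]

/-- A cycle without consecutive nodes on one axis has three or four nodes on different axes. -/
theorem IsAxial.of_consecutive_axis_ne {C : Cycle Γ f} (hC : C.IsAxial) (hf : ContDiff ℝ 1 f)
    (he : IsEquivariant Γ f) (h : ∀ j, axis (C.node j) ≠ axis (C.node (j + 1))) :
    Function.Injective (fun j => axis (C.node j)) ∧ (C.k = 2 ∨ C.k = 3) ∧
      (LinearIsometryEquiv.neg ℝ : O4) ∈ Γ := by
  have hinj : Function.Injective (fun j => axis (C.node j)) := by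
    intro i j hij
    by_contra hne
    -- Every node is perpendicular to its successor and is therefore reversed by a symmetry, so no
    -- second node can lie on its axis.
    obtain ⟨ρ, hρ, hneg⟩ := C.exists_neg_of_inner_eq_zero hC.simple hf he
      ((hC.onAxis (i + 1)).inner_eq_zero (hC.onAxis i) (h i).symm)
    exact (hC.of_axis_eq hne hij).1 ρ hρ hneg
  have hk : C.k = 2 ∨ C.k = 3 := by
    have h4 := Fintype.card_le_of_injective _ hinj
    simp only [Fintype.card_fin] at h4
    -- With two nodes both connections would lie in the same coordinate plane.
    have h1 : C.k ≠ 1 := by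
      intro hk
      have h2 : (0 : Fin (C.k + 1)) + 1 + 1 = 0 := by
        apply Fin.ext
        simp only [Fin.val_add, Fin.val_one', Fin.val_zero]
        rw [hk]
      refine C.P_ne_P_succ 0 ?_
      rw [hC.P_eq (h 0), hC.P_eq (h (0 + 1)), h2, Set.pair_comm]
    have := C.k_pos
    omega
  refine ⟨hinj, hk, neg_mem_of_halfTurns hk hinj fun j => ?_⟩
  obtain ⟨ρ, hρ, h1, h2⟩ := C.exists_halfTurn hC.simple hf he j
  rw [hC.P_eq (h j)] at h1 h2
  refine ⟨ρ, hρ, h1 _ (Submodule.subset_span (by simp)), h1 _ (Submodule.subset_span (by simp)),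
    fun i hi hi' => h2 _ fun p hp => ?_⟩
  obtain ⟨a, c, rfl⟩ := Submodule.mem_span_pair.mp hp
  rw [inner_add_left, inner_smul_left, inner_smul_left, inner_e_e hi.symm, inner_e_e hi'.symm]
  simp

end Cycle

end HetNet

namespace HetNet

/-! ### Directed cycles in oriented graphs with four vertices -/

/-- Two cyclic paths traverse some edge in opposite directions. -/
def Opposed {k l : ℕ} (a : Fin (k + 1) → Fin 4) (b : Fin (l + 1) → Fin 4) : Prop :=
  ∃ i j, a i = b (j + 1) ∧ a (i + 1) = b j

/-- Every edge of the second cyclic path is an edge of the first one. -/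
def Covers {k l : ℕ} (a : Fin (k + 1) → Fin 4) (b : Fin (l + 1) → Fin 4) : Prop :=
  ∀ j, ∃ i, a i = b j ∧ a (i + 1) = b (j + 1)

/-- Modulo 4 each step is 1 or 2, and the four steps add up to 0, so they are all 1 or all 2; steps
of 2 would return to the start too early. -/
theorem four_cycle_rigid : ∀ a b c d : Fin 4, a ≠ b → a ≠ c → a ≠ d → b ≠ c → b ≠ d → c ≠ d →
    b + 1 ≠ a → c + 1 ≠ b → d + 1 ≠ c → a + 1 ≠ d → b = a + 1 ∧ c = b + 1 ∧ d = c + 1 ∧ a = d + 1 := by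
  decide

/-- After numbering the axes by their position along `a`, the other four-cycle never steps by `-1`,
so `four_cycle_rigid` applies. Hence a network contains at most one cycle with four nodes. -/
theorem covers_of_not_opposed {k l : ℕ} (hk : k = 3) (hl : l = 3) {a : Fin (k + 1) → Fin 4}
    {b : Fin (l + 1) → Fin 4} (ha : Function.Injective a) (hb : Function.Injective b)
    (h : ¬ Opposed a b) : Covers a b := by
  subst hk hl
  let π := Equiv.ofBijective a (Finite.injective_iff_bijective.mp ha)
  have hπ : ∀ i, a (π.symm i) = i := fun i => π.apply_symm_apply i
  have hinj : Function.Injective fun j => π.symm (b j) := π.symm.injective.comp hb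
  have hrev : ∀ j, π.symm (b (j + 1)) + 1 ≠ π.symm (b j) := fun j hj =>
    h ⟨π.symm (b (j + 1)), j, hπ _, by rw [hj, hπ]⟩
  have key := four_cycle_rigid (π.symm (b 0)) (π.symm (b 1)) (π.symm (b 2)) (π.symm (b 3))
    (hinj.ne (by decide)) (hinj.ne (by decide)) (hinj.ne (by decide)) (hinj.ne (by decide))
    (hinj.ne (by decide)) (hinj.ne (by decide)) (hrev 0) (hrev 1) (hrev 2) (hrev 3)
  intro j
  refine ⟨π.symm (b j), hπ _, ?_⟩
  have : π.symm (b j) + 1 = π.symm (b (j + 1)) := by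
    fin_cases j
    exacts [key.1.symm, key.2.1.symm, key.2.2.1.symm, key.2.2.2.symm]
  rw [this, hπ]

/-- The triangles `a → b → c → a` and `x → y → z → x` have opposite edges. -/
abbrev TriangleOpposed (a b c x y z : Fin 4) : Prop :=
  (a = y ∧ b = x) ∨ (a = z ∧ b = y) ∨ (a = x ∧ b = z) ∨ (b = y ∧ c = x) ∨ (b = z ∧ c = y) ∨
    (b = x ∧ c = z) ∨ (c = y ∧ a = x) ∨ (c = z ∧ a = y) ∨ (c = x ∧ a = z)

/-- The triangles `a → b → c → a` and `x → y → z → x` are equal. -/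
abbrev TriangleEq (a b c x y z : Fin 4) : Prop :=
  (a = x ∧ b = y ∧ c = z) ∨ (a = y ∧ b = z ∧ c = x) ∨ (a = z ∧ b = x ∧ c = y)

-- Two different triangles without opposite edges share one edge, say `a → b`. Of the two remaining
-- triples, one contains `a` and both third vertices, with two edges into `a`, and the other
-- contains `b` and both third vertices, with two edges out of `b`; neither carries a third directed
-- triangle. Fixing the first triangle keeps the case check small.
set_option synthInstance.maxSize 1000 in
set_option synthInstance.maxHeartbeats 200000 in
set_option maxRecDepth 4000 in
theorem triangle_trichotomy_standard : ∀ x y z : Fin 4, x ≠ y → x ≠ z → y ≠ z →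
    ¬ TriangleOpposed 0 1 2 x y z → ¬ TriangleEq 0 1 2 x y z →
    ∀ u v w : Fin 4, u ≠ v → u ≠ w → v ≠ w → ¬ TriangleOpposed 0 1 2 u v w →
      ¬ TriangleOpposed x y z u v w → TriangleEq 0 1 2 u v w ∨ TriangleEq x y z u v w := by
  decide

theorem exists_perm_standard {a b c : Fin 4} (hab : a ≠ b) (hac : a ≠ c) (hbc : b ≠ c) :
    ∃ π : Equiv.Perm (Fin 4), π a = 0 ∧ π b = 1 ∧ π c = 2 := by
  let π := Equiv.swap a 0
  let b' := π b
  let ρ := Equiv.swap b' 1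
  let c' := ρ (π c)
  have ha : π a = 0 := Equiv.swap_apply_left a 0
  have hb : ρ b' = 1 := Equiv.swap_apply_left b' 1
  have h1 : b' ≠ 0 := ha ▸ π.injective.ne hab.symm
  have h0 : ρ 0 = 0 := Equiv.swap_apply_of_ne_of_ne h1.symm (by decide)
  have h2 : c' ≠ 0 := by
    rw [← h0, ← ha]
    exact ρ.injective.ne (π.injective.ne hac.symm)
  have h3 : c' ≠ 1 := by
    rw [← hb]
    exact ρ.injective.ne (π.injective.ne hbc.symm)
  refine ⟨(π.trans ρ).trans (Equiv.swap c' 2), ?_, ?_, ?_⟩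
  · simp only [Equiv.trans_apply, ha, h0]
    exact Equiv.swap_apply_of_ne_of_ne h2.symm (by decide)
  · change Equiv.swap c' 2 (ρ b') = 1
    rw [hb]
    exact Equiv.swap_apply_of_ne_of_ne h3.symm (by decide)
  · exact Equiv.swap_apply_left c' 2

/-- A permutation of the axes brings the first triangle into standard position. The result bounds
the number of cycles with three nodes by two. -/
theorem covers_of_not_opposed_of_three {k l m : ℕ} (hk : k = 2) (hl : l = 2) (hm : m = 2)
    {a : Fin (k + 1) → Fin 4} {b : Fin (l + 1) → Fin 4} {c : Fin (m + 1) → Fin 4}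
    (ha : Function.Injective a) (hb : Function.Injective b) (hc : Function.Injective c)
    (hab : ¬ Opposed a b) (hac : ¬ Opposed a c) (hbc : ¬ Opposed b c) :
    (Covers a b ∧ Covers b a) ∨ (Covers a c ∧ Covers c a) ∨ (Covers b c ∧ Covers c b) := by
  subst hk hl hm
  obtain ⟨π, h0, h1, h2⟩ := exists_perm_standard (ha.ne (show (0 : Fin 3) ≠ 1 by decide))
    (ha.ne (show (0 : Fin 3) ≠ 2 by decide)) (ha.ne (show (1 : Fin 3) ≠ 2 by decide))
  have hopp : ∀ a b : Fin 3 → Fin 4, ¬ Opposed (k := 2) (l := 2) a b →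
      ¬ TriangleOpposed (π (a 0)) (π (a 1)) (π (a 2)) (π (b 0)) (π (b 1)) (π (b 2)) := by
    intro a b h ht
    simp only [TriangleOpposed, π.injective.eq_iff] at ht
    rcases ht with ht | ht | ht | ht | ht | ht | ht | ht | ht
    exacts [h ⟨0, 0, ht⟩, h ⟨0, 1, ht⟩, h ⟨0, 2, ht⟩, h ⟨1, 0, ht⟩, h ⟨1, 1, ht⟩, h ⟨1, 2, ht⟩,
      h ⟨2, 0, ht⟩, h ⟨2, 1, ht⟩, h ⟨2, 2, ht⟩]
  have hcov : ∀ a b : Fin 3 → Fin 4,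
      TriangleEq (π (a 0)) (π (a 1)) (π (a 2)) (π (b 0)) (π (b 1)) (π (b 2)) →
      Covers (k := 2) (l := 2) a b ∧ Covers (k := 2) (l := 2) b a := by
    intro a b h
    simp only [TriangleEq, π.injective.eq_iff] at h
    rcases h with ⟨e0, e1, e2⟩ | ⟨e0, e1, e2⟩ | ⟨e0, e1, e2⟩
    · constructor <;> intro j <;> fin_cases j
      exacts [⟨0, e0, e1⟩, ⟨1, e1, e2⟩, ⟨2, e2, e0⟩, ⟨0, e0.symm, e1.symm⟩, ⟨1, e1.symm, e2.symm⟩,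
        ⟨2, e2.symm, e0.symm⟩]
    · constructor <;> intro j <;> fin_cases j
      exacts [⟨2, e2, e0⟩, ⟨0, e0, e1⟩, ⟨1, e1, e2⟩, ⟨1, e0.symm, e1.symm⟩, ⟨2, e1.symm, e2.symm⟩,
        ⟨0, e2.symm, e0.symm⟩]
    · constructor <;> intro j <;> fin_cases j
      exacts [⟨1, e1, e2⟩, ⟨2, e2, e0⟩, ⟨0, e0, e1⟩, ⟨2, e0.symm, e1.symm⟩, ⟨0, e1.symm, e2.symm⟩,
        ⟨1, e2.symm, e0.symm⟩]
  have nb : ∀ {b : Fin 3 → Fin 4}, Function.Injective b → ∀ {i j : Fin 3}, i ≠ j → π (b i) ≠ π (b j) :=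
    fun hb _ _ hij => π.injective.ne (hb.ne hij)
  by_cases hab' : TriangleEq (π (a 0)) (π (a 1)) (π (a 2)) (π (b 0)) (π (b 1)) (π (b 2))
  · exact Or.inl (hcov a b hab')
  · have o1 := hopp a b hab
    have o2 := hopp a c hac
    have o3 := hopp b c hbc
    have c1 := hcov a c
    have c2 := hcov b c
    rw [h0, h1, h2] at o1 o2 c1 hab'
    rcases triangle_trichotomy_standard _ _ _ (nb hb (by decide)) (nb hb (by decide))
      (nb hb (by decide)) o1 hab' _ _ _ (nb hc (by decide)) (nb hc (by decide))
      (nb hc (by decide)) o2 o3 with h | h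
    · exact Or.inr (Or.inl (c1 h))
    · exact Or.inr (Or.inr (c2 h))

/-! ### Counting cycles -/

/-- The images of `p` and `q` have sizes with sum at most 3, hence with product at most 2. In the
application `p` and `q` pick the outgoing and the incoming plane of a cycle at a common node. -/
theorem card_le_two_of_disjoint {r : ℕ} (p q : Fin r → Fin 3)
    (hinj : ∀ i j, p i = p j → q i = q j → i = j) (hdisj : ∀ i j, p i ≠ q j) : r ≤ 2 := by
  classical
  let A := Finset.univ.image p
  let B := Finset.univ.image q
  have hd : Disjoint A B := by
    rw [Finset.disjoint_left]
    intro x hx hy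
    obtain ⟨i, -, rfl⟩ := Finset.mem_image.mp hx
    obtain ⟨j, -, hj⟩ := Finset.mem_image.mp hy
    exact hdisj i j hj.symm
  have h3 : A.card + B.card ≤ 3 := by
    rw [← Finset.card_union_of_disjoint hd]
    exact (Finset.card_le_univ _).trans (by simp)
  have hr : r ≤ (A ×ˢ B).card := by
    have := Finset.card_le_card_of_injOn (s := (Finset.univ : Finset (Fin r))) (t := A ×ˢ B)
      (fun i => (p i, q i)) (fun i _ => by simp [A, B]) (fun i _ j _ hij => by
        simp only [Prod.mk.injEq] at hij
        exact hinj i j hij.1 hij.2)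
    simpa using this
  rw [Finset.card_product] at hr
  have hA : A.card ≤ 3 := by omega
  interval_cases h : A.card <;> omega

/-- At most two indices satisfy `p` and at most one does not; a total of at least two leaves the
splittings 2 + 0, 1 + 1 and 2 + 1. -/
theorem map_label_mem {r : ℕ} (hr : 2 ≤ r) (lab : Fin r → Label) (p : Fin r → Prop) {X Y : Label}
    (hX : ∀ i, p i → lab i = X) (hY : ∀ i, ¬ p i → lab i = Y)
    (h3 : ∀ i j l, p i → p j → p l → i = j ∨ i = l ∨ j = l)
    (h4 : ∀ i j, ¬ p i → ¬ p j → i = j) :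
    Finset.univ.val.map lab = {X, X} ∨ Finset.univ.val.map lab = {X, Y} ∨
      Finset.univ.val.map lab = {X, X, Y} := by
  classical
  let F := Finset.univ.filter p
  let G := Finset.univ.filter fun i => ¬ p i
  have hF : F.card ≤ 2 := by
    by_contra hcon
    obtain ⟨i, j, l, hi, hj, hl, hij, hil, hjl⟩ := Finset.two_lt_card_iff.mp (not_le.mp hcon)
    simp only [F, Finset.mem_filter, Finset.mem_univ, true_and] at hi hj hl
    rcases h3 i j l hi hj hl with h | h | h
    exacts [hij h, hil h, hjl h]
  have hG : G.card ≤ 1 := by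
    refine Finset.card_le_one.mpr fun i hi j hj => ?_
    simp only [G, Finset.mem_filter, Finset.mem_univ, true_and] at hi hj
    exact h4 i j hi hj
  have hsum : F.card + G.card = r := by
    have := Finset.card_filter_add_card_filter_not (s := (Finset.univ : Finset (Fin r))) p
    simpa using this
  have hmap : Finset.univ.val.map lab = Multiset.replicate F.card X + Multiset.replicate G.card Y := by
    have h1 : (Finset.univ : Finset (Fin r)).val = F.val + G.val := by
      simp only [F, G, Finset.filter_val]
      exact (Multiset.filter_add_not p _).symm
    rw [h1, Multiset.map_add]
    congr 1
    · exact Multiset.eq_replicate.mpr ⟨by simp, fun y hy => by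
        obtain ⟨i, hi, rfl⟩ := Multiset.mem_map.mp hy
        exact hX i (Finset.mem_filter.mp (Finset.mem_val.mp hi)).2⟩
    · exact Multiset.eq_replicate.mpr ⟨by simp, fun y hy => by
        obtain ⟨i, hi, rfl⟩ := Multiset.mem_map.mp hy
        exact hY i (Finset.mem_filter.mp (Finset.mem_val.mp hi)).2⟩
  rw [hmap]
  have hcases : (F.card = 2 ∧ G.card = 0) ∨ (F.card = 1 ∧ G.card = 1) ∨
      (F.card = 2 ∧ G.card = 1) := by omega
  rcases hcases with ⟨h1, h2⟩ | ⟨h1, h2⟩ | ⟨h1, h2⟩ <;> rw [h1, h2]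
  · exact Or.inl rfl
  · exact Or.inr (Or.inl rfl)
  · exact Or.inr (Or.inr rfl)

end HetNet

/-! ### The possible types of networks. -/

namespace HetNet
open scoped InnerProductSpace

theorem hasOddIsotropy_neg {Γ : Subgroup O4} {x : E4} :
    HasOddIsotropy Γ (-x) ↔ HasOddIsotropy Γ x := by
  have : isotropy Γ (-x) = isotropy Γ x := by
    ext γ
    rw [mem_isotropy, mem_isotropy, map_neg, neg_inj]
  rw [HasOddIsotropy, this, HasOddIsotropy]

/-- Equivariance under `-Id` makes the linearizations at `x` and `-x` equal. This serves to compare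
nodes that are known only up to sign. -/
theorem isSinkIn_of_neg {Γ : Subgroup O4} {f : E4 → E4} (hf : ContDiff ℝ 1 f)
    (he : IsEquivariant Γ f) (hneg : (LinearIsometryEquiv.neg ℝ : O4) ∈ Γ) {P : Submodule ℝ E4}
    {x : E4} (h : IsSinkIn f P (-x)) : IsSinkIn f P x := by
  have hd : fderiv ℝ f (-x) = fderiv ℝ f x := by
    ext1 v
    have := he.fderiv_apply (hf.differentiable one_ne_zero) hneg x v
    rw [neg_apply, neg_apply, neg_apply, map_neg, neg_inj] at this
    exact this
  obtain ⟨h1, h2, h3⟩ := h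
  refine ⟨by simpa using P.neg_mem h1, ?_, ?_⟩
  · have := he _ hneg x
    rw [neg_apply, neg_apply, h2] at this
    simpa using this.symm
  · rw [linearizationOn, hd] at h3
    exact h3

theorem IsSinkIn.not_isSaddleIn {f : E4 → E4} {P : Submodule ℝ E4} {x : E4} (h : IsSinkIn f P x) :
    ¬ IsSaddleIn f P x := fun h' => by
  obtain ⟨μ, hμ, hμ0⟩ := h'.2.2.2.2
  exact absurd (h.2.2 μ hμ) (not_lt.mpr hμ0.le)

/-! ### The topology of cycles -/

/-- Away from the two limits only a compact piece of the trajectory matters. Closedness of cycles is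
what lets connectedness of a network produce cycles that meet. -/
theorem isClosed_insert_insert_range {z : ℝ → E4} (hz : Continuous z) {x y : E4}
    (hx : Tendsto z atBot (𝓝 x)) (hy : Tendsto z atTop (𝓝 y)) :
    IsClosed (insert x (insert y (Set.range z))) := by
  refine isClosed_of_closure_subset fun p hp => ?_
  by_contra hcon
  simp only [Set.mem_insert_iff, not_or] at hcon
  obtain ⟨hpx, hpy, hpz⟩ := hcon
  obtain ⟨U, V, hU, hV, hpU, hxV, hUV⟩ := t2_separation hpx
  obtain ⟨U', V', hU', hV', hpU', hyV', hUV'⟩ := t2_separation hpy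
  obtain ⟨a, ha⟩ := eventually_atBot.mp (hx.eventually_mem (hV.mem_nhds hxV))
  obtain ⟨b, hb⟩ := eventually_atTop.mp (hy.eventually_mem (hV'.mem_nhds hyV'))
  have hK : IsClosed (z '' Set.Icc a b) := (isCompact_Icc.image hz).isClosed
  have hpK : p ∉ z '' Set.Icc a b := fun ⟨t, _, ht⟩ => hpz ⟨t, ht⟩
  obtain ⟨q, hq, hq'⟩ := mem_closure_iff.mp hp (U ∩ U' ∩ (z '' Set.Icc a b)ᶜ)
    ((hU.inter hU').inter hK.isOpen_compl) ⟨⟨hpU, hpU'⟩, hpK⟩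
  rcases hq' with rfl | rfl | ⟨t, rfl⟩
  · exact Set.disjoint_left.mp hUV hq.1.1 hxV
  · exact Set.disjoint_left.mp hUV' hq.1.2 hyV'
  · rcases le_or_gt t a with hta | hta
    · exact Set.disjoint_left.mp hUV hq.1.1 (ha t hta)
    rcases le_or_gt b t with htb | htb
    · exact Set.disjoint_left.mp hUV' hq.1.2 (hb t htb)
    · exact hq.2 ⟨t, ⟨hta.le, htb.le⟩, rfl⟩

namespace Cycle

variable {Γ : Subgroup O4} {f : E4 → E4}

theorem continuous_traj (C : Cycle Γ f) (j : Fin (C.k + 1)) : Continuous (C.traj j) :=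
  continuous_iff_continuousAt.mpr fun t => (C.solution j t).continuousAt

theorem carrier_eq_iUnion (C : Cycle Γ f) :
    C.carrier = ⋃ j, insert (C.node j) (insert (C.node (j + 1)) (Set.range (C.traj j))) := by
  ext y
  simp only [carrier, Set.mem_union, Set.mem_iUnion, Set.mem_insert_iff]
  constructor
  · rintro (⟨j, rfl⟩ | ⟨j, hj⟩)
    · exact ⟨j, Or.inl rfl⟩
    · exact ⟨j, Or.inr (Or.inr hj)⟩
  · rintro ⟨j, rfl | rfl | hj⟩
    · exact Or.inl ⟨_, rfl⟩
    · exact Or.inl ⟨_, rfl⟩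
    · exact Or.inr ⟨j, hj⟩

theorem isClosed_carrier (C : Cycle Γ f) : IsClosed C.carrier := by
  rw [carrier_eq_iUnion]
  exact isClosed_iUnion_of_finite fun j =>
    isClosed_insert_insert_range (C.continuous_traj j) (C.tendsto_source j) (C.tendsto_target j)

/-- A connection contains no equilibria. -/
theorem traj_ne_of_eq_zero (C : Cycle Γ f) (hf : ContDiff ℝ 1 f) {x : E4} (hx : f x = 0)
    (j : Fin (C.k + 1)) (t : ℝ) : C.traj j t ≠ x := by
  intro h
  have hconst := solution_eq_const hf (C.solution j) hx h
  obtain ⟨s, hs⟩ := C.exists_traj_ne j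
  have h1 := C.tendsto_source j
  rw [hconst] at h1
  have hxn := tendsto_nhds_unique tendsto_const_nhds h1
  exact hs (by rw [hconst]; exact hxn)

/-- Cycles that intersect have a common node. -/
theorem exists_common_node {C C' : Cycle Γ f} (hf : ContDiff ℝ 1 f) {y : E4} (hy : y ∈ C.carrier)
    (hy' : y ∈ C'.carrier) : ∃ i j, C.node i = C'.node j := by
  rcases hy with ⟨i, rfl⟩ | hy <;> rcases hy' with ⟨j, hj⟩ | hy'
  · exact ⟨i, j, hj.symm⟩
  · obtain ⟨j, t, hj⟩ := Set.mem_iUnion.mp hy'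
    exact absurd hj (C'.traj_ne_of_eq_zero hf (C.saddle i).2.1 j t)
  · obtain ⟨i, t, hi⟩ := Set.mem_iUnion.mp hy
    exact absurd (hi.trans hj.symm) (C.traj_ne_of_eq_zero hf (C'.saddle j).2.1 i t)
  · obtain ⟨i, t, rfl⟩ := Set.mem_iUnion.mp hy
    obtain ⟨j, s, hs⟩ := Set.mem_iUnion.mp hy'
    -- Connections that meet are time shifts of each other, so they have the same source.
    have h := solution_eq_shift hf (C.solution i) (C'.solution j) hs.symm
    refine ⟨i, j, tendsto_nhds_unique ?_ (C'.tendsto_source j)⟩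
    rw [← h]
    exact (C.tendsto_source i).comp (tendsto_atBot_add_const_right _ _ tendsto_id)

end Cycle

theorem fin_eq_or_eq_succ {k : ℕ} (hk : k = 1) (i j : Fin (k + 1)) : i = j ∨ i = j + 1 := by
  subst hk
  revert i j
  decide

theorem fin_add_one_add_one {k : ℕ} (hk : k = 1) (i : Fin (k + 1)) : i + 1 + 1 = i := by
  subst hk
  revert i
  decide

theorem fin_three_cases {k : ℕ} (hk : k = 2) (i : Fin (k + 1)) : i = 0 ∨ i = 0 + 1 ∨ i = 0 + 1 + 1 := by
  subst hk
  revert i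
  decide

namespace Network

variable {Γ : Subgroup O4} {f : E4 → E4} {N : Network Γ f}

theorem isAxial (hN : N.IsSimple) (hA : N.AssumptionA) {C : Cycle Γ f} (hC : C ∈ N.cycles) :
    C.IsAxial := by
  refine ⟨hN.simple_cycles C hC, hA.on_axis C hC, fun a b hab => ?_⟩
  obtain ⟨j, l, h⟩ := hA.elementary C hC
  exact Cycle.not_sameOrbit_of_isElementaryBlock h hab

theorem node_mem_groupOrbit {C : Cycle Γ f} (hC : C ∈ N.cycles) (i : Fin (C.k + 1)) :
    C.node i ∈ groupOrbit Γ N.carrier :=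
  subset_groupOrbit _ _ (Set.mem_biUnion hC (C.node_mem_carrier i))

/-- Nodes on the same half-axis are equal. -/
theorem node_eq_of_pos_smul (hN : N.IsSimple) {C C' : Cycle Γ f} (hC : C ∈ N.cycles)
    (hC' : C' ∈ N.cycles) {i : Fin (C.k + 1)} {j : Fin (C'.k + 1)} {c : ℝ} (hc : 0 < c)
    (h : C'.node j = c • C.node i) : C'.node j = C.node i := by
  have := (hN.meetsAxesOnce C hC).eq_of_pos_smul hc (C.node_mem_L i)
    ((hN.simple_cycles C hC).node_ne_zero i) (node_mem_groupOrbit hC i)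
    (h ▸ node_mem_groupOrbit hC' j)
  rw [h, this]

/-! #### Networks for groups that contain `-Id` -/

/-- With `-Id` in the group both half-axes through a node contain a point of the group orbit of the
network, and neither contains a second one. -/
theorem node_eq_or_neg (hN : N.IsSimple) (hA : N.AssumptionA)
    (hneg : (LinearIsometryEquiv.neg ℝ : O4) ∈ Γ) {C C' : Cycle Γ f} (hC : C ∈ N.cycles)
    (hC' : C' ∈ N.cycles) {i : Fin (C.k + 1)} {j : Fin (C'.k + 1)}
    (h : axis (C.node i) = axis (C'.node j)) :
    C'.node j = C.node i ∨ C'.node j = -C.node i := by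
  have hi0 := (hN.simple_cycles C hC).node_ne_zero i
  obtain ⟨c, hc, hcj⟩ := ((isAxial hN hA hC).onAxis i).exists_smul_eq hi0
    ((isAxial hN hA hC').onAxis j) ((hN.simple_cycles C' hC').node_ne_zero j) h
  rcases lt_or_gt_of_ne hc with hc | hc
  · right
    have h1 := (hN.meetsAxesOnce C hC).eq_of_pos_smul (neg_pos.mpr hc) (x := -C.node i)
      ((C.L i).neg_mem (C.node_mem_L i)) (neg_ne_zero.mpr hi0)
      ⟨_, hneg, _, Set.mem_biUnion hC (C.node_mem_carrier i), neg_apply _⟩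
      (by rw [neg_smul_neg, ← hcj]; exact node_mem_groupOrbit hC' j)
    rw [neg_smul_neg, ← hcj] at h1
    exact h1
  · exact Or.inl (node_eq_of_pos_smul hN hC hC' hc hcj)

/-- The axes that a cycle visits. -/
noncomputable abbrev axes (C : Cycle Γ f) (i : Fin (C.k + 1)) : Fin 4 := axis (C.node i)

theorem axes_ne_succ (hN : N.IsSimple) (hA : N.AssumptionA) (hf : ContDiff ℝ 1 f)
    (he : IsEquivariant Γ f) (hneg : (LinearIsometryEquiv.neg ℝ : O4) ∈ Γ) {C : Cycle Γ f}
    (hC : C ∈ N.cycles) (j : Fin (C.k + 1)) : axes C j ≠ axes C (j + 1) := fun h =>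
  ((isAxial hN hA hC).of_consecutive_axis_eq hf he h).2.2 hneg

theorem P_eq_of_axes_eq (hN : N.IsSimple) (hA : N.AssumptionA) (hf : ContDiff ℝ 1 f)
    (he : IsEquivariant Γ f) (hneg : (LinearIsometryEquiv.neg ℝ : O4) ∈ Γ) {C C' : Cycle Γ f}
    (hC : C ∈ N.cycles) (hC' : C' ∈ N.cycles) {i : Fin (C.k + 1)} {j : Fin (C'.k + 1)}
    (h : ({axes C i, axes C (i + 1)} : Set (Fin 4)) = {axes C' j, axes C' (j + 1)}) :
    C.P i = C'.P j := by
  rw [(isAxial hN hA hC).P_eq (axes_ne_succ hN hA hf he hneg hC i),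
    (isAxial hN hA hC').P_eq (axes_ne_succ hN hA hf he hneg hC' j)]
  have := congrArg (fun s => e '' s) h
  simp only [Set.image_pair] at this
  rw [this]

/-- Opposite edges span the same plane, in which the source of one connection would be a saddle and,
up to sign, also the target of the other and hence a sink. -/
theorem not_opposed (hN : N.IsSimple) (hA : N.AssumptionA) (hf : ContDiff ℝ 1 f)
    (he : IsEquivariant Γ f) (hneg : (LinearIsometryEquiv.neg ℝ : O4) ∈ Γ) {C C' : Cycle Γ f}
    (hC : C ∈ N.cycles) (hC' : C' ∈ N.cycles) : ¬ Opposed (axes C) (axes C') := by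
  rintro ⟨i, j, h1, h2⟩
  have hP := P_eq_of_axes_eq hN hA hf he hneg hC hC' (i := i) (j := j)
    (by rw [h1, h2, Set.pair_comm])
  have hsink := C'.sink j
  rw [show fixedSpace (C'.Sig j) = fixedSpace (C.Sig i) from hP.symm] at hsink
  rcases node_eq_or_neg hN hA hneg hC hC' h1 with h | h
  · rw [h] at hsink
    exact hsink.not_isSaddleIn (C.saddle i)
  · rw [h] at hsink
    exact (isSinkIn_of_neg hf he hneg hsink).not_isSaddleIn (C.saddle i)

/-- Equal directed edges give the same plane and, up to `-Id`, the same source, and these determine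
the connection up to symmetry. -/
theorem groupOrbit_subset_of_covers (hN : N.IsSimple) (hA : N.AssumptionA) (hf : ContDiff ℝ 1 f)
    (he : IsEquivariant Γ f) (hneg : (LinearIsometryEquiv.neg ℝ : O4) ∈ Γ) {C C' : Cycle Γ f}
    (hC : C ∈ N.cycles) (hC' : C' ∈ N.cycles) (h : Covers (axes C) (axes C')) :
    groupOrbit Γ C'.carrier ⊆ groupOrbit Γ C.carrier := by
  refine Cycle.groupOrbit_carrier_subset (hN.simple_cycles C hC) hf he fun j => ?_
  obtain ⟨i, h1, h2⟩ := h j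
  have hP := P_eq_of_axes_eq hN hA hf he hneg hC hC' (i := i) (j := j) (by rw [h1, h2])
  rcases node_eq_or_neg hN hA hneg hC hC' h1 with hn | hn
  · exact ⟨i, 1, Γ.one_mem, hn.symm, fun y hy => hP ▸ hy⟩
  · exact ⟨i, _, hneg, by rw [neg_apply, hn, neg_neg], fun y hy => hP ▸ (C'.P j).neg_mem hy⟩

theorem isTypeA_iff_of_neg_mem (hN : N.IsSimple) (hA : N.AssumptionA) (hf : ContDiff ℝ 1 f)
    (he : IsEquivariant Γ f) (hneg : (LinearIsometryEquiv.neg ℝ : O4) ∈ Γ) {C C' : Cycle Γ f}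
    (hC : C ∈ N.cycles) (hC' : C' ∈ N.cycles) : C.IsTypeA ↔ C'.IsTypeA := by
  obtain ⟨hi, hk, -⟩ := (isAxial hN hA hC).of_consecutive_axis_ne hf he
    (axes_ne_succ hN hA hf he hneg hC)
  obtain ⟨hi', hk', -⟩ := (isAxial hN hA hC').of_consecutive_axis_ne hf he
    (axes_ne_succ hN hA hf he hneg hC')
  -- Two cycles that visit at least three of the four axes each must share one.
  have hcommon : ∃ i j, axes C i = axes C' j := by
    classical
    by_contra hcon
    push Not at hcon
    have hd : Disjoint (Finset.univ.image (axes C)) (Finset.univ.image (axes C')) := by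
      rw [Finset.disjoint_left]
      intro x hx hy
      obtain ⟨i, -, rfl⟩ := Finset.mem_image.mp hx
      obtain ⟨j, -, hj⟩ := Finset.mem_image.mp hy
      exact hcon i j hj.symm
    have h4 := Finset.card_le_univ (Finset.univ.image (axes C) ∪ Finset.univ.image (axes C'))
    rw [Finset.card_union_of_disjoint hd, Finset.card_image_of_injective _ hi,
      Finset.card_image_of_injective _ hi'] at h4
    simp only [Finset.card_univ, Fintype.card_fin] at h4
    omega
  obtain ⟨i, j, hij⟩ := hcommon
  rw [C.isTypeA_iff (hN.simple_cycles C hC) hf he i,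
    C'.isTypeA_iff (hN.simple_cycles C' hC') hf he j]
  rcases node_eq_or_neg hN hA hneg hC hC' hij with h | h
  · rw [h]
  · rw [h, hasOddIsotropy_neg]

/-- Two consecutive planes already contain all three axes and hence the third plane. As the cycle is
not of type A, a reflection fixes both planes. -/
theorem isTypeB_of_three (hN : N.IsSimple) (hA : N.AssumptionA) (hf : ContDiff ℝ 1 f)
    (he : IsEquivariant Γ f) (hneg : (LinearIsometryEquiv.neg ℝ : O4) ∈ Γ) {C : Cycle Γ f}
    (hC : C ∈ N.cycles) (hk : C.k = 2) (hnA : ¬ C.IsTypeA) : C.IsTypeB := by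
  have hs := hN.simple_cycles C hC
  rw [C.isTypeA_iff hs hf he (0 + 1), not_not] at hnA
  refine C.isTypeB_of_odd hs hf he hnA fun j => ?_
  rcases fin_three_cases hk j with rfl | rfl | rfl
  · exact le_sup_left
  · exact le_sup_right
  · have hax := isAxial hN hA hC
    have h3 : (0 : Fin (C.k + 1)) + 1 + 1 + 1 = 0 := by
      apply Fin.ext
      simp only [Fin.val_add, Fin.val_one', Fin.val_zero]
      rw [hk]
    rw [hax.P_eq (axes_ne_succ hN hA hf he hneg hC _), h3, Submodule.span_le]
    rintro y (rfl | rfl)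
    · rw [(hax.onAxis _).e_eq_smul (hs.node_ne_zero _)]
      exact Submodule.smul_mem _ _ (Submodule.mem_sup_right (C.node_succ_mem_P (0 + 1)))
    · rw [(hax.onAxis _).e_eq_smul (hs.node_ne_zero _)]
      exact Submodule.smul_mem _ _ (Submodule.mem_sup_left (C.node_mem_P 0))

/-- The nodes lie on all four axes and span the whole space. -/
theorem not_isTypeB_of_four (hN : N.IsSimple) (hA : N.AssumptionA) (hf : ContDiff ℝ 1 f)
    (he : IsEquivariant Γ f) (hneg : (LinearIsometryEquiv.neg ℝ : O4) ∈ Γ) {C : Cycle Γ f}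
    (hC : C ∈ N.cycles) (hk : C.k = 3) : ¬ C.IsTypeB := by
  rintro ⟨H, -, h3, hsub⟩
  have hax := isAxial hN hA hC
  have hinj := (hax.of_consecutive_axis_ne hf he (axes_ne_succ hN hA hf he hneg hC)).1
  have hsurj : Function.Surjective (axes C) :=
    ((Fintype.bijective_iff_injective_and_card _).mpr ⟨hinj, by simp [hk]⟩).2
  have htop : fixedSpace H = ⊤ := by
    rw [eq_top_iff, ← (EuclideanSpace.basisFun (Fin 4) ℝ).toBasis.span_eq, Submodule.span_le]
    rintro _ ⟨i, rfl⟩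
    obtain ⟨j, rfl⟩ := hsurj i
    have : (EuclideanSpace.basisFun (Fin 4) ℝ).toBasis (axes C j) = e (axis (C.node j)) := by simp
    rw [this, (hax.onAxis j).e_eq_smul (hax.simple.node_ne_zero j)]
    exact Submodule.smul_mem _ _ (hsub (C.node_mem_carrier j))
  rw [htop, finrank_top] at h3
  simp at h3

theorem exists_ne_orbit_of_hasType {τ : Multiset Label} (h : N.HasType τ) :
    ∃ (r : ℕ) (R : Fin r → Cycle Γ f), 2 ≤ r ∧ (∀ i, R i ∈ N.cycles) ∧
      (∀ i j, groupOrbit Γ (R i).carrier = groupOrbit Γ (R j).carrier → i = j) ∧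
      τ = Finset.univ.val.map fun i => (R i).label := by
  obtain ⟨r, R, hR, huniq, hτ⟩ := h
  refine ⟨r, R, ?_, hR, fun i j hij => (huniq (R i) (hR i)).unique rfl hij, hτ⟩
  obtain ⟨C, hC, C', hC', hne⟩ := N.two_cycles
  obtain ⟨i, hi, -⟩ := huniq C hC
  obtain ⟨j, hj, -⟩ := huniq C' hC'
  have hij : i ≠ j := fun h => hne (by rw [hi, hj, h])
  have := Fin.val_ne_of_ne hij
  have := i.2
  have := j.2
  omega

/-- The axes turn the cycles into directed triangles and four-cycles without opposite edges, and
different cycles into different ones; so at most two have three nodes and at most one has four. Type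
A holds for all cycles or for none, and in the latter case three nodes give type B and four nodes
type C. -/
theorem type_of_neg_mem (hN : N.IsSimple) (hA : N.AssumptionA) (hf : ContDiff ℝ 1 f)
    (he : IsEquivariant Γ f) (hneg : (LinearIsometryEquiv.neg ℝ : O4) ∈ Γ) {τ : Multiset Label}
    (h : N.HasType τ) :
    τ = {A3, A3} ∨ τ = {A3, A4} ∨ τ = {A3, A3, A4} ∨ τ = {B3, B3} ∨ τ = {B3, C4} ∨
      τ = {B3, B3, C4} := by
  obtain ⟨r, R, hr, hR, hinj, hτ⟩ := exists_ne_orbit_of_hasType h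
  have hcl := fun i => (isAxial hN hA (hR i)).of_consecutive_axis_ne hf he
    (axes_ne_succ hN hA hf he hneg (hR i))
  have hsize : ∀ i, (R i).numOrbits = (R i).k + 1 := fun i =>
    Cycle.numOrbits_eq (isAxial hN hA (hR i)).distinct
  have h3 : ∀ i j l, (R i).k = 2 → (R j).k = 2 → (R l).k = 2 → i = j ∨ i = l ∨ j = l := by
    intro i j l hi hj hl
    have hop := fun i j => not_opposed hN hA hf he hneg (hR i) (hR j)
    have heq : ∀ {i j}, Covers (axes (R i)) (axes (R j)) ∧ Covers (axes (R j)) (axes (R i)) →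
        i = j := fun {i j} hc => hinj i j <| Set.Subset.antisymm
      (groupOrbit_subset_of_covers hN hA hf he hneg (hR j) (hR i) hc.2)
      (groupOrbit_subset_of_covers hN hA hf he hneg (hR i) (hR j) hc.1)
    rcases covers_of_not_opposed_of_three hi hj hl (hcl i).1 (hcl j).1 (hcl l).1 (hop i j) (hop i l)
      (hop j l) with hc | hc | hc
    exacts [Or.inl (heq hc), Or.inr (Or.inl (heq hc)), Or.inr (Or.inr (heq hc))]
  have h4 : ∀ i j, (R i).k ≠ 2 → (R j).k ≠ 2 → i = j := by
    intro i j hi hj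
    replace hi := (hcl i).2.1.resolve_left hi
    replace hj := (hcl j).2.1.resolve_left hj
    refine hinj i j (Set.Subset.antisymm ?_ ?_)
    · exact groupOrbit_subset_of_covers hN hA hf he hneg (hR j) (hR i)
        (covers_of_not_opposed hj hi (hcl j).1 (hcl i).1
          (not_opposed hN hA hf he hneg (hR j) (hR i)))
    · exact groupOrbit_subset_of_covers hN hA hf he hneg (hR i) (hR j)
        (covers_of_not_opposed hi hj (hcl i).1 (hcl j).1
          (not_opposed hN hA hf he hneg (hR i) (hR j)))
  have hmem := fun X Y hX hY => map_label_mem hr (fun i => (R i).label) (fun i => (R i).k = 2)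
    (X := X) (Y := Y) hX hY h3 h4
  rw [← hτ] at hmem
  by_cases hAll : ∀ i, (R i).IsTypeA
  · have hlab : ∀ i, (R i).label = ⟨Kind.A, (R i).k + 1, true⟩ := fun i => by
      simp only [Cycle.label, if_pos (hAll i), hsize, hneg, decide_true]
    have := hmem A3 A4 (fun i hi => by rw [hlab, hi]; rfl)
      (fun i hi => by rw [hlab, (hcl i).2.1.resolve_left hi]; rfl)
    tauto
  · push Not at hAll
    obtain ⟨i₀, hi₀⟩ := hAll
    have hnA : ∀ i, ¬ (R i).IsTypeA := fun i h =>
      hi₀ ((isTypeA_iff_of_neg_mem hN hA hf he hneg (hR i) (hR i₀)).mp h)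
    have := hmem B3 C4 (fun i hi => by
        simp only [Cycle.label, if_neg (hnA i),
          if_pos (isTypeB_of_three hN hA hf he hneg (hR i) hi (hnA i)), hsize, hi, hneg, decide_true]
        rfl)
      (fun i hi => by
        have hi' := (hcl i).2.1.resolve_left hi
        simp only [Cycle.label, if_neg (hnA i),
          if_neg (not_isTypeB_of_four hN hA hf he hneg (hR i) hi'), hsize, hi', hneg, decide_true]
        rfl)
    tauto

/-! #### Networks for groups that do not contain `-Id` -/

/-- The alternative, a cycle through different axes, would generate `-Id`. -/
theorem collinear_of_neg_notMem (hN : N.IsSimple) (hA : N.AssumptionA) (hf : ContDiff ℝ 1 f)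
    (he : IsEquivariant Γ f) (hneg : (LinearIsometryEquiv.neg ℝ : O4) ∉ Γ) {C : Cycle Γ f}
    (hC : C ∈ N.cycles) : C.k = 1 ∧ ∀ i, axis (C.node i) = axis (C.node 0) := by
  have hax := isAxial hN hA hC
  by_cases h : ∃ j, axis (C.node j) = axis (C.node (j + 1))
  · obtain ⟨j, hj⟩ := h
    have := hax.of_consecutive_axis_eq hf he hj
    exact ⟨this.1, this.2.1⟩
  · push Not at h
    exact absurd (hax.of_consecutive_axis_ne hf he h).2.2 hneg

/-- In a connected network all nodes lie on one axis. -/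
theorem axis_eq_of_neg_notMem (hN : N.IsSimple) (hA : N.AssumptionA) (hf : ContDiff ℝ 1 f)
    (he : IsEquivariant Γ f) (hneg : (LinearIsometryEquiv.neg ℝ : O4) ∉ Γ) {C C' : Cycle Γ f}
    (hC : C ∈ N.cycles) (hC' : C' ∈ N.cycles) : axis (C'.node 0) = axis (C.node 0) := by
  by_contra hne
  -- Sorting the cycles by their axis splits the network into two closed sets; connectedness makes
  -- them meet, and cycles that meet have a common node, which lies on both axes.
  let S : Set (Cycle Γ f) := {D ∈ N.cycles | axis (D.node 0) = axis (C.node 0)}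
  let T : Set (Cycle Γ f) := {D ∈ N.cycles | axis (D.node 0) ≠ axis (C.node 0)}
  have hclS : IsClosed (⋃ D ∈ S, D.carrier) :=
    (N.finite_cycles.subset fun D hD => hD.1).isClosed_biUnion fun D _ => D.isClosed_carrier
  have hclT : IsClosed (⋃ D ∈ T, D.carrier) :=
    (N.finite_cycles.subset fun D hD => hD.1).isClosed_biUnion fun D _ => D.isClosed_carrier
  obtain ⟨y, -, hyS, hyT⟩ := isPreconnected_closed_iff.mp N.connected.isPreconnected _ _ hclS hclT
    (fun y hy => by
      obtain ⟨D, hD, hyD⟩ := Set.mem_iUnion₂.mp hy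
      by_cases h : axis (D.node 0) = axis (C.node 0)
      · exact Or.inl (Set.mem_biUnion (show D ∈ S from ⟨hD, h⟩) hyD)
      · exact Or.inr (Set.mem_biUnion (show D ∈ T from ⟨hD, h⟩) hyD))
    ⟨C.node 0, Set.mem_biUnion hC (C.node_mem_carrier 0),
      Set.mem_biUnion (show C ∈ S from ⟨hC, rfl⟩) (C.node_mem_carrier 0)⟩
    ⟨C'.node 0, Set.mem_biUnion hC' (C'.node_mem_carrier 0),
      Set.mem_biUnion (show C' ∈ T from ⟨hC', hne⟩) (C'.node_mem_carrier 0)⟩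
  obtain ⟨D, hD, hyD⟩ := Set.mem_iUnion₂.mp hyS
  obtain ⟨D', hD', hyD'⟩ := Set.mem_iUnion₂.mp hyT
  obtain ⟨i, j, hij⟩ := Cycle.exists_common_node hf hyD hyD'
  have h1 := (collinear_of_neg_notMem hN hA hf he hneg hD.1).2 i
  have h2 := (collinear_of_neg_notMem hN hA hf he hneg hD'.1).2 j
  rw [hij] at h1
  exact hD'.2 (h2.symm.trans (h1.trans hD.2))

/-- All cycles have the same two nodes. -/
theorem exists_node_eq_of_neg_notMem (hN : N.IsSimple) (hA : N.AssumptionA) (hf : ContDiff ℝ 1 f)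
    (he : IsEquivariant Γ f) (hneg : (LinearIsometryEquiv.neg ℝ : O4) ∉ Γ) {C C' : Cycle Γ f}
    (hC : C ∈ N.cycles) (hC' : C' ∈ N.cycles) :
    ∃ j, C'.node j = C.node 0 ∧ C'.node (j + 1) = C.node (0 + 1) := by
  have hax := isAxial hN hA hC
  have hax' := isAxial hN hA hC'
  have hc := collinear_of_neg_notMem hN hA hf he hneg hC
  have hc' := collinear_of_neg_notMem hN hA hf he hneg hC'
  have h00 := axis_eq_of_neg_notMem hN hA hf he hneg hC hC'
  obtain ⟨c, hc0, h0⟩ := (hax.onAxis 0).exists_smul_eq (hax.simple.node_ne_zero 0) (hax'.onAxis 0)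
    (hax'.simple.node_ne_zero 0) h00.symm
  obtain ⟨-, r, hr, h1⟩ := hax.of_axis_eq (C.ne_succ 0) (hc.2 (0 + 1)).symm
  obtain ⟨-, s, hs, h2⟩ := hax'.of_axis_eq (C'.ne_succ 0) (hc'.2 (0 + 1)).symm
  have hc01 : C.node 0 = r⁻¹ • C.node (0 + 1) := by
    rw [h1, smul_smul, inv_mul_cancel₀ hr.ne, one_smul]
  -- The two nodes of each cycle occupy the two half-axes; the sign of `c` decides whether the
  -- numbering of `C'` has to be shifted by one.
  rcases lt_or_gt_of_ne hc0 with hneg' | hpos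
  · refine ⟨0 + 1, ?_, ?_⟩
    · refine node_eq_of_pos_smul hN hC hC' (mul_pos_of_neg_of_neg hs hneg') ?_
      rw [h2, h0, smul_smul]
    · rw [fin_add_one_add_one hc'.1]
      refine node_eq_of_pos_smul hN hC hC' (mul_pos_of_neg_of_neg hneg' (inv_lt_zero.mpr hr)) ?_
      rw [h0, hc01, smul_smul]
  · refine ⟨0, node_eq_of_pos_smul hN hC hC' hpos h0, ?_⟩
    refine node_eq_of_pos_smul hN hC hC' (c := s * (c * r⁻¹)) ?_ ?_
    · exact mul_pos_of_neg_of_neg hs (mul_neg_of_pos_of_neg hpos (inv_lt_zero.mpr hr))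
    · rw [h2, h0, hc01, smul_smul, smul_smul, mul_assoc]

/-- All cycles have the same two nodes. A fixed plane through `C.node 0` is spanned by `b 0` and one
of three frame vectors, and a cycle is determined up to symmetry by its outgoing plane `p` and its
incoming plane `q`. The isotropy of the common node decides between types A and B for all cycles at
once. -/
theorem type_of_neg_notMem (hN : N.IsSimple) (hA : N.AssumptionA) (hf : ContDiff ℝ 1 f)
    (he : IsEquivariant Γ f) (hneg : (LinearIsometryEquiv.neg ℝ : O4) ∉ Γ) {τ : Multiset Label}
    (h : N.HasType τ) : τ = {A2, A2} ∨ τ = {B2, B2} := by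
  obtain ⟨r, R, hr, hR, hinj, hτ⟩ := exists_ne_orbit_of_hasType h
  let C := R ⟨0, by omega⟩
  have hC : C ∈ N.cycles := hR _
  have hs := hN.simple_cycles C hC
  have hk : ∀ i, (R i).k = 1 := fun i => (collinear_of_neg_notMem hN hA hf he hneg (hR i)).1
  choose j hj hj' using fun i => exists_node_eq_of_neg_notMem hN hA hf he hneg hC (hR i)
  -- Index `0 - 1` is the connection that ends at `C.node 0`.
  obtain ⟨b, hb⟩ := C.exists_isFrame hs hf he (0 - 1)
  rw [sub_add_cancel] at hb
  have hout : ∀ i, C.node 0 ∈ (R i).P (j i) := fun i => hj i ▸ (R i).node_mem_P (j i)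
  have hin : ∀ i, C.node 0 ∈ (R i).P (j i + 1) := fun i => by
    have := (R i).node_succ_mem_P (j i + 1)
    rwa [fin_add_one_add_one (hk i), hj i] at this
  choose p hp using fun i => hb.exists_eq_span ((R i).isotropy_Sig (j i)).le (hout i)
    (hs.node_ne_zero 0) ((hN.simple_cycles _ (hR i)).finrank_P (j i))
  choose q hq using fun i => hb.exists_eq_span ((R i).isotropy_Sig (j i + 1)).le (hin i)
    (hs.node_ne_zero 0) ((hN.simple_cycles _ (hR i)).finrank_P (j i + 1))
  have hsub : ∀ i l, p i = p l → q i = q l →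
      groupOrbit Γ (R l).carrier ⊆ groupOrbit Γ (R i).carrier := by
    intro i l hpl hql
    refine Cycle.groupOrbit_carrier_subset (hN.simple_cycles _ (hR i)) hf he fun m => ?_
    rcases fin_eq_or_eq_succ (hk l) m (j l) with rfl | rfl
    · refine ⟨j i, 1, Γ.one_mem, (hj i).trans (hj l).symm, fun y hy => ?_⟩
      change y ∈ fixedSpace _
      rw [hp i, hpl, ← hp l]
      exact hy
    · refine ⟨j i + 1, 1, Γ.one_mem, (hj' i).trans (hj' l).symm, fun y hy => ?_⟩
      change y ∈ fixedSpace _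
      rw [hq i, hql, ← hq l]
      exact hy
  -- A plane in which the common node is a saddle for one cycle cannot be a sink plane for any
  -- cycle, so the values of `p` and `q` are disjoint.
  have hr2 : r ≤ 2 := by
    refine card_le_two_of_disjoint p q (fun i l hpl hql => hinj i l (Set.Subset.antisymm
      (hsub l i hpl.symm hql.symm) (hsub i l hpl hql))) fun i l hpq => ?_
    have h1 := (R i).saddle (j i)
    have h2 := (R l).sink (j l + 1)
    rw [fin_add_one_add_one (hk l), hj l, hq l, ← hpq, ← hp i, ← hj i] at h2
    exact h2.not_isSaddleIn h1
  obtain rfl : r = 2 := le_antisymm hr2 hr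
  have hsize : ∀ i, (R i).numOrbits = 2 := fun i => by
    rw [Cycle.numOrbits_eq (isAxial hN hA (hR i)).distinct, hk i]
  have hA' : ∀ i, (R i).IsTypeA ↔ ¬ HasOddIsotropy Γ (C.node 0) := fun i => by
    rw [(R i).isTypeA_iff (hN.simple_cycles _ (hR i)) hf he (j i), hj i]
  have hpair : ∀ X, (∀ i, (R i).label = X) → τ = {X, X} := fun X hX => by
    rw [hτ]
    simp only [hX]
    rfl
  by_cases hodd : HasOddIsotropy Γ (C.node 0)
  · right
    refine hpair B2 fun i => ?_
    have hnA : ¬ (R i).IsTypeA := fun h => (hA' i).mp h hodd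
    have hB : (R i).IsTypeB := by
      refine (R i).isTypeB_of_odd (i := j i + 1) (hN.simple_cycles _ (hR i)) hf he ?_ fun m => ?_
      · rw [fin_add_one_add_one (hk i), hj i]; exact hodd
      · rcases fin_eq_or_eq_succ (hk i) m (j i + 1) with rfl | rfl
        · exact le_sup_left
        · exact le_sup_right
    simp only [Cycle.label, if_neg hnA, if_pos hB, hsize, hneg, decide_false]
    rfl
  · left
    refine hpair A2 fun i => ?_
    simp only [Cycle.label, if_pos ((hA' i).mpr hodd), hsize, hneg, decide_false]
    rfl

end Network

/-- The possible types of simple networks that satisfy Assumption A. -/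
theorem Supports.type_mem {n : WithTop ℕ∞} (hn : 1 ≤ n) {Γ : Subgroup O4} {f : E4 → E4}
    {τ : Multiset Label} (h : Supports n Γ f τ) :
    τ ∈ ({{A2, A2}, {A3, A3}, {A3, A4}, {A3, A3, A4}, {B2, B2}, {B3, B3}, {B3, C4},
      {B3, B3, C4}} : Set (Multiset Label)) := by
  obtain ⟨-, hf, he, N, hN, hA, hτ⟩ := h
  replace hf := hf.of_le hn
  simp only [Set.mem_insert_iff, Set.mem_singleton_iff]
  by_cases hneg : (LinearIsometryEquiv.neg ℝ : O4) ∈ Γ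
  · have := Network.type_of_neg_mem hN hA hf he hneg hτ
    tauto
  · have := Network.type_of_neg_notMem hN hA hf he hneg hτ
    tauto

end HetNet

namespace HetNet
open scoped InnerProductSpace

/-! ### Groups of sign changes -/

/-- The group of all sign changes of coordinates. -/
def signGroup : Subgroup O4 where
  carrier := {γ | ∃ s : Fin 4 → ℝ, (∀ i, s i = 1 ∨ s i = -1) ∧ ∀ x i, γ x i = s i * x i}
  mul_mem' := by
    rintro γ δ ⟨s, hs, hγ⟩ ⟨t, ht, hδ⟩
    refine ⟨fun i => s i * t i, fun i => ?_, fun x i => ?_⟩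
    · rcases hs i with h | h <;> rcases ht i with h' | h' <;> simp [h, h']
    · rw [mul_apply', hγ, hδ, mul_assoc]
  one_mem' := ⟨fun _ => 1, fun _ => Or.inl rfl, fun x i => (one_mul _).symm⟩
  inv_mem' := by
    rintro γ ⟨s, hs, hγ⟩
    refine ⟨s, hs, fun x i => ?_⟩
    have h1 : γ (γ⁻¹ x) i = x i := by rw [show γ (γ⁻¹ x) = x from γ.apply_symm_apply x]
    have h2 : s i * s i = 1 := by rcases hs i with h | h <;> simp [h]
    rw [← h1, hγ, ← mul_assoc, h2, one_mul]

theorem mem_signGroup {γ : O4} : γ ∈ signGroup ↔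
    ∃ s : Fin 4 → ℝ, (∀ i, s i = 1 ∨ s i = -1) ∧ ∀ x i, γ x i = s i * x i := Iff.rfl

theorem signGroup_apply_e {γ : O4} {s : Fin 4 → ℝ} (h : ∀ x i, γ x i = s i * x i) (i : Fin 4) :
    γ (e i) = s i • e i := by
  ext j
  rw [h]
  by_cases hj : j = i
  · subst hj; simp
  · simp [hj]

theorem finite_signGroup : Finite signGroup := by
  let S : Set (Fin 4 → ℝ) := {s | ∀ i, s i ∈ ({1, -1} : Set ℝ)}
  have hS : S.Finite := Set.Finite.pi' fun _ => Set.toFinite _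
  have := hS.to_subtype
  choose s hs h using fun γ : signGroup => mem_signGroup.mp γ.2
  refine Finite.of_injective (β := S) (fun γ => ⟨s γ, hs γ⟩) fun γ δ hγδ => ?_
  have hst : s γ = s δ := congrArg Subtype.val hγδ
  refine Subtype.ext (isometry_ext fun i => ?_)
  rw [signGroup_apply_e (h γ), signGroup_apply_e (h δ), hst]

theorem finite_of_le_signGroup {Γ : Subgroup O4} (h : Γ ≤ signGroup) : Finite Γ := by
  have := finite_signGroup
  exact Finite.of_injective _ (Subgroup.inclusion_injective h)

/-- The rotations. -/
def rotationGroup : Subgroup O4 where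
  carrier := {γ | LinearMap.det (γ.toLinearEquiv : E4 →ₗ[ℝ] E4) = 1}
  mul_mem' := by
    intro γ δ hγ hδ
    change LinearMap.det ((γ.toLinearEquiv : E4 →ₗ[ℝ] E4) ∘ₗ (δ.toLinearEquiv : E4 →ₗ[ℝ] E4)) = 1
    rw [LinearMap.det_comp, show LinearMap.det (γ.toLinearEquiv : E4 →ₗ[ℝ] E4) = 1 from hγ,
      show LinearMap.det (δ.toLinearEquiv : E4 →ₗ[ℝ] E4) = 1 from hδ, one_mul]
  one_mem' := LinearMap.det_id
  inv_mem' := by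
    intro γ hγ
    have h1 : ((γ⁻¹).toLinearEquiv : E4 →ₗ[ℝ] E4) ∘ₗ (γ.toLinearEquiv : E4 →ₗ[ℝ] E4) =
        LinearMap.id := by
      ext1 x
      exact γ.symm_apply_apply x
    have h2 := congrArg LinearMap.det h1
    rw [LinearMap.det_comp, show LinearMap.det (γ.toLinearEquiv : E4 →ₗ[ℝ] E4) = 1 from hγ, mul_one,
      LinearMap.det_id] at h2
    exact h2

theorem not_hasOddIsotropy {Γ : Subgroup O4} (h : Γ ≤ rotationGroup) (x : E4) :
    ¬ HasOddIsotropy Γ x := by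
  rintro ⟨γ, hγ, hdet⟩
  have : LinearMap.det (γ.toLinearEquiv : E4 →ₗ[ℝ] E4) = 1 := h hγ.1
  rw [hdet] at this
  norm_num at this

theorem det_of_signs {γ : O4} {s : Fin 4 → ℝ} (h : ∀ x i, γ x i = s i * x i) :
    LinearMap.det (γ.toLinearEquiv : E4 →ₗ[ℝ] E4) = s 0 * s 1 * s 2 * s 3 :=
  det_of_basis (EuclideanSpace.basisFun (Fin 4) ℝ) γ s fun i => by
    simpa using signGroup_apply_e h i

theorem kappa_apply (i j : Fin 4) (x : E4) (k : Fin 4) :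
    kappa i j x k = (if k = i ∨ k = j then 1 else -1) * x k := by
  by_cases h : k = i ∨ k = j
  · simp [kappa, LinearIsometryEquiv.piLpCongrRight_apply, h]
  · simp [kappa, LinearIsometryEquiv.piLpCongrRight_apply, h]

theorem kappa_mem_signGroup (i j : Fin 4) : kappa i j ∈ signGroup :=
  ⟨fun k => if k = i ∨ k = j then 1 else -1, fun k => by
    by_cases h : k = i ∨ k = j <;> simp [h], kappa_apply i j⟩

theorem kappa_mem_rotationGroup {i j : Fin 4} (h : i ≠ j) : kappa i j ∈ rotationGroup := by
  change LinearMap.det _ = 1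
  rw [det_of_signs (kappa_apply i j)]
  fin_cases i <;> fin_cases j <;> simp at h ⊢

/-- The reflection in the last coordinate. -/
noncomputable def reflectLast : O4 :=
  LinearIsometryEquiv.piLpCongrRight 2 fun k =>
    if k = 3 then LinearIsometryEquiv.neg ℝ else LinearIsometryEquiv.refl ℝ ℝ

theorem reflectLast_apply (x : E4) (k : Fin 4) :
    reflectLast x k = (if k = 3 then -1 else 1) * x k := by
  by_cases h : k = 3
  · simp [reflectLast, LinearIsometryEquiv.piLpCongrRight_apply, h]
  · simp [reflectLast, LinearIsometryEquiv.piLpCongrRight_apply, h]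

theorem reflectLast_mem_signGroup : reflectLast ∈ signGroup :=
  ⟨fun k => if k = 3 then -1 else 1, fun k => by by_cases h : k = 3 <;> simp [h], reflectLast_apply⟩

theorem hasOddIsotropy_of_reflectLast_mem {Γ : Subgroup O4} (h : reflectLast ∈ Γ) :
    HasOddIsotropy Γ (e 0) := by
  refine ⟨reflectLast, ⟨h, ?_⟩, ?_⟩
  · rw [signGroup_apply_e reflectLast_apply]
    simp
  · rw [det_of_signs reflectLast_apply]
    simp

theorem neg_eq_kappa_mul : (LinearIsometryEquiv.neg ℝ : O4) = kappa 0 1 * kappa 2 3 := by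
  ext x k
  rw [mul_apply', kappa_apply, kappa_apply, neg_apply]
  fin_cases k <;> simp

/-- A sign change is determined by its values at the unit vectors. -/
theorem kappa_eq_mul {a b i j k l : Fin 4}
    (h : ∀ m : Fin 4, (m = a ∨ m = b) ↔ ((m = i ∨ m = j) ↔ (m = k ∨ m = l))) :
    kappa a b = kappa i j * kappa k l := by
  ext x m
  rw [mul_apply', kappa_apply, kappa_apply, kappa_apply]
  have := h m
  by_cases h1 : m = i ∨ m = j <;> by_cases h2 : m = k ∨ m = l <;> simp_all

theorem kappa_mem_GammaThree {a b : Fin 4} (h : a ≠ b) : kappa a b ∈ GammaThree := by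
  have h01 : kappa 0 1 ∈ GammaThree := Subgroup.subset_closure (by simp)
  have h02 : kappa 0 2 ∈ GammaThree := Subgroup.subset_closure (by simp)
  have h23 : kappa 2 3 ∈ GammaThree := Subgroup.subset_closure (by simp)
  have h03 : kappa 0 3 ∈ GammaThree := by
    rw [kappa_eq_mul (i := 0) (j := 1) (k := 0) (l := 2) (by decide)]
    exact GammaThree.mul_mem h01 h02
  have h12 : kappa 1 2 ∈ GammaThree := by
    rw [show kappa 1 2 = kappa 0 1 * kappa 2 3 * kappa 0 3 by
      rw [← neg_eq_kappa_mul]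
      ext x m
      rw [mul_apply', kappa_apply, neg_apply, PiLp.neg_apply, kappa_apply]
      fin_cases m <;> simp]
    exact GammaThree.mul_mem (GammaThree.mul_mem h01 h23) h03
  have h13 : kappa 1 3 ∈ GammaThree := by
    rw [kappa_eq_mul (i := 0) (j := 1) (k := 1) (l := 2) (by decide)]
    exact GammaThree.mul_mem h01 h12
  have hsymm : ∀ i j, kappa i j = kappa j i := fun i j => by
    ext x m
    rw [kappa_apply, kappa_apply]
    simp only [or_comm]
  fin_cases a <;> fin_cases b <;> first | exact absurd rfl h | assumption | (rw [hsymm]; assumption)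

theorem GammaThree_le_signGroup : GammaThree ≤ signGroup := by
  rw [GammaThree, Subgroup.closure_le]
  rintro _ (rfl | rfl | rfl) <;> exact kappa_mem_signGroup _ _

theorem GammaThree_le_rotationGroup : GammaThree ≤ rotationGroup := by
  rw [GammaThree, Subgroup.closure_le]
  rintro _ (rfl | rfl | rfl) <;> exact kappa_mem_rotationGroup (by decide)

theorem kappa_mem_GammaTwo {j : Fin 4} (h : j ≠ 0) : kappa 0 j ∈ GammaTwo := by
  have h01 : kappa 0 1 ∈ GammaTwo := Subgroup.subset_closure (by simp)
  have h02 : kappa 0 2 ∈ GammaTwo := Subgroup.subset_closure (by simp)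
  have h03 : kappa 0 3 ∈ GammaTwo := by
    rw [kappa_eq_mul (i := 0) (j := 1) (k := 0) (l := 2) (by decide)]
    exact GammaTwo.mul_mem h01 h02
  fin_cases j <;> first | exact absurd rfl h | assumption

theorem GammaTwo_le_rotationGroup : GammaTwo ≤ rotationGroup := by
  rw [GammaTwo, Subgroup.closure_le]
  rintro _ (rfl | rfl) <;> exact kappa_mem_rotationGroup (by decide)

theorem GammaTwo_le_isotropy : GammaTwo ≤ isotropy signGroup (e 0) := by
  rw [GammaTwo, Subgroup.closure_le]
  rintro _ (rfl | rfl) <;>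
  · refine ⟨kappa_mem_signGroup _ _, ?_⟩
    rw [signGroup_apply_e (kappa_apply _ _)]
    simp

theorem mem_span_e_e {a b : Fin 4} {y : E4} :
    y ∈ Submodule.span ℝ {e a, e b} ↔ ∀ i, i ≠ a → i ≠ b → y i = 0 := by
  constructor
  · intro hy i ha hb
    obtain ⟨c, d, rfl⟩ := Submodule.mem_span_pair.mp hy
    simp [ha, hb]
  · intro h
    rw [Submodule.mem_span_pair]
    by_cases hab : a = b
    · subst hab
      refine ⟨y a, 0, ?_⟩
      ext i
      by_cases hi : i = a
      · subst hi; simp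
      · simp [hi, h i hi hi]
    · refine ⟨y a, y b, ?_⟩
      ext i
      by_cases ha : i = a
      · subst ha; simp [hab]
      · by_cases hb : i = b
        · subst hb; simp [ha]
        · simp [ha, hb, h i ha hb]

/-- The coordinate planes are the fixed-point spaces of the half turns. -/
theorem fixedSpace_isotropy {Γ : Subgroup O4} (hΓ : Γ ≤ signGroup) {a b : Fin 4} (hab : a ≠ b)
    (hκ : kappa a b ∈ Γ) :
    fixedSpace (isotropy Γ (e a + e b)) = Submodule.span ℝ {e a, e b} := by
  ext y
  rw [mem_span_e_e]
  constructor
  · intro hy i hia hib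
    have hmem : kappa a b ∈ isotropy Γ (e a + e b) := by
      refine ⟨hκ, ?_⟩
      rw [map_add, signGroup_apply_e (kappa_apply a b), signGroup_apply_e (kappa_apply a b)]
      simp
    have h1 := congrArg (fun z : E4 => z i) (hy _ hmem)
    simp only [kappa_apply, hia, hib, or_self, if_false] at h1
    linarith
  · intro hy γ hγ
    obtain ⟨s, hs, h⟩ := hΓ hγ.1
    have hγe := hγ.2
    have ha : s a = 1 := by
      have h1 := congrArg (fun z : E4 => z a) hγe
      simp only [h] at h1
      simpa [hab] using h1
    have hb : s b = 1 := by
      have h1 := congrArg (fun z : E4 => z b) hγe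
      simp only [h] at h1
      simpa [hab.symm] using h1
    ext i
    rw [h]
    by_cases hia : i = a
    · rw [hia, ha, one_mul]
    by_cases hib : i = b
    · rw [hib, hb, one_mul]
    rw [hy i hia hib, mul_zero]

end HetNet

namespace HetNet
open scoped InnerProductSpace

/-! ### Construction of networks in the coordinate planes -/

/-- On a coordinate axis, points of one component of the punctured line have coordinates of the
same sign. -/
theorem meetsAxesOnce_of_axis {Γ : Subgroup O4} {f : E4 → E4} {C : Cycle Γ f} {X S : Set E4}
    (hX : X ⊆ S) (hS : ∀ γ ∈ Γ, ∀ x ∈ S, γ x ∈ S)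
    (hL : ∀ j, ∃ i, ∀ y ∈ C.L j, ∀ i', i' ≠ i → y i' = 0)
    (hax : ∀ x ∈ S, ∀ y ∈ S, ∀ i, (∀ i', i' ≠ i → x i' = 0) → (∀ i', i' ≠ i → y i' = 0) →
      0 < x i * y i → x i = y i) : C.MeetsAxesOnce X := by
  have hGX : groupOrbit Γ X ⊆ S := by
    rintro _ ⟨γ, hγ, x, hx, rfl⟩
    exact hS γ hγ x (hX hx)
  rintro j x hx p ⟨hpX, hp⟩ q ⟨hqX, hq⟩
  obtain ⟨i, hi⟩ := hL j
  have hsub := connectedComponentIn_subset ((C.L j : Set E4) \ {0}) x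
  have hne : ∀ y ∈ connectedComponentIn ((C.L j : Set E4) \ {0}) x, y i ≠ 0 := by
    intro y hy h0
    refine (hsub hy).2 (?_ : y = 0)
    ext i'
    by_cases h : i' = i
    · rw [h, h0]; rfl
    · exact hi y (hsub hy).1 i' h
  have hcont : ContinuousOn (fun y : E4 => y i) (connectedComponentIn ((C.L j : Set E4) \ {0}) x) :=
    Continuous.continuousOn (by fun_prop)
  have hpos : 0 < p i * q i := by
    by_contra hcon
    rcases lt_or_gt_of_ne (hne p hp) with h1 | h1 <;> rcases lt_or_gt_of_ne (hne q hq) with h2 | h2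
    · exact hcon (mul_pos_of_neg_of_neg h1 h2)
    · obtain ⟨y, hy, hy0⟩ := isPreconnected_connectedComponentIn.intermediate_value hp hq hcont
        (show (0 : ℝ) ∈ Set.Icc _ _ from ⟨h1.le, h2.le⟩)
      exact hne y hy hy0
    · obtain ⟨y, hy, hy0⟩ := isPreconnected_connectedComponentIn.intermediate_value hq hp hcont
        (show (0 : ℝ) ∈ Set.Icc _ _ from ⟨h2.le, h1.le⟩)
      exact hne y hy hy0
    · exact hcon (mul_pos h1 h2)
  have hp0 := hi p (hsub hp).1
  have hq0 := hi q (hsub hq).1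
  have := hax p (hGX hpX) q (hGX hqX) i hp0 hq0 hpos
  ext i'
  by_cases h : i' = i
  · rw [h, this]
  · rw [hp0 i' h, hq0 i' h]

/-- A connection with its two limit nodes lies between a connected set and its closure, and
successive pieces share a node. -/
theorem Cycle.isConnected_carrier {Γ : Subgroup O4} {f : E4 → E4} (C : Cycle Γ f) :
    IsConnected C.carrier := by
  rw [Cycle.carrier_eq_iUnion]
  refine IsConnected.iUnion_of_reflTransGen (fun j => ⟨⟨_, Set.mem_insert _ _⟩, ?_⟩) fun i j => ?_
  · have hr : IsPreconnected (Set.range (C.traj j)) := isPreconnected_range (C.continuous_traj j)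
    refine hr.subset_closure (fun y hy => Or.inr (Or.inr hy)) ?_
    rintro y (rfl | rfl | hy)
    · exact mem_closure_of_tendsto (C.tendsto_source j) (Eventually.of_forall fun t => ⟨t, rfl⟩)
    · exact mem_closure_of_tendsto (C.tendsto_target j) (Eventually.of_forall fun t => ⟨t, rfl⟩)
    · exact subset_closure hy
  · refine Cycle.fin_cyclic_induction (p := fun j => Relation.ReflTransGen _ i j) (j := i)
      Relation.ReflTransGen.refl (fun l hl => hl.tail ?_) j
    exact ⟨C.node (l + 1), Or.inr (Or.inl rfl), Or.inl rfl⟩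

/-- Data for a heteroclinic cycle whose connections lie in coordinate planes and which is contained
in the set `S`. The `j`-th connection lies in the plane of the coordinates `a j` and `b j`, and
`lam j` are the eigenvalues of the linearization at the `j`-th node. -/
structure CoordCycle (Γ : Subgroup O4) (f : E4 → E4) (S : Set E4) where
  k : ℕ
  k_pos : 0 < k
  node : Fin (k + 1) → E4
  traj : Fin (k + 1) → ℝ → E4
  a : Fin (k + 1) → Fin 4
  b : Fin (k + 1) → Fin 4
  c : Fin (k + 1) → Fin 4
  lam : Fin (k + 1) → Fin 4 → ℝ
  ne : ∀ j, a j ≠ b j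
  kappa_mem : ∀ j, kappa (a j) (b j) ∈ Γ
  -- Consecutive planes have only the axis `c (j + 1)` in common, so the lines `L` of the cycle are
  -- contained in coordinate axes.
  inter : ∀ j i, (i = a j ∨ i = b j) → (i = a (j + 1) ∨ i = b (j + 1)) → i = c (j + 1)
  onAxis : ∀ j, OnAxis (node j)
  distinct : ∀ i j, i ≠ j → ¬ SameOrbit Γ (node i) (node j)
  equilibrium : ∀ j, f (node j) = 0
  node_mem : ∀ j, node j ∈ Submodule.span ℝ {e (a j), e (b j)}
  node_succ_mem : ∀ j, node (j + 1) ∈ Submodule.span ℝ {e (a j), e (b j)}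
  fderiv_node : ∀ j i, fderiv ℝ f (node j) (e i) = lam j i • e i
  lam_injective : ∀ j, Function.Injective (lam j)
  saddle_neg : ∀ j, lam j (a j) < 0
  saddle_pos : ∀ j, 0 < lam j (b j)
  sink_left : ∀ j, lam (j + 1) (a j) < 0
  sink_right : ∀ j, lam (j + 1) (b j) < 0
  solution : ∀ j t, HasDerivAt (traj j) (f (traj j t)) t
  traj_mem : ∀ j t, traj j t ∈ Submodule.span ℝ {e (a j), e (b j)}
  tendsto_source : ∀ j, Tendsto (traj j) atBot (𝓝 (node j))
  tendsto_target : ∀ j, Tendsto (traj j) atTop (𝓝 (node (j + 1)))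
  node_mem_set : ∀ j, node j ∈ S
  traj_mem_set : ∀ j t, traj j t ∈ S

namespace CoordCycle

variable {Γ : Subgroup O4} {f : E4 → E4} {S : Set E4}

/-- The heteroclinic cycle given by the data. -/
noncomputable def toCycle (D : CoordCycle Γ f S) (hΓ : Γ ≤ signGroup) : Cycle Γ f where
  k := D.k
  node := D.node
  node_injective := fun i j hij => by
    by_contra h
    exact D.distinct i j h (hij ▸ SameOrbit.refl Γ _)
  traj := D.traj
  -- The point `e (a j) + e (b j)` lies off both axes of the plane, so a sign change that fixes it
  -- fixes the whole plane.
  Sig := fun j => isotropy Γ (e (D.a j) + e (D.b j))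
  isotropy_Sig := fun j => ⟨_, rfl⟩
  solution := D.solution
  traj_mem := fun j t => by
    rw [fixedSpace_isotropy hΓ (D.ne j) (D.kappa_mem j)]
    exact D.traj_mem j t
  tendsto_source := D.tendsto_source
  tendsto_target := D.tendsto_target
  saddle := fun j => by
    rw [fixedSpace_isotropy hΓ (D.ne j) (D.kappa_mem j)]
    have h := complexEigenvalues_linearizationOn rfl (linearIndependent_e_e (D.ne j))
      (D.fderiv_node j (D.a j)) (D.fderiv_node j (D.b j))
    have h1 := D.saddle_neg j
    have h2 := D.saddle_pos j
    refine ⟨D.node_mem j, D.equilibrium j, ?_, ?_, ?_⟩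
    · rw [h]
      intro μ hμ
      rcases Multiset.mem_cons.mp hμ with rfl | hμ
      · rw [Complex.ofReal_re]; exact h1.ne
      · rw [Multiset.mem_singleton.mp hμ, Complex.ofReal_re]; exact h2.ne'
    · rw [h]
      exact ⟨_, Multiset.mem_cons_self _ _, by rwa [Complex.ofReal_re]⟩
    · rw [h]
      exact ⟨_, Multiset.mem_cons_of_mem (Multiset.mem_singleton_self _), by rwa [Complex.ofReal_re]⟩
  sink := fun j => by
    rw [fixedSpace_isotropy hΓ (D.ne j) (D.kappa_mem j)]
    have h := complexEigenvalues_linearizationOn rfl (linearIndependent_e_e (D.ne j))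
      (D.fderiv_node (j + 1) (D.a j)) (D.fderiv_node (j + 1) (D.b j))
    refine ⟨D.node_succ_mem j, D.equilibrium (j + 1), ?_⟩
    rw [h]
    intro μ hμ
    rcases Multiset.mem_cons.mp hμ with rfl | hμ
    · rw [Complex.ofReal_re]; exact D.sink_left j
    · rw [Multiset.mem_singleton.mp hμ, Complex.ofReal_re]; exact D.sink_right j
  not_homoclinic := by
    have := D.k_pos
    refine ⟨⟨1, by omega⟩, D.distinct _ _ fun h => ?_⟩
    have := congrArg Fin.val h
    simp at this

theorem toCycle_P (D : CoordCycle Γ f S) (hΓ : Γ ≤ signGroup)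
    (j : Fin ((D.toCycle hΓ).k + 1)) :
    (D.toCycle hΓ).P j = Submodule.span ℝ {e (D.a j), e (D.b j)} :=
  fixedSpace_isotropy hΓ (D.ne j) (D.kappa_mem j)

theorem carrier_subset (D : CoordCycle Γ f S) (hΓ : Γ ≤ signGroup) :
    (D.toCycle hΓ).carrier ⊆ S := by
  rintro y (⟨j, rfl⟩ | hy)
  · exact D.node_mem_set j
  · obtain ⟨j, t, rfl⟩ := Set.mem_iUnion.mp hy
    exact D.traj_mem_set j t

theorem meetsAxesOnce (D : CoordCycle Γ f S) (hΓ : Γ ≤ signGroup) {X : Set E4} (hX : X ⊆ S)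
    (hS : ∀ γ ∈ Γ, ∀ x ∈ S, γ x ∈ S)
    (hax : ∀ x ∈ S, ∀ y ∈ S, ∀ i, (∀ i', i' ≠ i → x i' = 0) → (∀ i', i' ≠ i → y i' = 0) →
      0 < x i * y i → x i = y i) : (D.toCycle hΓ).MeetsAxesOnce X := by
  refine meetsAxesOnce_of_axis hX hS (fun j => ⟨D.c j, fun y hy i hi => ?_⟩) hax
  obtain ⟨l, rfl⟩ : ∃ l, j = l + 1 := ⟨j - 1, (sub_add_cancel j 1).symm⟩
  have h1 : y ∈ (D.toCycle hΓ).P (l + 1 - 1) := hy.1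
  have h2 : y ∈ (D.toCycle hΓ).P (l + 1) := hy.2
  rw [add_sub_cancel_right, toCycle_P, mem_span_e_e] at h1
  rw [toCycle_P, mem_span_e_e] at h2
  by_contra h0
  have h3 : i = D.a l ∨ i = D.b l := by
    by_contra hcon
    rw [not_or] at hcon
    exact h0 (h1 i hcon.1 hcon.2)
  refine hi (D.inter l i h3 ?_)
  by_contra hcon
  rw [not_or] at hcon
  exact h0 (h2 i hcon.1 hcon.2)

theorem isSimple (D : CoordCycle Γ f S) (hΓ : Γ ≤ signGroup)
    (hS : ∀ γ ∈ Γ, ∀ x ∈ S, γ x ∈ S) (h0 : (0 : E4) ∉ S)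
    (hax : ∀ x ∈ S, ∀ y ∈ S, ∀ i, (∀ i', i' ≠ i → x i' = 0) → (∀ i', i' ≠ i → y i' = 0) →
      0 < x i * y i → x i = y i) : (D.toCycle hΓ).IsSimple where
  zero_notMem := fun h => h0 (D.carrier_subset hΓ h)
  finrank_P := fun j => by rw [toCycle_P]; exact finrank_span_e_e (D.ne j)
  meetsAxesOnce := D.meetsAxesOnce hΓ (D.carrier_subset hΓ) hS hax
  no_double_eigenvalue := fun j => by
    rw [complexEigenvalues_of_basis (EuclideanSpace.basisFun (Fin 4) ℝ).toBasis _ (D.lam j)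
      fun i => by
        have := D.fderiv_node j i
        simpa [toCycle] using this]
    exact Finset.univ.nodup.map fun i l hil => D.lam_injective j (Complex.ofReal_injective hil)

theorem exists_isElementaryBlock (D : CoordCycle Γ f S) (hΓ : Γ ≤ signGroup) :
    ∃ j l, (D.toCycle hΓ).IsElementaryBlock j l := by
  have hval : ∀ a < D.k + 1, (0 + Fin.ofNat (D.k + 1) a : Fin (D.k + 1)).val = a := by
    intro a ha
    simp [Fin.ofNat, Nat.mod_eq_of_lt ha]
  have hlast : (0 + Fin.ofNat (D.k + 1) (D.k + 1) : Fin (D.k + 1)) = 0 := by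
    apply Fin.ext
    simp [Fin.ofNat]
  have hne : ∀ a b, a < b → b < D.k + 1 →
      ¬ SameOrbit Γ (D.node (0 + Fin.ofNat (D.k + 1) a)) (D.node (0 + Fin.ofNat (D.k + 1) b)) := by
    intro a b hab hb
    refine D.distinct _ _ fun h => ?_
    have := congrArg Fin.val h
    rw [hval a (hab.trans hb), hval b hb] at this
    omega
  refine ⟨(0 : Fin (D.k + 1)), D.k + 1, ⟨Nat.succ_pos _, ?_, fun a ha ha' => ?_⟩, hne, ?_⟩
  · change SameOrbit Γ (D.node 0) (D.node (0 + Fin.ofNat (D.k + 1) (D.k + 1)))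
    rw [hlast]
    exact SameOrbit.refl Γ _
  · have := hne 0 a ha ha'
    rwa [show (0 + Fin.ofNat (D.k + 1) 0 : Fin (D.k + 1)) = 0 from by
      apply Fin.ext; simp [Fin.ofNat]] at this
  · change D.node (0 + Fin.ofNat (D.k + 1) (D.k + 1)) = D.node 0
    rw [hlast]

/-- Finitely many cycles through a common point form a simple network that satisfies
Assumption A. -/
theorem exists_network (hΓ : Γ ≤ signGroup) (hS : ∀ γ ∈ Γ, ∀ x ∈ S, γ x ∈ S) (h0 : (0 : E4) ∉ S)
    (hax : ∀ x ∈ S, ∀ y ∈ S, ∀ i, (∀ i', i' ≠ i → x i' = 0) → (∀ i', i' ≠ i → y i' = 0) →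
      0 < x i * y i → x i = y i)
    {r : ℕ} (hr : 2 ≤ r) (R : Fin r → CoordCycle Γ f S)
    (hne : ∀ i j, groupOrbit Γ ((R i).toCycle hΓ).carrier = groupOrbit Γ ((R j).toCycle hΓ).carrier →
      i = j) {x : E4} (hx : ∀ i, x ∈ ((R i).toCycle hΓ).carrier) :
    ∃ N : Network Γ f, N.IsSimple ∧ N.AssumptionA ∧ (∀ i, (R i).toCycle hΓ ∈ N.cycles) ∧
      N.HasType (Finset.univ.val.map fun i => ((R i).toCycle hΓ).label) := by
  have hconn : IsConnected (⋃ C ∈ Set.range fun i => (R i).toCycle hΓ, C.carrier) := by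
    rw [Set.biUnion_range]
    refine ⟨⟨x, Set.mem_iUnion.mpr ⟨⟨0, by omega⟩, hx _⟩⟩, ?_⟩
    exact isPreconnected_iUnion ⟨x, Set.mem_iInter.mpr hx⟩ fun i =>
      ((R i).toCycle hΓ).isConnected_carrier.isPreconnected
  let N : Network Γ f :=
    { cycles := Set.range fun i => (R i).toCycle hΓ
      finite_cycles := Set.finite_range _
      connected := hconn
      two_cycles := ⟨_, ⟨⟨0, by omega⟩, rfl⟩, _, ⟨⟨1, by omega⟩, rfl⟩, fun h => by
        have := congrArg Fin.val (hne _ _ h)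
        simp at this⟩ }
  have hsub : N.carrier ⊆ S := by
    rintro y hy
    obtain ⟨_, ⟨i, rfl⟩, hy⟩ := Set.mem_iUnion₂.mp hy
    exact (R i).carrier_subset hΓ hy
  refine ⟨N, ⟨?_, ?_⟩, ⟨?_, ?_⟩, fun i => ⟨i, rfl⟩, r, fun i => (R i).toCycle hΓ,
    fun i => ⟨i, rfl⟩, ?_, rfl⟩
  · rintro _ ⟨i, rfl⟩
    exact (R i).isSimple hΓ hS h0 hax
  · rintro _ ⟨i, rfl⟩
    exact (R i).meetsAxesOnce hΓ hsub hS hax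
  · rintro _ ⟨i, rfl⟩
    exact (R i).exists_isElementaryBlock hΓ
  · rintro _ ⟨i, rfl⟩ j
    exact (R i).onAxis j
  · rintro _ ⟨i, rfl⟩
    exact ⟨i, rfl, fun j hj => (hne _ _ hj).symm⟩

end CoordCycle

end HetNet

namespace HetNet
open scoped InnerProductSpace

/-! ### Networks with three and four nodes -/

theorem smul_e_add_smul_e_apply {a b : Fin 4} (hab : a ≠ b) (x y : ℝ) (i : Fin 4) :
    (x • e a + y • e b) i = if i = a then x else if i = b then y else 0 := by
  by_cases ha : i = a
  · subst ha; simp [hab]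
  · by_cases hb : i = b
    · subst hb; simp [ha]
    · simp [ha, hb]

theorem sum_mul_sq_plane {a b : Fin 4} (hab : a ≠ b) (B : Fin 4 → ℝ) (x y : ℝ) :
    ∑ i, B i * (x • e a + y • e b) i ^ 2 = B a * x ^ 2 + B b * y ^ 2 := by
  have : ∀ i, B i * (x • e a + y • e b) i ^ 2 =
      (if i = a then B a * x ^ 2 else 0) + (if i = b then B b * y ^ 2 else 0) := by
    intro i
    rw [smul_e_add_smul_e_apply hab]
    by_cases ha : i = a
    · subst ha; simp [hab]
    · by_cases hb : i = b
      · subst hb; simp [ha]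
      · simp [ha, hb]
  rw [Finset.sum_congr rfl fun i _ => this i, Finset.sum_add_distrib]
  simp

/-- The terms with coefficients `c` contain the product of all four coordinates and vanish on
coordinate planes; so `c` may be chosen freely without affecting the connections. -/
theorem fieldThree_plane (A : Fin 4 → ℝ) (B : Fin 4 → Fin 4 → ℝ) (c : Fin 4 → ℝ) {a b : Fin 4}
    (hab : a ≠ b) (x y : ℝ) :
    fieldThree A B c (x • e a + y • e b) =
      (x * (A a + B a a * x ^ 2 + B a b * y ^ 2)) • e a +
        (y * (A b + B b a * x ^ 2 + B b b * y ^ 2)) • e b := by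
  have hprod : (x • e a + y • e b) 0 * (x • e a + y • e b) 1 * (x • e a + y • e b) 2 *
      (x • e a + y • e b) 3 = 0 := by
    simp only [smul_e_add_smul_e_apply hab]
    fin_cases a <;> fin_cases b <;> simp at hab ⊢
  ext j
  have h1 : fieldThree A B c (x • e a + y • e b) j =
      (x • e a + y • e b) j * (A j + ∑ i, B j i * (x • e a + y • e b) i ^ 2) +
      c j * ((x • e a + y • e b) 0 * (x • e a + y • e b) 1 * (x • e a + y • e b) 2 *
        (x • e a + y • e b) 3) * (x • e a + y • e b) j := by
    simp only [fieldThree]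
    ring
  rw [h1, hprod, sum_mul_sq_plane hab, smul_e_add_smul_e_apply hab, smul_e_add_smul_e_apply hab]
  by_cases ha : j = a
  · subst ha
    rw [if_pos rfl, if_pos rfl]
    ring
  · by_cases hb : j = b
    · subst hb
      rw [if_neg ha, if_pos rfl, if_neg ha, if_pos rfl]
      ring
    · simp [ha, hb]

theorem contDiff_fieldThree (n : WithTop ℕ∞) (A : Fin 4 → ℝ) (B : Fin 4 → Fin 4 → ℝ)
    (c : Fin 4 → ℝ) : ContDiff ℝ n (fieldThree A B c) := by
  refine contDiff_euclidean.mpr fun j => ?_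
  simp only [fieldThree]
  fun_prop

/-- A sign change multiplies the product of all coordinates by its determinant. All other terms
respect every sign change, so only `c` distinguishes rotations from reflections. -/
theorem isEquivariant_fieldThree {Γ : Subgroup O4} (hΓ : Γ ≤ signGroup) (A : Fin 4 → ℝ)
    (B : Fin 4 → Fin 4 → ℝ) (c : Fin 4 → ℝ) (h : c = 0 ∨ Γ ≤ rotationGroup) :
    IsEquivariant Γ (fieldThree A B c) := by
  intro γ hγ x
  obtain ⟨s, hs, hγs⟩ := hΓ hγ
  have hsq : ∀ i, s i ^ 2 = 1 := fun i => by rcases hs i with h | h <;> simp [h]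
  have hc : ∀ j, c j * (s 0 * s 1 * s 2 * s 3) = c j := by
    intro j
    rcases h with h | h
    · simp [h]
    · have hdet : LinearMap.det (γ.toLinearEquiv : E4 →ₗ[ℝ] E4) = 1 := h hγ
      rw [det_of_signs hγs] at hdet
      rw [hdet, mul_one]
  ext j
  rw [hγs]
  simp only [fieldThree, hγs, mul_pow, hsq, one_mul]
  linear_combination (x 0 * x 1 * x 2 * x 3 * (s j * x j)) * hc j

/-! #### The connecting orbit on the unit circle -/

/-- A coordinate of the connecting orbit on the unit circle. -/
noncomputable def circleCoord (d t : ℝ) : ℝ := (√(1 + Real.exp (2 * d * t)))⁻¹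

theorem circleCoord_sq (d t : ℝ) : circleCoord d t ^ 2 = (1 + Real.exp (2 * d * t))⁻¹ := by
  rw [circleCoord, inv_pow, Real.sq_sqrt (by positivity)]

theorem circleCoord_sq_add_sq (d t : ℝ) : circleCoord d t ^ 2 + circleCoord d (-t) ^ 2 = 1 := by
  rw [circleCoord_sq, circleCoord_sq, show 2 * d * -t = -(2 * d * t) by ring, Real.exp_neg]
  have := Real.exp_pos (2 * d * t)
  field_simp
  ring

theorem hasDerivAt_circleCoord (d t : ℝ) :
    HasDerivAt (circleCoord d) (-d * circleCoord d t * circleCoord d (-t) ^ 2) t := by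
  have hpos : 0 < 1 + Real.exp (2 * d * t) := by positivity
  have h1 : HasDerivAt (fun t => 1 + Real.exp (2 * d * t)) (Real.exp (2 * d * t) * (2 * d)) t := by
    have := ((hasDerivAt_id t).const_mul (2 * d)).exp.const_add 1
    simpa using this
  have h2 := (h1.sqrt hpos.ne').inv (Real.sqrt_pos.mpr hpos).ne'
  refine h2.congr_deriv ?_
  have h3 : circleCoord d (-t) ^ 2 = 1 - circleCoord d t ^ 2 := by
    linarith [circleCoord_sq_add_sq d t]
  rw [h3, circleCoord_sq, circleCoord, Real.sq_sqrt hpos.le]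
  have hs := Real.sqrt_pos.mpr hpos
  field_simp
  ring

theorem tendsto_circleCoord_atBot {d : ℝ} (hd : 0 < d) :
    Tendsto (circleCoord d) atBot (𝓝 1) := by
  have h1 : Tendsto (fun t => Real.exp (2 * d * t)) atBot (𝓝 0) :=
    Real.tendsto_exp_atBot.comp (tendsto_id.const_mul_atBot (by positivity))
  have h2 := ((h1.const_add 1).sqrt).inv₀ (by simp)
  rw [add_zero, Real.sqrt_one, inv_one] at h2
  exact h2

theorem tendsto_circleCoord_atTop {d : ℝ} (hd : 0 < d) :
    Tendsto (circleCoord d) atTop (𝓝 0) := by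
  have h1 : Tendsto (fun t => Real.exp (2 * d * t)) atTop atTop :=
    Real.tendsto_exp_atTop.comp (tendsto_id.const_mul_atTop (by positivity))
  exact tendsto_inv_atTop_zero.comp
    (Real.tendsto_sqrt_atTop.comp (tendsto_atTop_add_const_left _ 1 h1))

/-! #### The vector field -/

/-- An orientation of the complete graph on the four coordinate axes. -/
def orient : Fin 4 → Fin 4 → ℤ := ![![0, 1, -3, -1], ![-1, 0, 1, 3], ![3, -1, 0, 1], ![1, -3, -1, 0]]

theorem orient_antisymm : ∀ i j, orient j i = -orient i j := by decide

theorem orient_self : ∀ i, orient i i = 0 := by decide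

/-- Eigenvalues at the equilibrium on the axis `a`. -/
def orientEigenvalue (a i : Fin 4) : ℤ := if i = a then -2 else orient a i

/-- The weights 1 and 3 in `orient` are chosen so that, together with the radial value `-2`, the
four eigenvalues at each node are different. -/
theorem orientEigenvalue_injective : ∀ a i j, orientEigenvalue a i = orientEigenvalue a j → i = j := by
  decide

/-- A vector field for which the unit sphere is invariant. -/
noncomputable def sphereField (c : Fin 4 → ℝ) : E4 → E4 :=
  fieldThree (fun _ => 1) (fun j i => -1 - orient j i) c

/-- Antisymmetry of `orient` cancels the mixed terms in the growth rate of the squared radius `R`,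
which is `2 * R * (1 - R)`; so the unit circle is invariant. -/
theorem sphereField_plane (c : Fin 4 → ℝ) {a b : Fin 4} (hab : a ≠ b) (x y : ℝ) :
    sphereField c (x • e a + y • e b) =
      (x * (1 - x ^ 2 - (1 + orient a b) * y ^ 2)) • e a +
        (y * (1 - (1 - orient a b) * x ^ 2 - y ^ 2)) • e b := by
  rw [sphereField, fieldThree_plane _ _ _ hab, orient_antisymm a b, orient_self, orient_self]
  congr 2 <;> push_cast <;> ring

theorem fderiv_sphereField_plane (c : Fin 4 → ℝ) {a b : Fin 4} (hab : a ≠ b) (p q : ℝ) :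
    fderiv ℝ (sphereField c) (e a) (p • e a + q • e b) =
      (-2 * p) • e a + (orient a b * q) • e b := by
  have hd : DifferentiableAt ℝ (sphereField c) (e a) :=
    (contDiff_fieldThree 1 _ _ c).differentiable one_ne_zero _
  rw [← hd.lineDeriv_eq_fderiv]
  refine HasLineDerivAt.lineDeriv ?_
  have hline : (fun t : ℝ => sphereField c (e a + t • (p • e a + q • e b))) = fun t : ℝ =>
      ((1 + t * p) * (1 - (1 + t * p) ^ 2 - (1 + orient a b) * (t * q) ^ 2)) • e a +
        ((t * q) * (1 - (1 - orient a b) * (1 + t * p) ^ 2 - (t * q) ^ 2)) • e b := by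
    funext t
    rw [← sphereField_plane c hab]
    congr 1
    rw [smul_add, smul_smul, smul_smul, add_smul, one_smul, add_assoc]
  rw [HasLineDerivAt, hline]
  have h1 : HasDerivAt (fun t : ℝ => 1 + t * p) p 0 := by
    simpa using ((hasDerivAt_id (0 : ℝ)).mul_const p).const_add 1
  have h2 : HasDerivAt (fun t : ℝ => t * q) q 0 := by
    simpa using (hasDerivAt_id (0 : ℝ)).mul_const q
  have h3 := (h1.fun_mul (((h1.fun_pow 2).const_sub 1).fun_sub
    ((h2.fun_pow 2).const_mul (1 + (orient a b : ℝ))))).smul_const (e a)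
  have h4 := (h2.fun_mul ((((h1.fun_pow 2).const_mul (1 - (orient a b : ℝ))).const_sub 1).fun_sub
    (h2.fun_pow 2))).smul_const (e b)
  refine (h3.fun_add h4).congr_deriv ?_
  congr 2
  · norm_num
  · norm_num
    ring

theorem fderiv_sphereField (c : Fin 4 → ℝ) (a i : Fin 4) :
    fderiv ℝ (sphereField c) (e a) (e i) = (orientEigenvalue a i : ℝ) • e i := by
  by_cases h : i = a
  · subst h
    have hne : i ≠ i + 1 := by revert i; decide
    have := fderiv_sphereField_plane c hne 1 0
    simpa [orientEigenvalue] using this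
  · have := fderiv_sphereField_plane c (Ne.symm h) 0 1
    simpa [orientEigenvalue, h] using this

theorem sphereField_e (c : Fin 4 → ℝ) (a : Fin 4) : sphereField c (e a) = 0 := by
  have hne : a ≠ a + 1 := by revert a; decide
  have := sphereField_plane c hne 1 0
  simpa using this

/-- The unit sphere. -/
def unitSphere : Set E4 := {x | ∑ i, x i ^ 2 = 1}

theorem mem_unitSphere_plane {a b : Fin 4} (hab : a ≠ b) {x y : ℝ} (h : x ^ 2 + y ^ 2 = 1) :
    x • e a + y • e b ∈ unitSphere := by
  have := sum_mul_sq_plane hab (fun _ => 1) x y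
  simp only [one_mul] at this
  exact this.trans h

theorem unitSphere_invariant {γ : O4} (hγ : γ ∈ signGroup) {x : E4} (hx : x ∈ unitSphere) :
    γ x ∈ unitSphere := by
  obtain ⟨s, hs, h⟩ := hγ
  change ∑ i, (γ x) i ^ 2 = 1
  rw [← show ∑ i, x i ^ 2 = 1 from hx]
  refine Finset.sum_congr rfl fun i _ => ?_
  rw [h]
  rcases hs i with h | h <;> rw [h] <;> ring

theorem eq_of_sq_eq_sq_of_mul_pos {x y : ℝ} (h : x ^ 2 = y ^ 2) (hxy : 0 < x * y) : x = y := by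
  rcases sq_eq_sq_iff_eq_or_eq_neg.mp h with h | h
  · exact h
  · exfalso
    rw [h] at hxy
    nlinarith [sq_nonneg y]

theorem unitSphere_axis : ∀ x ∈ unitSphere, ∀ y ∈ unitSphere, ∀ i, (∀ i', i' ≠ i → x i' = 0) →
    (∀ i', i' ≠ i → y i' = 0) → 0 < x i * y i → x i = y i := by
  have key : ∀ x ∈ unitSphere, ∀ i, (∀ i', i' ≠ i → x i' = 0) → x i ^ 2 = 1 := by
    intro x hx i h
    rw [← show ∑ i, x i ^ 2 = 1 from hx]
    exact (Finset.sum_eq_single (f := fun j => x j ^ 2) i (fun j _ hj => by rw [h j hj]; ring) (by simp)).symm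
  intro x hx y hy i hxi hyi hpos
  exact eq_of_sq_eq_sq_of_mul_pos ((key x hx i hxi).trans (key y hy i hyi).symm) hpos

theorem onAxis_smul_e (c : ℝ) (i : Fin 4) : OnAxis (c • e i) := ⟨i, fun j hj => by simp [hj]⟩

/-- The heteroclinic cycle that visits the axes `p 0, p 1, …` in this order. -/
noncomputable def sphereCycle {Γ : Subgroup O4} (hΓ : Γ ≤ signGroup)
    (hκ : ∀ a b : Fin 4, a ≠ b → kappa a b ∈ Γ) (c : Fin 4 → ℝ) (k : ℕ) (hk : 0 < k)
    (p : Fin (k + 1) → Fin 4) (hp : Function.Injective p)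
    (hor : ∀ j, 0 < orient (p j) (p (j + 1))) (h2 : ∀ j : Fin (k + 1), j ≠ j + 1 + 1) :
    CoordCycle Γ (sphereField c) unitSphere where
  k := k
  k_pos := hk
  node := fun j => e (p j)
  -- On the unit circle the field gives `x' = -d * x * y ^ 2` and `y' = d * y * x ^ 2` with `d =
  -- orient (p j) (p (j + 1))`; the second coordinate is the first one in reversed time.
  traj := fun j t => circleCoord (orient (p j) (p (j + 1))) t • e (p j) +
    circleCoord (orient (p j) (p (j + 1))) (-t) • e (p (j + 1))
  a := p
  b := fun j => p (j + 1)
  c := p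
  lam := fun j i => orientEigenvalue (p j) i
  ne := fun j h => by
    have := hor j
    rw [← h, orient_self] at this
    exact lt_irrefl _ this
  kappa_mem := fun j => hκ _ _ fun h => by
    have := hor j
    rw [← h, orient_self] at this
    exact lt_irrefl _ this
  -- The condition `h2` excludes cycles of length two, so consecutive edges share only their middle
  -- vertex.
  inter := fun j i h h' => by
    rcases h with h | h
    · rcases h' with h' | h'
      · exact h'
      · exact absurd (hp (h.symm.trans h')) (h2 j)
    · exact h
  onAxis := fun j => by simpa using onAxis_smul_e 1 (p j)
  distinct := fun i j hij => by
    rintro ⟨γ, hγ, h⟩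
    obtain ⟨s, hs, hγs⟩ := hΓ hγ
    rw [signGroup_apply_e hγs] at h
    have h1 := congrArg (fun x : E4 => x (p j)) h
    simp [hp.ne hij.symm] at h1
  equilibrium := fun j => sphereField_e c (p j)
  node_mem := fun j => Submodule.subset_span (by simp)
  node_succ_mem := fun j => Submodule.subset_span (by simp)
  fderiv_node := fun j i => fderiv_sphereField c (p j) i
  lam_injective := fun j i i' h => orientEigenvalue_injective _ _ _ (Int.cast_injective h)
  saddle_neg := fun j => by simp [orientEigenvalue]
  saddle_pos := fun j => by
    have h := hor j
    have hne : p (j + 1) ≠ p j := fun h' => by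
      rw [h', orient_self] at h
      exact lt_irrefl _ h
    rw [orientEigenvalue, if_neg hne]
    exact_mod_cast h
  sink_left := fun j => by
    have h := hor j
    have hne : p j ≠ p (j + 1) := fun h' => by
      rw [← h', orient_self] at h
      exact lt_irrefl _ h
    rw [orientEigenvalue, if_neg hne, orient_antisymm (p j) (p (j + 1))]
    exact_mod_cast neg_neg_of_pos h
  sink_right := fun j => by simp [orientEigenvalue]
  solution := fun j t => by
    have h := hor j
    have hne : p j ≠ p (j + 1) := fun h' => by
      rw [← h', orient_self] at h
      exact lt_irrefl _ h
    rw [sphereField_plane c hne]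
    set d : ℝ := ((orient (p j) (p (j + 1)) : ℤ) : ℝ)
    have h1 := hasDerivAt_circleCoord d t
    have h2 : HasDerivAt (fun t => circleCoord d (-t))
        (d * circleCoord d (-t) * circleCoord d t ^ 2) t := by
      have := (hasDerivAt_circleCoord d (-t)).comp t (hasDerivAt_neg t)
      rw [neg_neg] at this
      exact this.congr_deriv (by ring)
    refine ((h1.smul_const (e (p j))).fun_add (h2.smul_const (e (p (j + 1))))).congr_deriv ?_
    have hsq := circleCoord_sq_add_sq d t
    congr 2
    · linear_combination (circleCoord d t) * hsq
    · linear_combination (circleCoord d (-t)) * hsq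
  traj_mem := fun j t => Submodule.mem_span_pair.mpr ⟨_, _, rfl⟩
  tendsto_source := fun j => by
    have hd : (0 : ℝ) < orient (p j) (p (j + 1)) := by exact_mod_cast hor j
    have h1 := tendsto_circleCoord_atBot hd
    have h2 := (tendsto_circleCoord_atTop hd).comp tendsto_neg_atBot_atTop
    simpa using (h1.smul_const (e (p j))).add (h2.smul_const (e (p (j + 1))))
  tendsto_target := fun j => by
    have hd : (0 : ℝ) < orient (p j) (p (j + 1)) := by exact_mod_cast hor j
    have h1 := tendsto_circleCoord_atTop hd
    have h2 := (tendsto_circleCoord_atBot hd).comp tendsto_neg_atTop_atBot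
    simpa using (h1.smul_const (e (p j))).add (h2.smul_const (e (p (j + 1))))
  node_mem_set := fun j => by
    have hne : p j ≠ p j + 1 := by generalize p j = a; revert a; decide
    have := mem_unitSphere_plane hne (x := 1) (y := 0) (by norm_num)
    simpa using this
  traj_mem_set := fun j t => by
    have h := hor j
    have hne : p j ≠ p (j + 1) := fun h' => by
      rw [← h', orient_self] at h
      exact lt_irrefl _ h
    exact mem_unitSphere_plane hne (circleCoord_sq_add_sq _ t)

end HetNet

/-! ### The networks of types A3, A4, B3 and C4 on the unit sphere. -/

namespace HetNet
open scoped InnerProductSpace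

theorem zero_notMem_unitSphere : (0 : E4) ∉ unitSphere := by
  intro h
  have : ∑ i, (0 : E4) i ^ 2 = 1 := h
  simp at this

/-- Sign changes do not alter which coordinates vanish, so the group orbit of a cycle remembers the
axes it involves. This tells the constructed cycles apart. -/
theorem CoordCycle.exists_axis_of_groupOrbit_eq {Γ : Subgroup O4} {f : E4 → E4} {S : Set E4}
    {hΓ : Γ ≤ signGroup} {D D' : CoordCycle Γ f S}
    (h : groupOrbit Γ (D.toCycle hΓ).carrier = groupOrbit Γ (D'.toCycle hΓ).carrier) {y : E4}
    (hy : y ∈ (D.toCycle hΓ).carrier) {i : Fin 4} (hi : y i ≠ 0) :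
    ∃ l, i = D'.a l ∨ i = D'.b l := by
  by_contra! hcon
  have h1 := subset_groupOrbit Γ _ hy
  rw [h] at h1
  obtain ⟨γ, hγ, x, hx, rfl⟩ := h1
  obtain ⟨s, -, hs⟩ := hΓ hγ
  rw [hs] at hi
  refine hi ?_
  suffices x i = 0 by rw [this, mul_zero]
  rcases hx with ⟨j, rfl⟩ | hx
  · exact mem_span_e_e.mp (D'.node_mem j) i (hcon j).1 (hcon j).2
  · obtain ⟨j, t, rfl⟩ := Set.mem_iUnion.mp hx
    exact mem_span_e_e.mp (D'.traj_mem j t) i (hcon j).1 (hcon j).2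

/-- Three heteroclinic cycles of `sphereField c`. -/
noncomputable def sphereCycles {Γ : Subgroup O4} (hΓ : Γ ≤ signGroup)
    (hκ : ∀ a b : Fin 4, a ≠ b → kappa a b ∈ Γ) (c : Fin 4 → ℝ) :
    Fin 3 → CoordCycle Γ (sphereField c) unitSphere :=
  -- The positive entries of `orient` are the edges 0 → 1, 1 → 2, 2 → 0, 1 → 3, 3 → 0, 2 → 3, which
  -- carry exactly two triangles and one four-cycle.
  ![sphereCycle hΓ hκ c 2 two_pos ![0, 1, 2] (by decide) (by decide) (by decide),
    sphereCycle hΓ hκ c 2 two_pos ![0, 1, 3] (by decide) (by decide) (by decide),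
    sphereCycle hΓ hκ c 3 three_pos ![0, 1, 2, 3] (by decide) (by decide) (by decide)]

theorem sphereCycles_injective {Γ : Subgroup O4} (hΓ : Γ ≤ signGroup)
    (hκ : ∀ a b : Fin 4, a ≠ b → kappa a b ∈ Γ) (c : Fin 4 → ℝ) (i j : Fin 3)
    (h : groupOrbit Γ ((sphereCycles hΓ hκ c i).toCycle hΓ).carrier =
      groupOrbit Γ ((sphereCycles hΓ hκ c j).toCycle hΓ).carrier) : i = j := by
  have h01 : groupOrbit Γ ((sphereCycles hΓ hκ c 0).toCycle hΓ).carrier ≠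
      groupOrbit Γ ((sphereCycles hΓ hκ c 1).toCycle hΓ).carrier := fun h =>
    absurd (show ∃ l : Fin 3, (2 : Fin 4) = ![0, 1, 3] l ∨ (2 : Fin 4) = ![0, 1, 3] (l + 1) from
      CoordCycle.exists_axis_of_groupOrbit_eq h (y := e 2) (i := 2)
        (Or.inl ⟨(2 : Fin 3), rfl⟩) (by simp))
      (by decide)
  have h02 : groupOrbit Γ ((sphereCycles hΓ hκ c 0).toCycle hΓ).carrier ≠
      groupOrbit Γ ((sphereCycles hΓ hκ c 2).toCycle hΓ).carrier := fun h =>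
    absurd (show ∃ l : Fin 3, (3 : Fin 4) = ![0, 1, 2] l ∨ (3 : Fin 4) = ![0, 1, 2] (l + 1) from
      CoordCycle.exists_axis_of_groupOrbit_eq h.symm (y := e 3) (i := 3)
        (Or.inl ⟨(3 : Fin 4), rfl⟩) (by simp))
      (by decide)
  have h12 : groupOrbit Γ ((sphereCycles hΓ hκ c 1).toCycle hΓ).carrier ≠
      groupOrbit Γ ((sphereCycles hΓ hκ c 2).toCycle hΓ).carrier := fun h =>
    absurd (show ∃ l : Fin 3, (2 : Fin 4) = ![0, 1, 3] l ∨ (2 : Fin 4) = ![0, 1, 3] (l + 1) from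
      CoordCycle.exists_axis_of_groupOrbit_eq h.symm (y := e 2) (i := 2)
        (Or.inl ⟨(2 : Fin 4), rfl⟩) (by simp))
      (by decide)
  fin_cases i <;> fin_cases j <;>
    first | rfl | exact absurd h h01 | exact absurd h h02 | exact absurd h h12 |
      exact absurd h.symm h01 | exact absurd h.symm h02 | exact absurd h.symm h12

theorem exists_node_sphereCycles {Γ : Subgroup O4} (hΓ : Γ ≤ signGroup)
    (hκ : ∀ a b : Fin 4, a ≠ b → kappa a b ∈ Γ) (c : Fin 4 → ℝ) (i : Fin 3) :
    ∃ j, ((sphereCycles hΓ hκ c i).toCycle hΓ).node j = e 0 := by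
  fin_cases i
  · exact ⟨(0 : Fin 3), rfl⟩
  · exact ⟨(0 : Fin 3), rfl⟩
  · exact ⟨(0 : Fin 4), rfl⟩

theorem e_mem_carrier_sphereCycles {Γ : Subgroup O4} (hΓ : Γ ≤ signGroup)
    (hκ : ∀ a b : Fin 4, a ≠ b → kappa a b ∈ Γ) (c : Fin 4 → ℝ) (i : Fin 3) :
    e 0 ∈ ((sphereCycles hΓ hκ c i).toCycle hΓ).carrier := by
  obtain ⟨j, hj⟩ := exists_node_sphereCycles hΓ hκ c i
  exact Or.inl ⟨j, hj⟩

theorem k_sphereCycles {Γ : Subgroup O4} (hΓ : Γ ≤ signGroup)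
    (hκ : ∀ a b : Fin 4, a ≠ b → kappa a b ∈ Γ) (c : Fin 4 → ℝ) (i : Fin 3) :
    ((sphereCycles hΓ hκ c i).toCycle hΓ).k = ![2, 2, 3] i := by
  fin_cases i <;> rfl

/-- One field serves for all types: `σ` selects which of its three cycles form the network. They all
pass through `e 0`, so any selection is connected. -/
theorem supports_sphereField_of_label (n : WithTop ℕ∞) {Γ : Subgroup O4} (hΓ : Γ ≤ signGroup)
    (hκ : ∀ a b : Fin 4, a ≠ b → kappa a b ∈ Γ) (c : Fin 4 → ℝ) (hc : c = 0 ∨ Γ ≤ rotationGroup)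
    {lab : Fin 3 → Label}
    (hlab : ∀ N : Network Γ (sphereField c), N.IsSimple → N.AssumptionA → ∀ i,
      (sphereCycles hΓ hκ c i).toCycle hΓ ∈ N.cycles →
      ((sphereCycles hΓ hκ c i).toCycle hΓ).label = lab i)
    {r : ℕ} (hr : 2 ≤ r) {σ : Fin r → Fin 3} (hσ : Function.Injective σ) :
    Supports n Γ (sphereField c) (Finset.univ.val.map fun i => lab (σ i)) := by
  obtain ⟨N, hN, hA, hmem, hτ⟩ := CoordCycle.exists_network hΓ
    (fun γ hγ x hx => unitSphere_invariant (hΓ hγ) hx) zero_notMem_unitSphere unitSphere_axis hr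
    (fun i => sphereCycles hΓ hκ c (σ i))
    (fun i j h => hσ (sphereCycles_injective hΓ hκ c _ _ h))
    (fun i => e_mem_carrier_sphereCycles hΓ hκ c (σ i))
  refine ⟨finite_of_le_signGroup hΓ, contDiff_fieldThree n _ _ _,
    isEquivariant_fieldThree hΓ _ _ _ hc, N, hN, hA, ?_⟩
  rwa [Multiset.map_congr rfl fun i _ => hlab N hN hA (σ i) (hmem i)] at hτ

theorem supports_sphereField_of_le_rotationGroup (n : WithTop ℕ∞) {Γ : Subgroup O4}
    (hΓ : Γ ≤ signGroup) (hrot : Γ ≤ rotationGroup) (hκ : ∀ a b : Fin 4, a ≠ b → kappa a b ∈ Γ)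
    (c : Fin 4 → ℝ) {r : ℕ} (hr : 2 ≤ r) {σ : Fin r → Fin 3} (hσ : Function.Injective σ) :
    Supports n Γ (sphereField c) (Finset.univ.val.map fun i => ![A3, A3, A4] (σ i)) := by
  refine supports_sphereField_of_label n hΓ hκ c (Or.inr hrot) (fun N hN _ i hi => ?_) hr hσ
  have hneg : (LinearIsometryEquiv.neg ℝ : O4) ∈ Γ := by
    rw [neg_eq_kappa_mul]
    exact Γ.mul_mem (hκ 0 1 (by decide)) (hκ 2 3 (by decide))
  have hTA : ((sphereCycles hΓ hκ c i).toCycle hΓ).IsTypeA :=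
    (Cycle.isTypeA_iff _ (hN.simple_cycles _ hi) (contDiff_fieldThree 1 _ _ _)
      (isEquivariant_fieldThree hΓ _ _ _ (Or.inr hrot)) 0).mpr (not_hasOddIsotropy hrot _)
  have hsize := Cycle.numOrbits_eq (C := (sphereCycles hΓ hκ c i).toCycle hΓ)
    (sphereCycles hΓ hκ c i).distinct
  rw [k_sphereCycles] at hsize
  simp only [Cycle.label, if_pos hTA, hsize, hneg, decide_true]
  fin_cases i <;> rfl

/-- The reflection fixes the common node `e 0`, which excludes type A; it is a symmetry of the field
because `c` is zero. -/
theorem supports_sphereField_of_reflectLast_mem (n : WithTop ℕ∞) {Γ : Subgroup O4}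
    (hΓ : Γ ≤ signGroup) (hrefl : reflectLast ∈ Γ) (hκ : ∀ a b : Fin 4, a ≠ b → kappa a b ∈ Γ)
    {r : ℕ} (hr : 2 ≤ r) {σ : Fin r → Fin 3} (hσ : Function.Injective σ) :
    Supports n Γ (sphereField 0) (Finset.univ.val.map fun i => ![B3, B3, C4] (σ i)) := by
  refine supports_sphereField_of_label n hΓ hκ 0 (Or.inl rfl) (fun N hN hA i hi => ?_) hr hσ
  have hneg : (LinearIsometryEquiv.neg ℝ : O4) ∈ Γ := by
    rw [neg_eq_kappa_mul]
    exact Γ.mul_mem (hκ 0 1 (by decide)) (hκ 2 3 (by decide))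
  have hf : ContDiff ℝ 1 (sphereField 0) := contDiff_fieldThree 1 _ _ _
  have he : IsEquivariant Γ (sphereField 0) := isEquivariant_fieldThree hΓ _ _ _ (Or.inl rfl)
  obtain ⟨j, hj⟩ := exists_node_sphereCycles hΓ hκ 0 i
  have hTA : ¬ ((sphereCycles hΓ hκ 0 i).toCycle hΓ).IsTypeA := by
    rw [Cycle.isTypeA_iff _ (hN.simple_cycles _ hi) hf he j, not_not, hj]
    exact hasOddIsotropy_of_reflectLast_mem hrefl
  have hk := k_sphereCycles hΓ hκ 0 i
  have hsize := Cycle.numOrbits_eq (C := (sphereCycles hΓ hκ 0 i).toCycle hΓ)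
    (sphereCycles hΓ hκ 0 i).distinct
  by_cases hi2 : i = 2
  · subst hi2
    have hB := Network.not_isTypeB_of_four hN hA hf he hneg hi hk
    simp only [Cycle.label, if_neg hTA, if_neg hB, hsize, hk, hneg, decide_true]
    rfl
  · have hk2 : ((sphereCycles hΓ hκ 0 i).toCycle hΓ).k = 2 := by
      rw [hk]
      fin_cases i <;> first | rfl | exact absurd rfl hi2
    have hB := Network.isTypeB_of_three hN hA hf he hneg hi hk2 hTA
    simp only [Cycle.label, if_neg hTA, if_pos hB, hsize, hk2, hneg, decide_true]
    fin_cases i <;> first | rfl | exact absurd rfl hi2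

theorem supports_GammaThree (n : WithTop ℕ∞) {τ : Multiset Label}
    (hτ : τ ∈ ({{A3, A3}, {A3, A4}, {A3, A3, A4}} : Set (Multiset Label))) :
    Supports n GammaThree (sphereField fun _ => 1) τ := by
  have key := @supports_sphereField_of_le_rotationGroup n GammaThree GammaThree_le_signGroup
    GammaThree_le_rotationGroup (fun a b h => kappa_mem_GammaThree h) (fun _ => 1)
  rcases hτ with rfl | rfl | rfl
  · exact key (le_refl 2) (σ := ![0, 1]) (by decide)
  · exact key (le_refl 2) (σ := ![0, 2]) (by decide)
  · exact key (r := 3) (by norm_num) (σ := id) Function.injective_id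

theorem supports_signGroup (n : WithTop ℕ∞) {τ : Multiset Label}
    (hτ : τ ∈ ({{B3, B3}, {B3, C4}, {B3, B3, C4}} : Set (Multiset Label))) :
    Supports n signGroup (sphereField 0) τ := by
  have key := @supports_sphereField_of_reflectLast_mem n signGroup le_rfl
    reflectLast_mem_signGroup (fun a b _ => kappa_mem_signGroup a b)
  rcases hτ with rfl | rfl | rfl
  · exact key (le_refl 2) (σ := ![0, 1]) (by decide)
  · exact key (le_refl 2) (σ := ![0, 2]) (by decide)
  · exact key (r := 3) (by norm_num) (σ := id) Function.injective_id

end HetNet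

namespace HetNet
open scoped InnerProductSpace

/-! ### Networks with two nodes -/

/-- A scalar autonomous differential equation is solved by inverting an antiderivative of the
reciprocal of its right hand side. -/
theorem exists_solution_of_antideriv {a b : ℝ} {g T : ℝ → ℝ} (hab : a < b)
    (hg : ∀ x ∈ Set.Ioo a b, 0 < g x) (hT : ∀ x ∈ Set.Ioo a b, HasDerivAt T (g x)⁻¹ x)
    (ha : Tendsto T (𝓝[>] a) atBot) (hb : Tendsto T (𝓝[<] b) atTop) :
    ∃ u : ℝ → ℝ, (∀ t, u t ∈ Set.Ioo a b) ∧ (∀ t, HasDerivAt u (g (u t)) t) ∧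
      Tendsto u atBot (𝓝 a) ∧ Tendsto u atTop (𝓝 b) := by
  have hcont : ContinuousOn T (Set.Ioo a b) := fun x hx => (hT x hx).continuousAt.continuousWithinAt
  have hmono : StrictMonoOn T (Set.Ioo a b) := by
    refine strictMonoOn_of_deriv_pos (convex_Ioo a b) hcont fun x hx => ?_
    rw [interior_Ioo] at hx
    rw [(hT x hx).deriv]
    exact inv_pos.mpr (hg x hx)
  -- The antiderivative `T` measures time as a function of position. It increases strictly from `-∞`
  -- to `∞`, and its inverse is the solution.
  have hex : ∀ t, ∃ x ∈ Set.Ioo a b, T x = t := by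
    intro t
    obtain ⟨x, hx, hxt⟩ := (((ha.eventually (eventually_le_atBot t)).and
      (Ioo_mem_nhdsGT hab))).exists
    obtain ⟨y, hy, hyt⟩ := (((hb.eventually (eventually_ge_atTop t)).and
      (Ioo_mem_nhdsLT hab))).exists
    obtain ⟨z, hz, hzt⟩ := isPreconnected_Ioo.intermediate_value hxt hyt hcont ⟨hx, hy⟩
    exact ⟨z, hz, hzt⟩
  choose u hu hTu using hex
  have hlt : ∀ {y t}, y ∈ Set.Ioo a b → T y < t → y < u t := fun {y t} hy h =>
    (hmono.lt_iff_lt hy (hu t)).mp (by rwa [hTu])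
  have hgt : ∀ {y t}, y ∈ Set.Ioo a b → t < T y → u t < y := fun {y t} hy h =>
    (hmono.lt_iff_lt (hu t) hy).mp (by rwa [hTu])
  have hc : ∀ t, ContinuousAt u t := by
    intro t
    refine tendsto_order.mpr ⟨fun y hy => ?_, fun y hy => ?_⟩
    · by_cases hya : a < y
      · have hy' : y ∈ Set.Ioo a b := ⟨hya, hy.trans (hu t).2⟩
        have h := hmono hy' (hu t) hy
        rw [hTu] at h
        filter_upwards [lt_mem_nhds h] with s hs using hlt hy' hs
      · exact Eventually.of_forall fun s => (not_lt.mp hya).trans_lt (hu s).1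
    · by_cases hyb : y < b
      · have hy' : y ∈ Set.Ioo a b := ⟨(hu t).1.trans hy, hyb⟩
        have h := hmono (hu t) hy' hy
        rw [hTu] at h
        filter_upwards [gt_mem_nhds h] with s hs using hgt hy' hs
      · exact Eventually.of_forall fun s => (hu s).2.trans_le (not_lt.mp hyb)
  refine ⟨u, hu, fun t => ?_, ?_, ?_⟩
  · have h := HasDerivAt.of_local_left_inverse (hc t) (hT (u t) (hu t))
      (inv_ne_zero (hg _ (hu t)).ne') (Eventually.of_forall hTu)
    rwa [inv_inv] at h
  · refine tendsto_order.mpr ⟨fun y hy => Eventually.of_forall fun s => hy.trans (hu s).1,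
      fun y hy => ?_⟩
    have hy' : min y ((a + b) / 2) ∈ Set.Ioo a b :=
      ⟨lt_min hy (by linarith), (min_le_right _ _).trans_lt (by linarith)⟩
    filter_upwards [eventually_lt_atBot (T (min y ((a + b) / 2)))] with s hs
    exact (hgt hy' hs).trans_le (min_le_left _ _)
  · refine tendsto_order.mpr ⟨fun y hy => ?_,
      fun y hy => Eventually.of_forall fun s => (hu s).2.trans hy⟩
    have hy' : max y ((a + b) / 2) ∈ Set.Ioo a b :=
      ⟨lt_of_lt_of_le (by linarith) (le_max_right _ _), max_lt hy (by linarith)⟩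
    filter_upwards [eventually_gt_atTop (T (max y ((a + b) / 2)))] with s hs
    exact (le_max_left _ _).trans_lt (hlt hy' hs)

/-- By `h` the reciprocal of the right-hand side is a sum of partial fractions, so `T` is a sum of
logarithms. Positivity of `p` and `q` gives the infinite limits at the ends; the third logarithm
stays bounded because `-β` lies outside the closed interval. -/
theorem exists_solution_of_partial_fractions {β σ p q r : ℝ} (hp : 0 < p) (hq : 0 < q)
    (hσ : ∀ x ∈ Set.Ioo (-2 : ℝ) 1, 0 < σ * ((1 - x) * (x + 2) * (x + β)))
    (hβ : ∀ x ∈ Set.Icc (-2 : ℝ) 1, x + β ≠ 0)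
    (h : ∀ x, p * ((x + 2) * (x + β)) + q * ((1 - x) * (x + β)) + r * ((1 - x) * (x + 2)) = σ⁻¹) :
    ∃ u : ℝ → ℝ, (∀ t, u t ∈ Set.Ioo (-2 : ℝ) 1) ∧
      (∀ t, HasDerivAt u (σ * ((1 - u t) * (u t + 2) * (u t + β))) t) ∧
      Tendsto u atBot (𝓝 (-2)) ∧ Tendsto u atTop (𝓝 1) := by
  refine exists_solution_of_antideriv (g := fun x => σ * ((1 - x) * (x + 2) * (x + β)))
    (T := fun x => -p * Real.log (1 - x) + q * Real.log (x + 2) + r * Real.log (x + β))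
    (by norm_num) hσ ?_ ?_ ?_
  · intro x hx
    have h1 : 1 - x ≠ 0 := by linarith [hx.2]
    have h2 : x + 2 ≠ 0 := by linarith [hx.1]
    have h3 := hβ x ⟨hx.1.le, hx.2.le⟩
    have d1 := (((hasDerivAt_id x).const_sub 1).log h1).const_mul (-p)
    have d2 := (((hasDerivAt_id x).add_const 2).log h2).const_mul q
    -- `Real.log` is the logarithm of the absolute value, so a negative `x + β` needs no separate
    -- treatment.
    have d3 := (((hasDerivAt_id x).add_const β).log h3).const_mul r
    refine ((d1.fun_add d2).fun_add d3).congr_deriv ?_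
    rw [mul_inv, ← h x]
    simp only [id]
    field_simp
  · have l1 : Tendsto (fun x : ℝ => -p * Real.log (1 - x)) (𝓝[>] (-2)) (𝓝 (-p * Real.log (1 - -2))) := by
      refine Tendsto.mono_left (ContinuousAt.tendsto ?_) nhdsWithin_le_nhds
      exact ((continuousAt_const.sub continuousAt_id).log (by norm_num)).const_mul _
    have l2 : Tendsto (fun x : ℝ => q * Real.log (x + 2)) (𝓝[>] (-2)) atBot := by
      refine Tendsto.const_mul_atBot hq (Real.tendsto_log_nhdsGT_zero.comp ?_)
      refine tendsto_nhdsWithin_iff.mpr ⟨?_, ?_⟩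
      · have : Tendsto (fun x : ℝ => x + 2) (𝓝 (-2)) (𝓝 (-2 + 2)) :=
          (continuous_add_const 2).tendsto _
        rw [neg_add_cancel] at this
        exact this.mono_left nhdsWithin_le_nhds
      · filter_upwards [self_mem_nhdsWithin] with x hx
        have : -2 < x := hx
        exact show 0 < x + 2 by linarith
    have l3 : Tendsto (fun x : ℝ => r * Real.log (x + β)) (𝓝[>] (-2))
        (𝓝 (r * Real.log (-2 + β))) := by
      refine Tendsto.mono_left (ContinuousAt.tendsto ?_) nhdsWithin_le_nhds
      exact ((continuousAt_id.add continuousAt_const).log (hβ _ (by norm_num))).const_mul _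
    exact (l1.add_atBot l2).atBot_add l3
  · have l1 : Tendsto (fun x : ℝ => -p * Real.log (1 - x)) (𝓝[<] 1) atTop := by
      refine Tendsto.const_mul_atBot_of_neg (by linarith) (Real.tendsto_log_nhdsGT_zero.comp ?_)
      refine tendsto_nhdsWithin_iff.mpr ⟨?_, ?_⟩
      · have : Tendsto (fun x : ℝ => 1 - x) (𝓝 1) (𝓝 (1 - 1)) :=
          (continuous_sub_left 1).tendsto _
        rw [sub_self] at this
        exact this.mono_left nhdsWithin_le_nhds
      · filter_upwards [self_mem_nhdsWithin] with x hx
        have : x < 1 := hx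
        exact show 0 < 1 - x by linarith
    have l2 : Tendsto (fun x : ℝ => q * Real.log (x + 2)) (𝓝[<] 1) (𝓝 (q * Real.log (1 + 2))) := by
      refine Tendsto.mono_left (ContinuousAt.tendsto ?_) nhdsWithin_le_nhds
      exact ((continuousAt_id.add continuousAt_const).log (by norm_num)).const_mul _
    have l3 : Tendsto (fun x : ℝ => r * Real.log (x + β)) (𝓝[<] 1)
        (𝓝 (r * Real.log (1 + β))) := by
      refine Tendsto.mono_left (ContinuousAt.tendsto ?_) nhdsWithin_le_nhds
      exact ((continuousAt_id.add continuousAt_const).log (hβ _ (by norm_num))).const_mul _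
    exact (l1.atTop_add l2).atTop_add l3

theorem exists_increasing_solution {β : ℝ} (hβ : 2 < β) :
    ∃ u : ℝ → ℝ, (∀ t, u t ∈ Set.Ioo (-2 : ℝ) 1) ∧
      (∀ t, HasDerivAt u ((1 - u t) * (u t + 2) * (u t + β)) t) ∧
      Tendsto u atBot (𝓝 (-2)) ∧ Tendsto u atTop (𝓝 1) := by
  have h1 : 0 < 1 + β := by linarith
  have h2 : 0 < β - 2 := by linarith
  -- The coefficients come from evaluating the identity `h` at `1`, `-2` and `-β`.
  have := exists_solution_of_partial_fractions (β := β) (σ := 1) (p := (3 * (1 + β))⁻¹)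
    (q := (3 * (β - 2))⁻¹) (r := -((1 + β) * (β - 2))⁻¹) (by positivity) (by positivity)
    (fun x hx => by
      have e1 : 0 < 1 - x := by linarith [hx.2]
      have e2 : 0 < x + 2 := by linarith [hx.1]
      have e3 : 0 < x + β := by linarith [hx.1]
      positivity)
    (fun x hx => by linarith [hx.1]) (fun x => by field_simp; ring)
  simpa only [one_mul] using this

theorem exists_decreasing_solution {β : ℝ} (hβ : β < -1) :
    ∃ u : ℝ → ℝ, (∀ t, u t ∈ Set.Ioo (-2 : ℝ) 1) ∧
      (∀ t, HasDerivAt u ((1 - u t) * (u t + 2) * (u t + β)) t) ∧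
      Tendsto u atBot (𝓝 1) ∧ Tendsto u atTop (𝓝 (-2)) := by
  have h1 : 0 < -1 - β := by linarith
  have h2 : 0 < 2 - β := by linarith
  -- Here the right-hand side is negative on the interval; `σ = -1` reverses time, and `t ↦ -t`
  -- reverses it back.
  obtain ⟨u, hu, hd, hbot, htop⟩ := exists_solution_of_partial_fractions (β := β) (σ := -1)
    (p := (3 * (-1 - β))⁻¹) (q := (3 * (2 - β))⁻¹) (r := ((-1 - β) * (2 - β))⁻¹)
    (by positivity) (by positivity)
    (fun x hx => by
      have e1 : 0 < 1 - x := by linarith [hx.2]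
      have e2 : 0 < x + 2 := by linarith [hx.1]
      have e3 : 0 < -(x + β) := by linarith [hx.2]
      have := mul_pos (mul_pos e1 e2) e3
      linarith)
    (fun x hx => by linarith [hx.2]) (fun x => by field_simp; ring)
  refine ⟨fun t => u (-t), fun t => hu _, fun t => ?_, htop.comp tendsto_neg_atBot_atTop,
    hbot.comp tendsto_neg_atTop_atBot⟩
  exact ((hd (-t)).comp t (hasDerivAt_neg t)).congr_deriv (by ring)

end HetNet

/-! ### The networks of types A2 and B2 on a sphere through both nodes. -/

namespace HetNet
open scoped InnerProductSpace

/-- The terms with `c 1`, `c 2`, `c 3` contain the product of the last three coordinates and vanish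
on planes that contain the first axis. -/
theorem fieldTwo_plane (A : Fin 4 → ℝ) (B : Fin 4 → Fin 4 → ℝ) (c : Fin 4 → ℝ) {j : Fin 4}
    (hj : j ≠ 0) (x y : ℝ) :
    fieldTwo A B c (x • e 0 + y • e j) =
      (A 0 * x + B 0 0 * x ^ 2 + B 0 j * y ^ 2 + c 0 * x ^ 3) • e 0 +
        (y * (A j + B j 0 * x ^ 2 + B j j * y ^ 2)) • e j := by
  ext i
  rw [smul_e_add_smul_e_apply hj.symm]
  fin_cases j <;> [exact absurd rfl hj; skip; skip; skip] <;> fin_cases i <;>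
    simp [fieldTwo, Fin.sum_univ_four] <;> ring

theorem contDiff_fieldTwo (n : WithTop ℕ∞) (A : Fin 4 → ℝ) (B : Fin 4 → Fin 4 → ℝ)
    (c : Fin 4 → ℝ) : ContDiff ℝ n (fieldTwo A B c) := by
  refine contDiff_euclidean.mpr fun j => ?_
  fin_cases j <;>
  · simp [fieldTwo]
    fun_prop

/-- The group fixes `e 0`, so the first component needs no symmetry in its first variable. The
product of the other three coordinates is multiplied by the determinant, which forces rotations
unless these coefficients vanish. -/
theorem isEquivariant_fieldTwo {Γ : Subgroup O4} (hΓ : Γ ≤ isotropy signGroup (e 0))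
    (A : Fin 4 → ℝ) (B : Fin 4 → Fin 4 → ℝ) (c : Fin 4 → ℝ)
    (h : (∀ j, j ≠ 0 → c j = 0) ∨ Γ ≤ rotationGroup) : IsEquivariant Γ (fieldTwo A B c) := by
  intro γ hγ x
  obtain ⟨⟨s, hs, hγs⟩, h0⟩ := hΓ hγ
  have hs0 : s 0 = 1 := by
    have := congrArg (fun y : E4 => y 0) h0
    simpa [hγs] using this
  have hsq : ∀ i, s i ^ 2 = 1 := fun i => by rcases hs i with h | h <;> simp [h]
  have hc : ∀ j, j ≠ 0 → c j * (s 1 * s 2 * s 3) = c j := by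
    intro j hj
    rcases h with h | h
    · simp [h j hj]
    · have hdet : LinearMap.det (γ.toLinearEquiv : E4 →ₗ[ℝ] E4) = 1 := h hγ
      rw [det_of_signs hγs, hs0, one_mul] at hdet
      rw [hdet, mul_one]
  have hc1 := hc 1 (by decide)
  have hc2 := hc 2 (by decide)
  have hc3 := hc 3 (by decide)
  ext j
  rw [hγs]
  fin_cases j
  · simp [fieldTwo, hγs, mul_pow, hsq, hs0]
  · simp [fieldTwo, hγs, mul_pow, hsq]
    linear_combination (s 1 * x 1 ^ 2 * x 2 * x 3) * hc1 -
      (c 1 * s 2 * s 3 * x 1 ^ 2 * x 2 * x 3) * hsq 1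
  · simp [fieldTwo, hγs, mul_pow, hsq]
    linear_combination (s 2 * x 1 * x 2 ^ 2 * x 3) * hc2 -
      (c 2 * s 1 * s 3 * x 1 * x 2 ^ 2 * x 3) * hsq 2
  · simp [fieldTwo, hγs, mul_pow, hsq]
    linear_combination (s 3 * x 1 * x 2 * x 3 ^ 2) * hc3 -
      (c 3 * s 1 * s 2 * x 1 * x 2 * x 3 ^ 2) * hsq 3

/-! #### The vector field -/

/-- In the plane of the coordinates `0` and `j` the flow on the invariant circle is
`ẋ = (1 - x) (x + 2) (x + slope j)`. -/
def slope : Fin 4 → ℝ := ![0, -3, -4, 3]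

/-- A vector field for which a sphere through `e 0` and `-2 • e 0` is invariant. -/
noncomputable def arcField (c : ℝ) : E4 → E4 :=
  fieldTwo (fun j => if j = 0 then 2 else -1 - 5 / 2 * slope j)
    (fun j i => if j = 0 then (if i = 0 then -1 else slope i) else
      if i = 0 then slope j - 1 / 2 else if i = j then slope j + 1 / 2 else 0) ![-1, c, c, c]

/-- The coefficients are solved for so that the circle `y ^ 2 = (1 - x) * (x + 2)` is invariant: on
it the components are `(1 - x) * (x + 2) * (x + slope j)` and `-y * (2 * x + 1) * (x + slope j) /
2`. -/
theorem arcField_plane (c : ℝ) {j : Fin 4} (hj : j ≠ 0) (x y : ℝ) :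
    arcField c (x • e 0 + y • e j) =
      (x * (1 - x) * (x + 2) + slope j * y ^ 2) • e 0 +
        (y * (-1 - 5 / 2 * slope j + (slope j - 1 / 2) * x ^ 2 + (slope j + 1 / 2) * y ^ 2)) •
          e j := by
  rw [arcField, fieldTwo_plane _ _ _ hj]
  simp only [if_true, if_neg hj, Matrix.cons_val_zero]
  congr 2
  ring

theorem contDiff_arcField (n : WithTop ℕ∞) (c : ℝ) : ContDiff ℝ n (arcField c) :=
  contDiff_fieldTwo n _ _ _

theorem isEquivariant_arcField {Γ : Subgroup O4} (hΓ : Γ ≤ isotropy signGroup (e 0)) {c : ℝ}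
    (h : c = 0 ∨ Γ ≤ rotationGroup) : IsEquivariant Γ (arcField c) := by
  refine isEquivariant_fieldTwo hΓ _ _ _ (h.imp_left fun h j hj => ?_)
  subst h
  fin_cases j <;> first | rfl | exact absurd rfl hj

/-- Eigenvalues at the point `z • e 0`. -/
noncomputable def arcEigenvalue (z : ℝ) (i : Fin 4) : ℝ :=
  if i = 0 then 2 - 2 * z - 3 * z ^ 2 else -1 - 5 / 2 * slope i + (slope i - 1 / 2) * z ^ 2

theorem fderiv_arcField_plane (c z : ℝ) {j : Fin 4} (hj : j ≠ 0) (p q : ℝ) :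
    fderiv ℝ (arcField c) (z • e 0) (p • e 0 + q • e j) =
      (arcEigenvalue z 0 * p) • e 0 + (arcEigenvalue z j * q) • e j := by
  have hd : DifferentiableAt ℝ (arcField c) (z • e 0) :=
    (contDiff_arcField 1 c).differentiable one_ne_zero _
  rw [← hd.lineDeriv_eq_fderiv]
  refine HasLineDerivAt.lineDeriv ?_
  have hline : (fun t : ℝ => arcField c (z • e 0 + t • (p • e 0 + q • e j))) = fun t : ℝ =>
      ((z + t * p) * (1 - (z + t * p)) * (z + t * p + 2) + slope j * (t * q) ^ 2) • e 0 +
        ((t * q) * (-1 - 5 / 2 * slope j + (slope j - 1 / 2) * (z + t * p) ^ 2 +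
          (slope j + 1 / 2) * (t * q) ^ 2)) • e j := by
    funext t
    rw [← arcField_plane c hj]
    congr 1
    rw [smul_add, smul_smul, smul_smul, add_smul, add_assoc]
  rw [HasLineDerivAt, hline]
  have h1 : HasDerivAt (fun t : ℝ => z + t * p) p 0 := by
    simpa using ((hasDerivAt_id (0 : ℝ)).mul_const p).const_add z
  have h2 : HasDerivAt (fun t : ℝ => t * q) q 0 := by
    simpa using (hasDerivAt_id (0 : ℝ)).mul_const q
  have h3 := (((h1.fun_mul (h1.const_sub 1)).fun_mul (h1.add_const 2)).fun_add
    ((h2.fun_pow 2).const_mul (slope j))).smul_const (e 0)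
  have h4 := (h2.fun_mul ((((h1.fun_pow 2).const_mul (slope j - 1 / 2)).const_add
    (-1 - 5 / 2 * slope j)).fun_add ((h2.fun_pow 2).const_mul (slope j + 1 / 2)))).smul_const (e j)
  refine (h3.fun_add h4).congr_deriv ?_
  simp only [arcEigenvalue, if_true, if_neg hj]
  congr 2
  · norm_num
    ring
  · norm_num
    ring

theorem fderiv_arcField (c z : ℝ) (i : Fin 4) :
    fderiv ℝ (arcField c) (z • e 0) (e i) = arcEigenvalue z i • e i := by
  by_cases h : i = 0
  · subst h
    simpa using fderiv_arcField_plane c z (j := 1) (by decide) 1 0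
  · simpa using fderiv_arcField_plane c z h 0 1

/-- The sphere with the diameter from `-2 • e 0` to `e 0`. -/
def arcSphere : Set E4 := {x | x 1 ^ 2 + x 2 ^ 2 + x 3 ^ 2 = (1 - x 0) * (x 0 + 2)}

theorem mem_arcSphere_plane {j : Fin 4} (hj : j ≠ 0) {x y : ℝ} (h : y ^ 2 = (1 - x) * (x + 2)) :
    x • e 0 + y • e j ∈ arcSphere := by
  have hx := smul_e_add_smul_e_apply hj.symm x y
  change _ = _
  fin_cases j <;> [exact absurd rfl hj; skip; skip; skip] <;> simpa [hx] using h

theorem arcSphere_invariant {γ : O4} (hγ : γ ∈ isotropy signGroup (e 0)) {x : E4}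
    (hx : x ∈ arcSphere) : γ x ∈ arcSphere := by
  obtain ⟨⟨s, hs, hγs⟩, h0⟩ := hγ
  have hs0 : s 0 = 1 := by
    have := congrArg (fun y : E4 => y 0) h0
    simpa [hγs] using this
  have hsq : ∀ i, s i ^ 2 = 1 := fun i => by rcases hs i with h | h <;> simp [h]
  change _ = _
  simp only [hγs, mul_pow, hsq, hs0, one_mul]
  exact hx

theorem zero_notMem_arcSphere : (0 : E4) ∉ arcSphere := by
  intro h
  have : (0 : E4) 1 ^ 2 + (0 : E4) 2 ^ 2 + (0 : E4) 3 ^ 2 = (1 - (0 : E4) 0) * ((0 : E4) 0 + 2) := h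
  norm_num at this

theorem arcSphere_axis : ∀ x ∈ arcSphere, ∀ y ∈ arcSphere, ∀ i, (∀ i', i' ≠ i → x i' = 0) →
    (∀ i', i' ≠ i → y i' = 0) → 0 < x i * y i → x i = y i := by
  have key : ∀ x ∈ arcSphere, ∀ i, i ≠ 0 → (∀ i', i' ≠ i → x i' = 0) → x i ^ 2 = 2 := by
    intro x hx i hi h
    have hx' : x 1 ^ 2 + x 2 ^ 2 + x 3 ^ 2 = (1 - x 0) * (x 0 + 2) := hx
    rw [h 0 hi.symm] at hx'
    fin_cases i <;> [exact absurd rfl hi; skip; skip; skip]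
    · rw [h 2 (by decide), h 3 (by decide)] at hx'
      simpa using hx'
    · rw [h 1 (by decide), h 3 (by decide)] at hx'
      simpa using hx'
    · rw [h 1 (by decide), h 2 (by decide)] at hx'
      simpa using hx'
  have key0 : ∀ x ∈ arcSphere, (∀ i', i' ≠ 0 → x i' = 0) → x 0 = 1 ∨ x 0 = -2 := by
    intro x hx h
    have hx' : x 1 ^ 2 + x 2 ^ 2 + x 3 ^ 2 = (1 - x 0) * (x 0 + 2) := hx
    rw [h 1 (by decide), h 2 (by decide), h 3 (by decide)] at hx'
    rcases mul_eq_zero.mp (show (1 - x 0) * (x 0 + 2) = 0 by linarith) with h | h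
    · exact Or.inl (by linarith)
    · exact Or.inr (by linarith)
  intro x hx y hy i hxi hyi hpos
  by_cases hi : i = 0
  · subst hi
    rcases key0 x hx hxi with h | h <;> rcases key0 y hy hyi with h' | h' <;> rw [h, h'] at hpos ⊢ <;>
      norm_num at hpos
  · exact eq_of_sq_eq_sq_of_mul_pos ((key x hx i hi hxi).trans (key y hy i hi hyi).symm) hpos

/-! #### The cycles -/

/-- The positions of the two nodes on their axis. -/
def arcNode : Fin 2 → ℝ := ![1, -2]

/-- The axes that span the planes of the two connections, together with the axis of the nodes. -/
def arcAxis (i : Fin 4) : Fin 2 → Fin 4 := ![i, 3]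

theorem arcNode_injective : Function.Injective arcNode := by
  intro i j h
  fin_cases i <;> fin_cases j <;> first | rfl | (norm_num [arcNode] at h)

theorem arcAxis_ne_zero {i : Fin 4} (hi : i = 1 ∨ i = 2) (j : Fin 2) : arcAxis i j ≠ 0 := by
  rcases hi with rfl | rfl <;> revert j <;> decide

/-- The slopes `-3` and `-4` are below `-1` and make the flow on the arc run from `1` to `-2`; the
slope `3` exceeds `2` and brings it back. -/
theorem exists_arc {i : Fin 4} (hi : i = 1 ∨ i = 2) (j : Fin 2) :
    ∃ u : ℝ → ℝ, (∀ t, u t ∈ Set.Ioo (-2 : ℝ) 1) ∧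
      (∀ t, HasDerivAt u ((1 - u t) * (u t + 2) * (u t + slope (arcAxis i j))) t) ∧
      Tendsto u atBot (𝓝 (arcNode j)) ∧ Tendsto u atTop (𝓝 (arcNode (j + 1))) := by
  fin_cases j
  · refine exists_decreasing_solution (show slope i < -1 from ?_)
    rcases hi with rfl | rfl
    · exact show (-3 : ℝ) < -1 by norm_num
    · exact show (-4 : ℝ) < -1 by norm_num
  · exact exists_increasing_solution (show (2 : ℝ) < 3 by norm_num)

/-- The connecting orbit in the plane of the coordinates `0` and `j`. -/
noncomputable def arc (j : Fin 4) (u : ℝ → ℝ) (t : ℝ) : E4 :=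
  u t • e 0 + √((1 - u t) * (u t + 2)) • e j

theorem hasDerivAt_arc (c : ℝ) {j : Fin 4} (hj : j ≠ 0) {u : ℝ → ℝ}
    (hu : ∀ t, u t ∈ Set.Ioo (-2 : ℝ) 1)
    (hd : ∀ t, HasDerivAt u ((1 - u t) * (u t + 2) * (u t + slope j)) t) (t : ℝ) :
    HasDerivAt (arc j u) (arcField c (arc j u t)) t := by
  have hpos : 0 < (1 - u t) * (u t + 2) :=
    mul_pos (by linarith [(hu t).2]) (by linarith [(hu t).1])
  have hsq := Real.sq_sqrt hpos.le
  have hs := Real.sqrt_pos.mpr hpos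
  have h2 := (((hd t).const_sub 1).fun_mul ((hd t).add_const 2)).sqrt hpos.ne'
  rw [arc, arcField_plane c hj]
  refine (((hd t).smul_const (e 0)).fun_add (h2.smul_const (e j))).congr_deriv ?_
  congr 2
  · rw [hsq]
    ring
  · rw [div_eq_iff (by positivity), hsq]
    have : √((1 - u t) * (u t + 2)) * √((1 - u t) * (u t + 2)) = (1 - u t) * (u t + 2) := by
      rw [← sq, hsq]
    linear_combination (-2 * (-1 - 5 / 2 * slope j + (slope j - 1 / 2) * u t ^ 2 +
      (slope j + 1 / 2) * ((1 - u t) * (u t + 2)))) * this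

theorem tendsto_arc {l : Filter ℝ} {u : ℝ → ℝ} {z : ℝ} (j : Fin 4) (h : Tendsto u l (𝓝 z))
    (hz : (1 - z) * (z + 2) = 0) : Tendsto (arc j u) l (𝓝 (z • e 0)) := by
  have h1 := ((h.const_sub 1).mul (h.add_const 2)).sqrt
  rw [hz, Real.sqrt_zero] at h1
  have h2 := (h.smul_const (e 0)).add (h1.smul_const (e j))
  rw [zero_smul, add_zero] at h2
  exact h2

theorem arc_apply_self {j : Fin 4} (hj : j ≠ 0) {u : ℝ → ℝ} {t : ℝ}
    (hu : u t ∈ Set.Ioo (-2 : ℝ) 1) : arc j u t j ≠ 0 := by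
  have hpos : 0 < (1 - u t) * (u t + 2) := mul_pos (by linarith [hu.2]) (by linarith [hu.1])
  rw [arc, smul_e_add_smul_e_apply hj.symm, if_neg hj, if_pos rfl]
  exact (Real.sqrt_pos.mpr hpos).ne'

theorem arcNode_root (j : Fin 2) : (1 - arcNode j) * (arcNode j + 2) = 0 := by
  fin_cases j <;> norm_num [arcNode]

/-- The slopes also have to keep the spectra simple: they give `-3, 3, 9/2, -6` at `1` and `-6,
-15/2, -9, 3/2` at `-2`. -/
theorem arcEigenvalue_injective (j : Fin 2) : Function.Injective (arcEigenvalue (arcNode j)) := by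
  intro i i' h
  fin_cases j <;> fin_cases i <;> fin_cases i' <;>
    first | rfl | (norm_num [arcEigenvalue, arcNode, slope] at h)

theorem arcEigenvalue_one {i : Fin 4} (hi : i ≠ 0) :
    arcEigenvalue 1 i = -3 / 2 * (slope i + 1) := by
  rw [arcEigenvalue, if_neg hi]
  ring

theorem arcEigenvalue_neg_two {i : Fin 4} (hi : i ≠ 0) :
    arcEigenvalue (-2) i = 3 / 2 * (slope i - 2) := by
  rw [arcEigenvalue, if_neg hi]
  ring

theorem arcEigenvalue_zero_neg (j : Fin 2) : arcEigenvalue (arcNode j) 0 < 0 := by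
  fin_cases j <;> norm_num [arcEigenvalue, arcNode]

theorem arcEigenvalue_arcAxis_pos {i : Fin 4} (hi : i = 1 ∨ i = 2) (j : Fin 2) :
    0 < arcEigenvalue (arcNode j) (arcAxis i j) := by
  fin_cases j
  · change 0 < arcEigenvalue 1 i
    rcases hi with rfl | rfl
    · rw [arcEigenvalue_one (by decide), show slope 1 = -3 from rfl]
      norm_num
    · rw [arcEigenvalue_one (by decide), show slope 2 = -4 from rfl]
      norm_num
  · change 0 < arcEigenvalue (-2) 3
    rw [arcEigenvalue_neg_two (by decide), show slope 3 = 3 from rfl]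
    norm_num

theorem arcEigenvalue_arcAxis_neg {i : Fin 4} (hi : i = 1 ∨ i = 2) (j : Fin 2) :
    arcEigenvalue (arcNode (j + 1)) (arcAxis i j) < 0 := by
  fin_cases j
  · change arcEigenvalue (-2) i < 0
    rcases hi with rfl | rfl
    · rw [arcEigenvalue_neg_two (by decide), show slope 1 = -3 from rfl]
      norm_num
    · rw [arcEigenvalue_neg_two (by decide), show slope 2 = -4 from rfl]
      norm_num
  · change arcEigenvalue 1 3 < 0
    rw [arcEigenvalue_one (by decide), show slope 3 = 3 from rfl]
    norm_num

theorem eq_zero_of_arcAxis {i : Fin 4} (hi : i = 1 ∨ i = 2) (j : Fin 2) (l : Fin 4)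
    (h : l = 0 ∨ l = arcAxis i j) (h' : l = 0 ∨ l = arcAxis i (j + 1)) : l = 0 := by
  rcases hi with rfl | rfl <;> revert j l <;> decide

/-- The heteroclinic cycle in the planes of the coordinates `0, i` and `0, 3`. -/
noncomputable def arcCycle {Γ : Subgroup O4} (hΓ : Γ ≤ isotropy signGroup (e 0))
    (hκ : ∀ j : Fin 4, j ≠ 0 → kappa 0 j ∈ Γ) (c : ℝ) (i : Fin 4) (hi : i = 1 ∨ i = 2) :
    CoordCycle Γ (arcField c) arcSphere where
  k := 1
  k_pos := one_pos
  node := fun j => arcNode j • e 0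
  traj := fun j => arc (arcAxis i j) (exists_arc hi j).choose
  a := fun _ => 0
  b := arcAxis i
  c := fun _ => 0
  lam := fun j => arcEigenvalue (arcNode j)
  ne := fun j => (arcAxis_ne_zero hi j).symm
  kappa_mem := fun j => hκ _ (arcAxis_ne_zero hi j)
  inter := eq_zero_of_arcAxis hi
  onAxis := fun j => onAxis_smul_e _ _
  distinct := fun j l hjl => by
    rintro ⟨γ, hγ, h⟩
    rw [map_smul, (hΓ hγ).2] at h
    have h1 := congrArg (fun x : E4 => x 0) h
    exact hjl (arcNode_injective (by simpa using h1))
  equilibrium := fun j => by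
    have := arcField_plane c (j := 1) (by decide) (arcNode j) 0
    rw [mul_assoc, arcNode_root] at this
    simpa using this
  node_mem := fun j => Submodule.smul_mem _ _ (Submodule.subset_span (by simp))
  node_succ_mem := fun j => Submodule.smul_mem _ _ (Submodule.subset_span (by simp))
  fderiv_node := fun j l => fderiv_arcField c (arcNode j) l
  lam_injective := arcEigenvalue_injective
  saddle_neg := arcEigenvalue_zero_neg
  saddle_pos := arcEigenvalue_arcAxis_pos hi
  sink_left := fun j => arcEigenvalue_zero_neg (j + 1)
  sink_right := arcEigenvalue_arcAxis_neg hi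
  solution := fun j t => hasDerivAt_arc c (arcAxis_ne_zero hi j) (exists_arc hi j).choose_spec.1
    (exists_arc hi j).choose_spec.2.1 t
  traj_mem := fun j t => Submodule.mem_span_pair.mpr ⟨_, _, rfl⟩
  tendsto_source := fun j =>
    tendsto_arc _ (exists_arc hi j).choose_spec.2.2.1 (arcNode_root j)
  tendsto_target := fun j =>
    tendsto_arc _ (exists_arc hi j).choose_spec.2.2.2 (arcNode_root (j + 1))
  node_mem_set := fun j => by
    have := mem_arcSphere_plane (j := 1) (by decide) (x := arcNode j) (y := 0)
      (by rw [arcNode_root]; norm_num)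
    simpa using this
  traj_mem_set := fun j t => mem_arcSphere_plane (arcAxis_ne_zero hi j) (Real.sq_sqrt (by
    have := (exists_arc hi j).choose_spec.1 t
    exact (mul_pos (by linarith [this.2]) (by linarith [this.1])).le))

/-- Two heteroclinic cycles of `arcField c`. -/
noncomputable def arcCycles {Γ : Subgroup O4} (hΓ : Γ ≤ isotropy signGroup (e 0))
    (hκ : ∀ j : Fin 4, j ≠ 0 → kappa 0 j ∈ Γ) (c : ℝ) :
    Fin 2 → CoordCycle Γ (arcField c) arcSphere :=
  ![arcCycle hΓ hκ c 1 (Or.inl rfl), arcCycle hΓ hκ c 2 (Or.inr rfl)]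

/-- The two cycles have the same nodes and the same plane for the return, and differ in the plane of
the connection that leaves `e 0`. The map `-Id` is not in the group, because the group fixes `e 0`.
-/
theorem supports_arcField (n : WithTop ℕ∞) {Γ : Subgroup O4} (hΓ : Γ ≤ isotropy signGroup (e 0))
    (hκ : ∀ j : Fin 4, j ≠ 0 → kappa 0 j ∈ Γ) {c : ℝ} (hc : c = 0 ∨ Γ ≤ rotationGroup)
    {kind : Kind}
    (hkind : ∀ C : Cycle Γ (arcField c), C.IsSimple → C.k = 1 → (∃ j, C.node (j + 1) = e 0) →
      C.label.kind = kind) :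
    Supports n Γ (arcField c) {⟨kind, 2, false⟩, ⟨kind, 2, false⟩} := by
  have hΓ' : Γ ≤ signGroup := fun γ hγ => (hΓ hγ).1
  have hne : groupOrbit Γ ((arcCycles hΓ hκ c 0).toCycle hΓ').carrier ≠
      groupOrbit Γ ((arcCycles hΓ hκ c 1).toCycle hΓ').carrier := fun h => by
    refine absurd (show ∃ l : Fin 2, (1 : Fin 4) = 0 ∨ (1 : Fin 4) = arcAxis 2 l from
      CoordCycle.exists_axis_of_groupOrbit_eq h (i := 1)
        (y := (arcCycles hΓ hκ c 0).traj (0 : Fin 2) 0)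
        (Or.inr (Set.mem_iUnion.mpr ⟨(0 : Fin 2), 0, rfl⟩)) ?_) (by decide)
    exact arc_apply_self (by decide) ((exists_arc (Or.inl rfl) 0).choose_spec.1 0)
  have hnode : ∀ i, ((arcCycles hΓ hκ c i).toCycle hΓ').k = 1 ∧
      ∃ j, ((arcCycles hΓ hκ c i).toCycle hΓ').node (j + 1) = e 0 := by
    intro i
    have h : arcNode (1 + 1) • e 0 = e 0 := by
      rw [show arcNode (1 + 1) = 1 from rfl, one_smul]
    fin_cases i <;> exact ⟨rfl, (1 : Fin 2), h⟩
  obtain ⟨N, hN, hA, hmem, hτ⟩ := CoordCycle.exists_network hΓ'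
    (fun γ hγ x hx => arcSphere_invariant (hΓ hγ) hx) zero_notMem_arcSphere arcSphere_axis
    (le_refl 2) (arcCycles hΓ hκ c)
    (fun i j h => by
      fin_cases i <;> fin_cases j <;> first | rfl | exact absurd h hne | exact absurd h.symm hne)
    (x := e 0) (fun i => by
      obtain ⟨-, j, hj⟩ := hnode i
      exact Or.inl ⟨_, hj⟩)
  refine ⟨finite_of_le_signGroup hΓ', contDiff_arcField n c, isEquivariant_arcField hΓ hc, N, hN, hA,
    ?_⟩
  have hneg : (LinearIsometryEquiv.neg ℝ : O4) ∉ Γ := fun h => by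
    have := congrArg (fun x : E4 => x 0) (hΓ h).2
    rw [neg_apply] at this
    norm_num at this
  have hlab : ∀ i, ((arcCycles hΓ hκ c i).toCycle hΓ').label = ⟨kind, 2, false⟩ := by
    intro i
    obtain ⟨hk, hj⟩ := hnode i
    have hsize := Cycle.numOrbits_eq (C := (arcCycles hΓ hκ c i).toCycle hΓ')
      (arcCycles hΓ hκ c i).distinct
    rw [hk] at hsize
    have h1 := hkind _ (hN.simple_cycles _ (hmem i)) hk hj
    rw [← h1]
    simp only [Cycle.label, hsize, hneg, decide_false]
  rw [Multiset.map_congr rfl fun i _ => hlab i] at hτ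
  exact hτ

theorem supports_GammaTwo (n : WithTop ℕ∞) : Supports n GammaTwo (arcField 1) {A2, A2} :=
  supports_arcField n GammaTwo_le_isotropy (fun _ h => kappa_mem_GammaTwo h)
    (Or.inr GammaTwo_le_rotationGroup) fun C hC _ _ => if_pos <|
      (C.isTypeA_iff hC (contDiff_arcField 1 1)
        (isEquivariant_arcField GammaTwo_le_isotropy (Or.inr GammaTwo_le_rotationGroup)) 0).mpr
          (not_hasOddIsotropy GammaTwo_le_rotationGroup _)

theorem supports_isotropy_signGroup (n : WithTop ℕ∞) :
    Supports n (isotropy signGroup (e 0)) (arcField 0) {B2, B2} := by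
  have hrefl : reflectLast ∈ isotropy signGroup (e 0) := by
    refine ⟨reflectLast_mem_signGroup, ?_⟩
    rw [signGroup_apply_e reflectLast_apply]
    simp
  refine supports_arcField n le_rfl (fun j h => GammaTwo_le_isotropy (kappa_mem_GammaTwo h))
    (Or.inl rfl) fun C hC hk hj => ?_
  obtain ⟨j, hj⟩ := hj
  have hf := contDiff_arcField 1 0
  have he := isEquivariant_arcField (le_refl (isotropy signGroup (e 0))) (c := 0) (Or.inl rfl)
  have hodd : HasOddIsotropy (isotropy signGroup (e 0)) (C.node (j + 1)) := by
    rw [hj]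
    exact hasOddIsotropy_of_reflectLast_mem hrefl
  have hA : ¬ C.IsTypeA := by
    rw [C.isTypeA_iff hC hf he (j + 1), not_not]
    exact hodd
  have hB : C.IsTypeB := C.isTypeB_of_odd hC hf he hodd fun l => by
    rcases fin_eq_or_eq_succ hk l j with rfl | rfl
    · exact le_sup_left
    · exact le_sup_right
  simp only [Cycle.label, if_neg hA, if_pos hB]

end HetNet

theorem mainTheorem1 (n : WithTop ℕ∞) (hn : 1 ≤ n) :
    {τ : Multiset HetNet.Label |
        ∃ (Γ : Subgroup HetNet.O4) (f : HetNet.E4 → HetNet.E4), HetNet.Supports n Γ f τ} =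
      {{HetNet.A2, HetNet.A2}, {HetNet.A3, HetNet.A3}, {HetNet.A3, HetNet.A4},
        {HetNet.A3, HetNet.A3, HetNet.A4},
        {HetNet.B2, HetNet.B2}, {HetNet.B3, HetNet.B3},
        {HetNet.B3, HetNet.C4}, {HetNet.B3, HetNet.B3, HetNet.C4}} ∧
    (∃ (a : Fin 4 → ℝ) (b : Fin 4 → Fin 4 → ℝ) (c : Fin 4 → ℝ), (∀ j, c j ≠ 0) ∧
      HetNet.Supports n HetNet.GammaTwo (HetNet.fieldTwo a b c) {HetNet.A2, HetNet.A2}) ∧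
    (∀ τ ∈ ({{HetNet.A3, HetNet.A3}, {HetNet.A3, HetNet.A4},
        {HetNet.A3, HetNet.A3, HetNet.A4}} : Set (Multiset HetNet.Label)),
      ∃ (a : Fin 4 → ℝ) (b : Fin 4 → Fin 4 → ℝ) (c : Fin 4 → ℝ), (∀ j, c j ≠ 0) ∧
        HetNet.Supports n HetNet.GammaThree (HetNet.fieldThree a b c) τ) := by
  refine ⟨Set.Subset.antisymm ?_ ?_, ⟨_, _, _, ?_, HetNet.supports_GammaTwo n⟩, fun τ hτ =>
    ⟨_, _, _, fun _ => one_ne_zero, HetNet.supports_GammaThree n hτ⟩⟩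
  · rintro τ ⟨Γ, f, h⟩
    exact h.type_mem hn
  · rintro τ (rfl | rfl | rfl | rfl | rfl | rfl | rfl | rfl)
    · exact ⟨_, _, HetNet.supports_GammaTwo n⟩
    · exact ⟨_, _, HetNet.supports_GammaThree n (by simp)⟩
    · exact ⟨_, _, HetNet.supports_GammaThree n (by simp)⟩
    · exact ⟨_, _, HetNet.supports_GammaThree n (by simp)⟩
    · exact ⟨_, _, HetNet.supports_isotropy_signGroup n⟩
    · exact ⟨_, _, HetNet.supports_signGroup n (by simp)⟩
    · exact ⟨_, _, HetNet.supports_signGroup n (by simp)⟩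
    · exact ⟨_, _, HetNet.supports_signGroup n (by simp)⟩
  · intro j
    fin_cases j <;> norm_num
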